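/- **Setting.** Let $G$ be a group and $\Bbbk$ a commutative ring. A *$G$-ribbon category* is a monoidal category $\mathcal C$ with $\Bbbk$-linear Hom-modules and $\Bbbk$-bilinear $\circ$ and $\otimes$, together with the following data. * A $G$-grading: pairwise disjoint full subcategories $\mathcal C_\alpha$ ($\alpha\in G$) with $\mathbb 1\in\mathcal C_1$, $\mathcal C_\alpha\otimes\mathcal C_\beta\subset\mathcal C_{\alpha\beta}$, and $\mathrm{Hom}(X,Y)=0$ for $X\in\mathcal C_\alpha$, $Y\in\mathcal C_\beta$, $\alpha\ne\beta$. Objects of $\mathcal C_\alpha$ are homogeneous of degree $|X|=\alpha$. * A pivotal duality $(X^*,\mathrm{ev}_X,\mathrm{coev}_X,\widetilde{\mathrm{ev}}_X,\widetilde{\mathrm{coev}}_X)$ (left and right dual functors coincide as monoidal functors) with $X^*\in\mathcal C_{\alpha^{-1}}$ for $X\in\mathcal C_\alpha$. Put $X^+=X$, $X^-=X^*$. * A pivotal crossing: $\Bbbk$-linear strong monoidal auto-equivalences $\varphi_\alpha$ of $\mathcal C$ with $\varphi_\alpha(\mathcal C_\beta)\subset\mathcal C_{\alpha^{-1}\beta\alpha}$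 and coherent monoidal natural isomorphisms $\varphi_2(\alpha,\beta)\colon\varphi_\alpha\varphi_\beta\cong\varphi_{\beta\alpha}$, $\varphi_0\colon 1_{\mathcal C}\cong\varphi_1$, such that the two canonical morphisms $\varphi_\alpha(X^*)\to\varphi_\alpha(X)^*$ defined by the left and the right duality coincide; denote them by $\varphi^1_\alpha(X)$. * A $G$-braiding: natural isomorphisms $\tau_{X,Y}\colon X\otimes Y\to Y\otimes\varphi_{|Y|}(X)$ for $X\in\mathcal C$ and homogeneous $Y$, with $\tau_{X,Y\otimes Z}=(\mathrm{id}\otimes\varphi_2(|Z|,|Y|)_X)(\mathrm{id}_Y\otimes\tau_{\varphi_{|Y|}(X),Z})(\tau_{X,Y}\otimes\mathrm{id}_Z)$, $\tau_{X\otimes Y,Z}=(\mathrm{id}\otimes(\varphi_{|Z|})_2(X,Y))(\tau_{X,Z}\otimes\mathrm{id})(\mathrm{id}_X\otimes\tau_{Y,Z})$, $\varphi_\alpha(\tau_{X,Y})(\varphi_\alpha)_2(X,Y)=(\varphi_\alpha)_2(Y,\varphi_{|Y|}(X))\bigl(\mathrm{id}\otimes\varphi_2(\alpha,|Y|)_X^{-1}\varphi_2(\alpha^{-1}|Y|\alpha,\alpha)_X\bigr)\tau_{\varphi_\alpha(X),\varphi_\alpha(Y)}$.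 * The twist $\theta_X=(\mathrm{ev}_X\otimes\mathrm{id})(\mathrm{id}_{X^*}\otimes\tau_{X,X})(\widetilde{\mathrm{coev}}_X\otimes\mathrm{id}_X)\colon X\to\varphi_\alpha(X)$, $X\in\mathcal C_\alpha$, is self-dual: $\theta_X^*=(\varphi_0)_X^*\,(\varphi_2(\alpha^{-1},\alpha)_X^{-1})^*\,\varphi^1_{\alpha^{-1}}(\varphi_\alpha(X))\,\theta_{\varphi_\alpha(X)^*}$. For an isomorphism $\psi\colon X\to\varphi_\alpha(Y)$ put $\overline\psi=\varphi_{\alpha^{-1}}(\psi^{-1})\,\varphi_2(\alpha^{-1},\alpha)_Y^{-1}\,(\varphi_0)_Y\colon Y\to\varphi_{\alpha^{-1}}(X)$, $\psi^+=\psi$ and $\psi^-=\varphi_\alpha^1(Y)^{-1}(\psi^{-1})^*\colon X^*\to\varphi_\alpha(Y^*)$. **Colored diagrams.** A graph diagram is a diagram in $\mathbb R\times[0,1]$ of oriented strands and of coupons with over/under crossings; an underpass runs along a strand between consecutive overcrossing points of it. In a $\mathcal C$-colored diagram every underpass is colored with a non-zero homogeneous object and every crossing with an isomorphism $\psi$ as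 below; a coupon whose $m$ bottom and $n$ top strands have signed colors $(U_i,\varepsilon_i)$, $(U^j,\varepsilon^j)$ (sign $+$ for strands directed downwards), $\prod|U_i|^{\varepsilon_i}=\prod|U^j|^{\varepsilon^j}$, is colored with a morphism $v\colon\bigotimes_iU_i^{\varepsilon_i}\to\bigotimes_j(U^j)^{\varepsilon^j}$. Diagrams are read from the bottom to the top. For strands directed downwards there is the positive crossing $\sigma_+(X,Y,X',\psi)\colon(X,Y)\to(Y,X')$, $\psi\colon X'\cong\varphi_{|Y|}(X)$, in which the strand from the bottom left passes over and changes its color from $X$ to $X'$, and the negative crossing $\sigma_-(X,Y,Y',\psi)\colon(X,Y)\to(Y',X)$, $\psi\colon Y\cong\varphi_{|X|}(Y')$, in which the strand from the bottom right passes over. Crossings with other orientations are rotations of these. The strict monoidal category $\mathcal D_{\mathcal C}$ has as objects the finite sequences of signed colors and as morphisms the colored diagrams up to plane isotopy and isomorphism of colorings (families of isomorphisms of the colors of underpasses, identities at the inputs and outputs, compatible with the colors of all crossings and coupons); composition is stacking and $\otimes$ is juxtaposition. **Theorem.** For any $G$-ribbon category $\mathcal C$ there is a unique strong monoidal functor $\mathcal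 F\colon\mathcal D_{\mathcal C}\to\mathcal C$ that carries $((U_r,\varepsilon_r))_r$ to $\bigotimes_rU_r^{\varepsilon_r}$, with $\mathcal F_0=\mathrm{id}$, $\mathcal F_2$ the canonical isomorphisms given by the constraints of $\mathcal C$, that carries the caps and cups directed to the right (left) to $\mathrm{ev},\mathrm{coev}$ ($\widetilde{\mathrm{ev}},\widetilde{\mathrm{coev}}$), a coupon to its color, $\sigma_+(X,Y,X',\psi)$ to $(\mathrm{id}_Y\otimes\psi^{-1})\tau_{X,Y}$ and $\sigma_-(X,Y,Y',\psi)$ to $\tau_{Y',X}^{-1}(\mathrm{id}_X\otimes\psi)$. Moreover $\mathcal F(D)=\mathcal F(D')$ whenever $D$ and $D'$ are related by one of the following local moves (identical outside a disk) or its inverse. 1. *Type 1* (four moves). A downward $X$-colored strand is replaced with two successive curls on its left, or two on its right, with crossings of opposite signs in either order. The strand between the curls has color $X'$ and both crossings have the same color, $\psi\colon X'\cong\varphi_{|X|}(X)$ if the first (lower) curl is positive, $\psi\colon X\cong\varphi_{|X|}(X')$ if it is negative. 2. *Type 2* (four moves). Two parallel vertical strands colored $X$ (left) and $Y$ (right)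 are replaced with two opposite crossings with the same color $\psi$: (a) both directed downwards, the right strand passes over and has color $Y'$ in between, $\psi\colon Y\cong\varphi_{|X|}(Y')$; (b) both directed downwards, the left strand passes over and has color $X'$ in between, $\psi\colon X'\cong\varphi_{|Y|}(X)$; (c) $X$ upwards, $Y$ downwards and over, $\psi\colon Y'\cong\varphi_{|X|}(Y)$; (d) $X$ downwards, $Y$ upwards and over, $\psi\colon Y\cong\varphi_{|X|}(Y')$. 3. *Type 3*. For downward strands $X,Y,Z$, the diagram with crossings $A\colon X'\cong\varphi_{|Y|}(X)$, $B\colon X''\cong\varphi_{|Z|}(X')$, $C\colon Y'\cong\varphi_{|Z|}(Y)$, i.e. $\sigma_+(X,Y,X',A)$, then $\sigma_+(X',Z,X'',B)$, then $\sigma_+(Y,Z,Y',C)$, is replaced with $\sigma_+(Y,Z,Y',C)$, then $\sigma_+(X,Z,\widetilde X,A')$, then $\sigma_+(\widetilde X,Y',X'',B')$, where $A'\colon\widetilde X\cong\varphi_{|Z|}(X)$, $B'\colon X''\cong\varphi_{|Y'|}(\widetilde X)$ and $\varphi_2(|Y'|,|Z|)_X\,\varphi_{|Y'|}(A')\,B'=\varphi_2(|Z|,|Y|)_X\,\varphi_{|Z|}(A)\,B$.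 4. *Type 4*. (i) A downward $Z$-colored strand on the left of a coupon colored with $v_0\colon\bigotimes_iX_i^{\varepsilon_i}\to\bigotimes_j(Y^j)^{\varepsilon^j}$, which passes above the coupon from the left to the right behind its exits (crossings $\psi^j\colon Y^j\cong\varphi_{|Z|}(X^j)$), is pushed behind the coupon, so that it passes from the left to the right below the coupon behind its entries (crossings $\psi_i\colon X_i\cong\varphi_{|Z|}(Y_i)$), and the coupon becomes colored with $v_1\colon\bigotimes_iY_i^{\varepsilon_i}\to\bigotimes_j(X^j)^{\varepsilon^j}$, provided that, for $\mu=|Z|$, $$(\varphi_\mu)_n\circ\bigl(\textstyle\bigotimes_j(\psi^j)^{\varepsilon^j}\bigr)\circ v_0=\varphi_\mu(v_1)\circ(\varphi_\mu)_m\circ\bigl(\bigotimes_i\psi_i^{\varepsilon_i}\bigr).$$ (ii) The same with the $Z$-strand directed upwards, with crossings $\psi_i\colon Y_i\cong\varphi_{|Z|}(X_i)$, $\psi^j\colon X^j\cong\varphi_{|Z|}(Y^j)$, and with $\mu=|Z|^{-1}$ and $\overline{\psi_i},\overline{\psi^j}$ instead of $\psi_i,\psi^j$ in the condition. (iii) A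 downward strand is pushed from above to below a coupon in front of it; the coupon keeps its color $v$. Its bottom and top strands have signed colors $(Y_i,\varepsilon_i)_{i\le m}$, $(Y^j,\varepsilon^j)_{j\le n}$; the strand has successive colors $X_0,\dots,X_m$ along the entries and $X^0=X_0,\dots,X^n=X_m$ along the exits, with crossing colors $\psi_i\colon X_i\cong\varphi_{|Y_i|}(X_{i-1})$ if $\varepsilon_i=+$, $\psi_i\colon X_{i-1}\cong\varphi_{|Y_i|}(X_i)$ if $\varepsilon_i=-$, and similarly $\psi^j$. The condition is that the composition $$X_m\to\varphi_{y_m}(X_{m-1})\to\cdots\to\varphi_{y_m}\cdots\varphi_{y_1}(X_0)\to\varphi_{y_1\cdots y_m}(X_0),\qquad y_i=|Y_i|^{\varepsilon_i},$$ induced by the $\psi_i$ (by $\overline{\psi_i}$ if $\varepsilon_i=-$) and by $\varphi_2,\varphi_0$, equals the analogous composition $X^n\to\varphi_{y^1\cdots y^n}(X^0)$ for the $\psi^j$. (iv) The same with the strand directed upwards. 5. *Stabilization*. A coupon colored with $\mathrm{id}_X$ is inserted into a downward $X$-colored strand. -/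

import Mathlib

open CategoryTheory MonoidalCategory

universe v u w

namespace GRibbon

class PivotalCategory (C : Type u) [Category.{v} C] [MonoidalCategory C] where
  dual : C → C
  ev (X : C) : dual X ⊗ X ⟶ 𝟙_ C
  coev (X : C) : 𝟙_ C ⟶ X ⊗ dual X
  evt (X : C) : X ⊗ dual X ⟶ 𝟙_ C
  coevt (X : C) : 𝟙_ C ⟶ dual X ⊗ X
  coev_ev (X : C) : 𝟙 X ⊗≫ coev X ▷ X ⊗≫ X ◁ ev X ⊗≫ 𝟙 X = 𝟙 X
  ev_coev (X : C) :
    𝟙 (dual X) ⊗≫ dual X ◁ coev X ⊗≫ ev X ▷ dual X ⊗≫ 𝟙 (dual X) = 𝟙 (dual X)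
  coevt_evt (X : C) : 𝟙 X ⊗≫ X ◁ coevt X ⊗≫ evt X ▷ X ⊗≫ 𝟙 X = 𝟙 X
  evt_coevt (X : C) :
    𝟙 (dual X) ⊗≫ coevt X ▷ dual X ⊗≫ dual X ◁ evt X ⊗≫ 𝟙 (dual X) = 𝟙 (dual X)
  left_dual_eq_right_dual {X Y : C} (f : X ⟶ Y) :
    𝟙 (dual Y) ⊗≫ dual Y ◁ coev X ⊗≫ dual Y ◁ f ▷ dual X ⊗≫ ev Y ▷ dual X ⊗≫ 𝟙 (dual X) =
      𝟙 (dual Y) ⊗≫ coevt X ▷ dual Y ⊗≫ dual X ◁ f ▷ dual Y ⊗≫ dual X ◁ evt Y ⊗≫ 𝟙 (dual X)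
  left_constraint_eq_right_constraint (X Y : C) :
    𝟙 (dual X ⊗ dual Y) ⊗≫ (dual X ⊗ dual Y) ◁ coev (Y ⊗ X) ⊗≫
        dual X ◁ ev Y ▷ (X ⊗ dual (Y ⊗ X)) ⊗≫ ev X ▷ dual (Y ⊗ X) ⊗≫ 𝟙 (dual (Y ⊗ X)) =
      𝟙 (dual X ⊗ dual Y) ⊗≫ coevt (Y ⊗ X) ▷ (dual X ⊗ dual Y) ⊗≫
        (dual (Y ⊗ X) ⊗ Y) ◁ evt X ▷ dual Y ⊗≫ dual (Y ⊗ X) ◁ evt Y ⊗≫ 𝟙 (dual (Y ⊗ X))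
  ev_unit : ev (𝟙_ C) = (ρ_ (dual (𝟙_ C))).hom ≫ (λ_ (dual (𝟙_ C))).inv ≫ evt (𝟙_ C)

open PivotalCategory

section Monoidal

variable {C : Type u} [Category.{v} C] [MonoidalCategory C]

/-- The tensor product of `f a` over the entries `a` of a list, from the left to the right
(bracketed to the right; the empty product is the unit object). -/
def tensorList {ι : Type*} (f : ι → C) : List ι → C
  | [] => 𝟙_ C
  | [a] => f a
  | a :: b :: l => f a ⊗ tensorList f (b :: l)

/-- Splitting off the first factor of a tensor product. -/
def tensorListCons {ι : Type*} (f : ι → C) (a : ι) :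
    ∀ l : List ι, tensorList f (a :: l) ≅ f a ⊗ tensorList f l
  | [] => (ρ_ (f a)).symm
  | _ :: _ => Iso.refl _

/-- The canonical isomorphism from the associativity and unit constraints of `C`. -/
def tensorListAppend {ι : Type*} (f : ι → C) :
    ∀ l l' : List ι, tensorList f l ⊗ tensorList f l' ≅ tensorList f (l ++ l')
  | [], l' => λ_ (tensorList f l')
  | a :: l, l' =>
      whiskerRightIso (tensorListCons f a l) (tensorList f l') ≪≫
        α_ (f a) (tensorList f l) (tensorList f l') ≪≫
        whiskerLeftIso (f a) (tensorListAppend f l l') ≪≫ (tensorListCons f a (l ++ l')).symm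

/-- The `n`-fold monoidal constraint `F(X₁) ⊗ ⋯ ⊗ F(Xₙ) ⟶ F(X₁ ⊗ ⋯ ⊗ Xₙ)` of a monoidal
functor; it is `F₀` for `n = 0`. -/
def tensorListConstraint (F : C ⥤ C) [F.LaxMonoidal] {ι : Type*} (f : ι → C) :
    ∀ l : List ι, tensorList (fun a => F.obj (f a)) l ⟶ F.obj (tensorList f l)
  | [] => Functor.LaxMonoidal.ε F
  | a :: l =>
      (tensorListCons (fun a => F.obj (f a)) a l).hom ≫
        F.obj (f a) ◁ tensorListConstraint F f l ≫
        Functor.LaxMonoidal.μ F (f a) (tensorList f l) ≫ F.map (tensorListCons f a l).inv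

variable [PivotalCategory C]

/-- The dual morphism `f^* : Y^* ⟶ X^*` of `f : X ⟶ Y`. -/
def dualMap {X Y : C} (f : X ⟶ Y) : dual Y ⟶ dual X :=
  𝟙 (dual Y) ⊗≫ dual Y ◁ coev X ⊗≫ dual Y ◁ f ▷ dual X ⊗≫ ev Y ▷ dual X ⊗≫ 𝟙 (dual X)

variable (F : C ⥤ C) [F.Monoidal]

/-- The comparison morphism `F^l(X) : F(X^*) ⟶ F(X)^*`. -/
def leftComparison (X : C) : F.obj (dual X) ⟶ dual (F.obj X) :=
  𝟙 (F.obj (dual X)) ⊗≫ F.obj (dual X) ◁ coev (F.obj X) ⊗≫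
    (Functor.LaxMonoidal.μ F (dual X) X ≫ F.map (ev X) ≫ Functor.OplaxMonoidal.η F) ▷
      dual (F.obj X) ⊗≫ 𝟙 (dual (F.obj X))

/-- The comparison morphism `F^r(X) : F(X^*) ⟶ F(X)^*`. -/
def rightComparison (X : C) : F.obj (dual X) ⟶ dual (F.obj X) :=
  𝟙 (F.obj (dual X)) ⊗≫ coevt (F.obj X) ▷ F.obj (dual X) ⊗≫
    dual (F.obj X) ◁
      (Functor.LaxMonoidal.μ F X (dual X) ≫ F.map (evt X) ≫ Functor.OplaxMonoidal.η F) ⊗≫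
    𝟙 (dual (F.obj X))

/-- The duality `(X, X^*, ev, coev)`. -/
@[reducible] def pairing (X : C) : ExactPairing X (dual X) where
  coevaluation' := coev X
  evaluation' := ev X
  coevaluation_evaluation' := by
    have h := ev_coev X
    rw [← cancel_epi (ρ_ (dual X)).inv, ← cancel_mono (λ_ (dual X)).hom]
    simpa [monoidalComp] using h
  evaluation_coevaluation' := by
    have h := coev_ev X
    rw [← cancel_epi (λ_ X).inv, ← cancel_mono (ρ_ X).hom]
    simpa [monoidalComp] using h

/-- The image of the duality `(X, X^*, ev, coev)` under a strong monoidal functor. -/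
@[reducible] def mapPairing (X : C) : ExactPairing (F.obj X) (F.obj (dual X)) where
  coevaluation' := Functor.LaxMonoidal.ε F ≫ F.map (coev X) ≫ Functor.OplaxMonoidal.δ F X (dual X)
  evaluation' := Functor.LaxMonoidal.μ F (dual X) X ≫ F.map (ev X) ≫ Functor.OplaxMonoidal.η F
  coevaluation_evaluation' := by
    have h := congrArg F.map (pairing X).coevaluation_evaluation'
    simp only [Functor.map_comp, Functor.Monoidal.map_whiskerLeft,
      Functor.Monoidal.map_whiskerRight, Functor.Monoidal.map_associator_inv,
      Functor.Monoidal.map_rightUnitor, Functor.Monoidal.map_leftUnitor_inv, Category.assoc,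
      Functor.Monoidal.μ_δ_assoc] at h
    replace h := congrArg (fun t => F.obj (dual X) ◁ Functor.LaxMonoidal.ε F ≫ Functor.LaxMonoidal.μ F _ _ ≫ t ≫
      Functor.OplaxMonoidal.δ F _ _ ≫ Functor.OplaxMonoidal.η F ▷ F.obj (dual X)) h
    simp only [Category.assoc, Functor.Monoidal.μ_δ_assoc, Category.comp_id,
      Functor.Monoidal.whiskerLeft_ε_η_assoc, Functor.Monoidal.whiskerRight_ε_η] at h
    simp only [whiskerLeft_comp, comp_whiskerRight, Category.assoc]
    exact h
  evaluation_coevaluation' := by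
    have h := congrArg F.map (pairing X).evaluation_coevaluation'
    simp only [Functor.map_comp, Functor.Monoidal.map_whiskerLeft,
      Functor.Monoidal.map_whiskerRight, Functor.Monoidal.map_associator,
      Functor.Monoidal.map_leftUnitor, Functor.Monoidal.map_rightUnitor_inv, Category.assoc,
      Functor.Monoidal.μ_δ_assoc] at h
    replace h := congrArg (fun t => Functor.LaxMonoidal.ε F ▷ F.obj X ≫ Functor.LaxMonoidal.μ F _ _ ≫ t ≫
      Functor.OplaxMonoidal.δ F _ _ ≫ F.obj X ◁ Functor.OplaxMonoidal.η F) h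
    simp only [Category.assoc, Functor.Monoidal.μ_δ_assoc, Category.comp_id,
      Functor.Monoidal.whiskerRight_ε_η_assoc, Functor.Monoidal.whiskerLeft_ε_η] at h
    simp only [whiskerLeft_comp, comp_whiskerRight, Category.assoc]
    exact h

/-- `F^l(X)` is an isomorphism. -/
theorem isIso_leftComparison (X : C) : IsIso (leftComparison F X) := by
  have h : leftComparison F X = (rightDualIso (mapPairing F X) (pairing (F.obj X))).hom := by
    have h1 : (rightDualIso (mapPairing F X) (pairing (F.obj X))).hom =
        (ρ_ (F.obj (dual X))).inv ≫ F.obj (dual X) ◁ coev (F.obj X) ≫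
          F.obj (dual X) ◁ 𝟙 (F.obj X) ▷ dual (F.obj X) ≫
          (α_ (F.obj (dual X)) (F.obj X) (dual (F.obj X))).inv ≫
          (Functor.LaxMonoidal.μ F (dual X) X ≫ F.map (ev X) ≫ Functor.OplaxMonoidal.η F) ▷
            dual (F.obj X) ≫ (λ_ (dual (F.obj X))).hom := rfl
    rw [h1]
    simp [leftComparison, monoidalComp]
  rw [h]
  infer_instance

end Monoidal

section Graded

variable (G : Type w) [Group G] (C : Type u) [Category.{v} C] [MonoidalCategory C] [Preadditive C]

/-- A `G`-grading of a monoidal category: pairwise disjoint full subcategories `C_α`, `α ∈ G`.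
(Linearity over the ground ring is expressed by Mathlib's classes.) -/
class GGradedCategory where
  component : G → ObjectProperty C
  disjoint {α β : G} {X : C} : component α X → component β X → α = β
  unit_mem : component 1 (𝟙_ C)
  tensor_mem {α β : G} {X Y : C} : component α X → component β Y → component (α * β) (X ⊗ Y)
  hom_eq_zero {α β : G} {X Y : C} :
    component α X → component β Y → α ≠ β → ∀ f : X ⟶ Y, f = 0

open GGradedCategory

/-- A pivotal `G`-graded category: `X^* ∈ C_{α⁻¹}` for `X ∈ C_α`. -/
class PivotalGGradedCategory [GGradedCategory G C] [PivotalCategory C] : Prop where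
  dual_mem {α : G} {X : C} : component α X → component α⁻¹ (dual X)

/-- A crossing: strong monoidal auto-equivalences `φ_α = act α` of `C` with isomorphisms
`φ_2(α, β) : φ_α φ_β ≅ φ_{βα}` and `φ_0 : id ≅ φ_1` of monoidal functors. -/
class GCrossing [GGradedCategory G C] where
  act : G → C ⥤ C
  [act_monoidal : ∀ α, (act α).Monoidal]
  act_additive (α : G) : (act α).Additive
  act_isEquivalence (α : G) : (act α).IsEquivalence
  act_mem (α : G) {β : G} {X : C} : component β X → component (α⁻¹ * β * α) ((act α).obj X)
  actMul (α β : G) : act β ⋙ act α ≅ act (β * α)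
  actMul_isMonoidal (α β : G) : NatTrans.IsMonoidal (actMul α β).hom
  actOne : 𝟭 C ≅ act 1
  actOne_isMonoidal : NatTrans.IsMonoidal actOne.hom
  actMul_actMul (α β γ : G) (X : C) :
    (act α).map ((actMul β γ).hom.app X) ≫ (actMul α (γ * β)).hom.app X =
      (actMul α β).hom.app ((act γ).obj X) ≫ (actMul (β * α) γ).hom.app X ≫
        eqToHom (by rw [mul_assoc])
  act_actOne (α : G) (X : C) :
    (act α).map (actOne.hom.app X) ≫ (actMul α 1).hom.app X = eqToHom (by simp)
  actOne_act (α : G) (X : C) :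
    actOne.hom.app ((act α).obj X) ≫ (actMul 1 α).hom.app X = eqToHom (by simp)

attribute [reducible, instance] GCrossing.act_monoidal

open GCrossing

/-- The functors `φ_α` are linear over the ground ring `k`. -/
class LinearCrossing (k : Type*) [Semiring k] [Linear k C] [GGradedCategory G C]
    [GCrossing G C] : Prop where
  map_smul (α : G) {X Y : C} (r : k) (f : X ⟶ Y) : (act α).map (r • f) = r • (act α).map f

/-- A pivotal crossing: `φ_α^l = φ_α^r` for all `α`. -/
class PivotalCrossing [PivotalCategory C] [GGradedCategory G C] [GCrossing G C] : Prop where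
  left_eq_right (α : G) (X : C) : leftComparison (act α) X = rightComparison (act α) X

end Graded

open GGradedCategory GCrossing

section Crossed

variable {G : Type w} [Group G] {C : Type u} [Category.{v} C] [MonoidalCategory C] [Preadditive C]
  [GGradedCategory G C] [GCrossing G C]

/-- The isomorphism `φ_2(α, β)_X : φ_α φ_β (X) ≅ φ_γ(X)` where `γ = βα`. -/
def actMulIso (α β γ : G) (h : β * α = γ) (X : C) :
    (act α).obj ((act β).obj X) ≅ (act γ).obj X :=
  (actMul α β).app X ≪≫ eqToIso (by rw [h])

/-- For `ψ : X ≅ φ_α(Y)`, the isomorphism `ψ̄ : Y ≅ φ_{α⁻¹}(X)`. -/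
def barIso {α : G} {X Y : C} (ψ : X ≅ (act α).obj Y) : Y ≅ (act α⁻¹).obj X :=
  actOne.app Y ≪≫ (actMulIso α⁻¹ α 1 (mul_inv_cancel α) Y).symm ≪≫ (act α⁻¹).mapIso ψ.symm

variable [PivotalCategory C]

/-- `X^+ = X` (for `s = true`) and `X^- = X^*` (for `s = false`). -/
def signedDual (s : Bool) (X : C) : C := if s then X else dual X

/-- The comparison isomorphism `F^1(X) = F^l(X) : F(X^*) ≅ F(X)^*` of a pivotal functor `F`. -/
noncomputable def comparisonIso (F : C ⥤ C) [F.Monoidal] (X : C) :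
    F.obj (dual X) ≅ dual (F.obj X) :=
  haveI := isIso_leftComparison F X
  asIso (leftComparison F X)

/-- For `ψ : X ≅ φ_α(Y)`, the morphisms `ψ^+ = ψ` and `ψ^- : X^* ⟶ φ_α(Y^*)`. -/
noncomputable def signedHom {α : G} {X Y : C} (ψ : X ≅ (act α).obj Y) :
    ∀ s : Bool, signedDual s X ⟶ (act α).obj (signedDual s Y)
  | true => ψ.hom
  | false => dualMap ψ.inv ≫ (comparisonIso (act α) Y).inv

end Crossed

section Braided

variable (G : Type w) [Group G] (C : Type u) [Category.{v} C] [MonoidalCategory C] [Preadditive C]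
  [GGradedCategory G C] [GCrossing G C]

/-- A `G`-braiding: isomorphisms `τ_{X,Y} : X ⊗ Y ≅ Y ⊗ φ_{|Y|}(X)` for `X ∈ C` and `Y ∈ C_β`. -/
class GBraiding where
  braid (X : C) {Y : C} {β : G} (hY : component β Y) : X ⊗ Y ≅ Y ⊗ (act β).obj X
  braid_naturality {X X' Y Y' : C} {β : G} (hY : component β Y) (hY' : component β Y')
    (f : X ⟶ X') (g : Y ⟶ Y') :
    (f ⊗ₘ g) ≫ (braid X' hY').hom = (braid X hY).hom ≫ (g ⊗ₘ (act β).map f)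
  braid_tensor_right (X : C) {Y Z : C} {β γ : G} (hY : component β Y) (hZ : component γ Z) :
    (braid X (tensor_mem hY hZ)).hom =
      𝟙 (X ⊗ (Y ⊗ Z)) ⊗≫ (braid X hY).hom ▷ Z ⊗≫ Y ◁ (braid ((act β).obj X) hZ).hom ⊗≫
        (Y ⊗ Z) ◁ (actMulIso γ β (β * γ) rfl X).hom ⊗≫ 𝟙 ((Y ⊗ Z) ⊗ (act (β * γ)).obj X)
  braid_tensor_left (X Y : C) {Z : C} {γ : G} (hZ : component γ Z) :
    (braid (X ⊗ Y) hZ).hom =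
      𝟙 ((X ⊗ Y) ⊗ Z) ⊗≫ X ◁ (braid Y hZ).hom ⊗≫ (braid X hZ).hom ▷ (act γ).obj Y ⊗≫
        Z ◁ Functor.LaxMonoidal.μ (act γ) X Y ⊗≫ 𝟙 (Z ⊗ (act γ).obj (X ⊗ Y))
  act_braid (α : G) (X : C) {Y : C} {β : G} (hY : component β Y) :
    Functor.LaxMonoidal.μ (act α) X Y ≫ (act α).map (braid X hY).hom =
      (braid ((act α).obj X) (act_mem α hY)).hom ≫
        (act α).obj Y ◁ (actMulIso (α⁻¹ * β * α) α (β * α) (by group) X).hom ≫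
        (act α).obj Y ◁ (actMulIso α β (β * α) rfl X).inv ≫
        Functor.LaxMonoidal.μ (act α) Y ((act β).obj X)

open GBraiding

variable {G C} [PivotalCategory C] [GBraiding G C]

/-- The twist `θ_X : X ⟶ φ_α(X)` for `X ∈ C_α`. -/
def twist {X : C} {α : G} (hX : component α X) : X ⟶ (act α).obj X :=
  𝟙 X ⊗≫ coevt X ▷ X ⊗≫ dual X ◁ (braid X hX).hom ⊗≫ ev X ▷ (act α).obj X ⊗≫
    𝟙 ((act α).obj X)

variable (G C)

/-- A `G`-ribbon category: a pivotal `G`-braided category with pivotal crossing and self-dual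
twist. -/
class GRibbonCategory [PivotalGGradedCategory G C] : Prop extends PivotalCrossing G C where
  twist_selfDual {α : G} {X : C} (hX : component α X)
    (hX' : component α⁻¹ (dual ((act α).obj X))) :
    dualMap (twist hX) =
      twist hX' ≫ (comparisonIso (act α⁻¹) ((act α).obj X)).hom ≫
        dualMap (actMulIso α⁻¹ α 1 (mul_inv_cancel α) X).inv ≫ dualMap (actOne.hom.app X)

end Braided

section Diagrams

variable (G : Type w) [Group G] (C : Type u) [Category.{v} C] [MonoidalCategory C] [Preadditive C]
  [GGradedCategory G C]

/-- Non-zero homogeneous objects of `C`, the colors of underpasses. -/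
structure Color where
  obj : C
  degree : G
  mem : component degree obj
  not_isZero : ¬ Limits.IsZero obj

/-- A color with a sign: the sign `+` (`true`) stands for a strand directed downwards, the sign
`-` (`false`) for a strand directed upwards. -/
structure SignedColor where
  color : Color G C
  sign : Bool

variable {G C}

/-- The signed color `(X, +)`. -/
def Color.down (X : Color G C) : SignedColor G C := ⟨X, true⟩

/-- The signed color `(X, -)`. -/
def Color.up (X : Color G C) : SignedColor G C := ⟨X, false⟩

/-- Inverting the orientation of a strand. -/
def SignedColor.reverse (a : SignedColor G C) : SignedColor G C := ⟨a.color, !a.sign⟩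

/-- The degree `|X|^ε` of `(X, ε)`. -/
def SignedColor.degree (a : SignedColor G C) : G :=
  if a.sign then a.color.degree else a.color.degree⁻¹

/-- The object `X^ε` of `(X, ε)`. -/
def SignedColor.value [PivotalCategory C] (a : SignedColor G C) : C := signedDual a.sign a.color.obj

/-- The product `|X₁|^ε₁ ⋯ |Xₘ|^εₘ`. -/
def listDegree (A : List (SignedColor G C)) : G := (A.map SignedColor.degree).prod

/-- The object `X₁^ε₁ ⊗ ⋯ ⊗ Xₘ^εₘ`. -/
def listValue [PivotalCategory C] (A : List (SignedColor G C)) : C :=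
  tensorList SignedColor.value A

/-- The sequence read from the right to the left with all signs inverted. -/
def reverseList : List (SignedColor G C) → List (SignedColor G C)
  | [] => []
  | a :: l => reverseList l ++ [a.reverse]

variable [GCrossing G C] [PivotalCategory C]

/-- Colored graph diagrams in `ℝ × [0,1]` in generic position (read from the bottom to the top),
with given source and target: they are obtained from the elementary colored diagrams by stacking
(`comp D E` is `E` on top of `D`) and juxtaposition (`tensor D E` has `E` on the right of `D`).
The color is constant along each underpass; at a crossing the strand which changes its color is
the overcrossing one, and the crossing `c` carries an isomorphism
`ψ : U_{c⁺} ≅ φ_{|U_{c̲}|}(U_{c⁻})`. -/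
inductive Diagram :
    List (SignedColor G C) → List (SignedColor G C) → Type (max u v w)
  /-- vertical segments -/
  | id (A : List (SignedColor G C)) : Diagram A A
  | comp {A B K : List (SignedColor G C)} (D : Diagram A B) (E : Diagram B K) : Diagram A K
  | tensor {A B A' B' : List (SignedColor G C)} (D : Diagram A B) (E : Diagram A' B') :
      Diagram (A ++ A') (B ++ B')
  /-- the cap directed to the right -/
  | capRight (X : Color G C) : Diagram [X.up, X.down] []
  /-- the cup directed to the right -/
  | cupRight (X : Color G C) : Diagram [] [X.down, X.up]
  /-- the cap directed to the left -/
  | capLeft (X : Color G C) : Diagram [X.down, X.up] []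
  /-- the cup directed to the left -/
  | cupLeft (X : Color G C) : Diagram [] [X.up, X.down]
  /-- the positive crossing `σ₊(X, Y, X', ψ)` of strands directed downwards -/
  | crossPos (X Y X' : Color G C) (ψ : X'.obj ≅ (act Y.degree).obj X.obj) :
      Diagram [X.down, Y.down] [Y.down, X'.down]
  /-- the negative crossing `σ₋(X, Y, Y', ψ)` of strands directed downwards -/
  | crossNeg (X Y Y' : Color G C) (ψ : Y.obj ≅ (act X.degree).obj Y'.obj) :
      Diagram [X.down, Y.down] [Y'.down, X.down]
  /-- a coupon colored by `f` -/
  | coupon (A B : List (SignedColor G C)) (h : listDegree A = listDegree B)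
      (f : listValue A ⟶ listValue B) : Diagram A B

namespace Diagram

/-- Rewriting the source and the target of a diagram along equalities. -/
def cast {A A' B B' : List (SignedColor G C)} (hA : A = A') (hB : B = B') (D : Diagram A B) :
    Diagram A' B' := hA ▸ hB ▸ D

/-- Inserting a diagram between vertical segments. -/
def insert (L R : List (SignedColor G C)) {A B : List (SignedColor G C)} (D : Diagram A B) :
    Diagram (L ++ (A ++ R)) (L ++ (B ++ R)) :=
  (id L).tensor (D.tensor (id R))

/-- The cap at a strand (of any orientation) and its reversed copy on the left. -/
def cap : ∀ a : SignedColor G C, Diagram [a.reverse, a] []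
  | ⟨X, true⟩ => capRight X
  | ⟨X, false⟩ => capLeft X

/-- The cap at a strand (of any orientation) and its reversed copy on the right. -/
def cap' : ∀ a : SignedColor G C, Diagram [a, a.reverse] []
  | ⟨X, true⟩ => capLeft X
  | ⟨X, false⟩ => capRight X

/-- The cup at a strand (of any orientation) and its reversed copy on the right. -/
def cup : ∀ a : SignedColor G C, Diagram [] [a, a.reverse]
  | ⟨X, true⟩ => cupRight X
  | ⟨X, false⟩ => cupLeft X

/-- The cup at a strand (of any orientation) and its reversed copy on the left. -/
def cup' : ∀ a : SignedColor G C, Diagram [] [a.reverse, a]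
  | ⟨X, true⟩ => cupLeft X
  | ⟨X, false⟩ => cupRight X

/-- Nested caps. -/
def caps : ∀ A : List (SignedColor G C), Diagram (reverseList A ++ A) []
  | [] => id []
  | a :: l =>
      ((insert (reverseList l) l (cap a)).comp (caps l)).cast
        (by simp [reverseList]) rfl

/-- Nested caps. -/
def caps' : ∀ A : List (SignedColor G C), Diagram (A ++ reverseList A) []
  | [] => id []
  | a :: l =>
      ((insert [a] [a.reverse] (caps' l)).comp (cap' a)).cast (by simp [reverseList]) rfl

/-- Nested cups. -/
def cups : ∀ A : List (SignedColor G C), Diagram [] (A ++ reverseList A)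
  | [] => id []
  | a :: l =>
      ((cup a).comp (insert [a] [a.reverse] (cups l))).cast rfl (by simp [reverseList])

/-- Nested cups. -/
def cups' : ∀ A : List (SignedColor G C), Diagram [] (reverseList A ++ A)
  | [] => id []
  | a :: l =>
      ((cups' l).comp (insert (reverseList l) l (cup' a))).cast rfl (by simp [reverseList])

/-- The diagram rotated counterclockwise or clockwise by the angle `π`. -/
def rotate {A B : List (SignedColor G C)} (D : Diagram A B) :
    Diagram (reverseList B) (reverseList A) :=
  (((id (reverseList B)).tensor (cups A)).comp
    (((id (reverseList B)).tensor (D.tensor (id (reverseList A)))).comp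
      (((caps B).tensor (id (reverseList A))).cast (by simp) rfl))).cast (by simp) (by simp)

/-- The diagram rotated by the angle `π` in the direction opposite to that of `rotate`. -/
def rotate' {A B : List (SignedColor G C)} (D : Diagram A B) :
    Diagram (reverseList B) (reverseList A) :=
  (((cups' A).tensor (id (reverseList B))).comp
    ((((id (reverseList A)).tensor (D.tensor (id (reverseList B)))).cast (by simp) rfl).comp
      ((id (reverseList A)).tensor (caps' B)))).cast (by simp) (by simp)

/-- Plane isotopy of colored diagrams (keeping inputs, outputs and all colors): two diagrams in
generic position are isotopic if and only if they are related by the following local isotopies. -/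
inductive PlaneIsotopic :
    ∀ {A B : List (SignedColor G C)}, Diagram A B → Diagram A B → Prop
  | refl {A B} (D : Diagram A B) : PlaneIsotopic D D
  | symm {A B} {D E : Diagram A B} : PlaneIsotopic D E → PlaneIsotopic E D
  | trans {A B} {D E K : Diagram A B} : PlaneIsotopic D E → PlaneIsotopic E K → PlaneIsotopic D K
  | comp {A B K} {D D' : Diagram A B} {E E' : Diagram B K} :
      PlaneIsotopic D D' → PlaneIsotopic E E' → PlaneIsotopic (D.comp E) (D'.comp E')
  | tensor {A B A' B'} {D D' : Diagram A B} {E E' : Diagram A' B'} :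
      PlaneIsotopic D D' → PlaneIsotopic E E' → PlaneIsotopic (D.tensor E) (D'.tensor E')
  /- vertical rescaling, different ways to cut the same picture into pieces, and independent
  vertical displacement of juxtaposed pieces -/
  | id_comp {A B} (D : Diagram A B) : PlaneIsotopic ((id A).comp D) D
  | comp_id {A B} (D : Diagram A B) : PlaneIsotopic (D.comp (id B)) D
  | assoc {A B K L} (D : Diagram A B) (E : Diagram B K) (N : Diagram K L) :
      PlaneIsotopic ((D.comp E).comp N) (D.comp (E.comp N))
  | id_tensor_id (A B : List (SignedColor G C)) :
      PlaneIsotopic ((id A).tensor (id B)) (id (A ++ B))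
  | interchange {A B K A' B' K'} (D : Diagram A B) (E : Diagram B K)
      (D' : Diagram A' B') (E' : Diagram B' K') :
      PlaneIsotopic ((D.tensor D').comp (E.tensor E')) ((D.comp E).tensor (D'.comp E'))
  | nil_tensor {A B} (D : Diagram A B) : PlaneIsotopic ((id []).tensor D) D
  | tensor_nil {A B} (D : Diagram A B) :
      PlaneIsotopic ((D.tensor (id [])).cast (List.append_nil A) (List.append_nil B)) D
  | tensor_assoc {A B A' B' A'' B''} (D : Diagram A B) (D' : Diagram A' B')
      (D'' : Diagram A'' B'') :
      PlaneIsotopic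
        (((D.tensor D').tensor D'').cast (List.append_assoc A A' A'') (List.append_assoc B B' B''))
        (D.tensor (D'.tensor D''))
  /- straightening of strands -/
  | zigzag_down_right (X : Color G C) :
      PlaneIsotopic
        (((cupRight X).tensor (id [X.down])).comp ((id [X.down]).tensor (capRight X)))
        (id [X.down])
  | zigzag_up_right (X : Color G C) :
      PlaneIsotopic
        (((id [X.up]).tensor (cupRight X)).comp ((capRight X).tensor (id [X.up])))
        (id [X.up])
  | zigzag_down_left (X : Color G C) :
      PlaneIsotopic
        (((id [X.down]).tensor (cupLeft X)).comp ((capLeft X).tensor (id [X.down])))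
        (id [X.down])
  | zigzag_up_left (X : Color G C) :
      PlaneIsotopic
        (((cupLeft X).tensor (id [X.up])).comp ((id [X.up]).tensor (capLeft X)))
        (id [X.up])
  /- rotation of a part of the diagram (for instance, a crossing or a coupon) by a full turn -/
  | full_turn {A B} (D : Diagram A B) : PlaneIsotopic (rotate D) (rotate' D)

end Diagram

/-- A system of isomorphisms between the colors of two sequences of signed colors. -/
inductive ColorIso : List (SignedColor G C) → List (SignedColor G C) → Type (max u v w)
  | nil : ColorIso [] []
  | cons {X X' : Color G C} (s : Bool) (f : X.obj ≅ X'.obj) {A A' : List (SignedColor G C)}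
      (r : ColorIso A A') : ColorIso (⟨X, s⟩ :: A) (⟨X', s⟩ :: A')

namespace ColorIso

/-- The system of identity isomorphisms. -/
def refl : ∀ A : List (SignedColor G C), ColorIso A A
  | [] => nil
  | ⟨_, s⟩ :: A => cons s (Iso.refl _) (refl A)

/-- Juxtaposition. -/
def append {A A' B B' : List (SignedColor G C)} (q : ColorIso B B') :
    ColorIso A A' → ColorIso (A ++ B) (A' ++ B')
  | nil => q
  | cons s f r => cons s f (append q r)

/-- For `f : X ≅ X'`, the morphisms `f^+ = f` and `f^- = (f^*)⁻¹ : X^* ⟶ X'^*`. -/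
def signed {X X' : C} (f : X ≅ X') : ∀ s : Bool, signedDual s X ⟶ signedDual s X'
  | true => f.hom
  | false => dualMap f.inv

/-- The morphism `⊗ᵢ fᵢ^εᵢ`. -/
def value : ∀ {A A' : List (SignedColor G C)}, ColorIso A A' → (listValue A ⟶ listValue A')
  | _, _, nil => 𝟙 (𝟙_ C)
  | _, _, cons (X := X) (X' := X') s f (A := A) (A' := A') r =>
      (tensorListCons SignedColor.value (⟨X, s⟩ : SignedColor G C) A).hom ≫
        (signed f s ⊗ₘ value r) ≫
        (tensorListCons SignedColor.value (⟨X', s⟩ : SignedColor G C) A').inv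

end ColorIso

namespace Diagram

/-- Isomorphism of colorings of one graph diagram: the colors of corresponding underpasses are
related by isomorphisms which are compatible with the colors of all crossings and coupons.
`ColoringIso p q D D'` means that such a system exists with `p` at the inputs and `q` at the
outputs. -/
inductive ColoringIso : ∀ {A A' B B' : List (SignedColor G C)},
    ColorIso A A' → ColorIso B B' → Diagram A B → Diagram A' B' → Prop
  | id {A A'} (p : ColorIso A A') : ColoringIso p p (id A) (id A')
  | comp {A A' B B' K K'} {p : ColorIso A A'} {q : ColorIso B B'} {r : ColorIso K K'}
      {D : Diagram A B} {D' : Diagram A' B'} {E : Diagram B K} {E' : Diagram B' K'} :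
      ColoringIso p q D D' → ColoringIso q r E E' → ColoringIso p r (D.comp E) (D'.comp E')
  | tensor {A A' B B' K K' L L'} {p : ColorIso A A'} {q : ColorIso B B'} {r : ColorIso K K'}
      {s : ColorIso L L'}
      {D : Diagram A B} {D' : Diagram A' B'} {E : Diagram K L} {E' : Diagram K' L'} :
      ColoringIso p q D D' → ColoringIso r s E E' →
        ColoringIso (.append r p) (.append s q) (D.tensor E) (D'.tensor E')
  | capRight {X X' : Color G C} (f : X.obj ≅ X'.obj) :
      ColoringIso (.cons false f (.cons true f .nil)) .nil (capRight X) (capRight X')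
  | cupRight {X X' : Color G C} (f : X.obj ≅ X'.obj) :
      ColoringIso .nil (.cons true f (.cons false f .nil)) (cupRight X) (cupRight X')
  | capLeft {X X' : Color G C} (f : X.obj ≅ X'.obj) :
      ColoringIso (.cons true f (.cons false f .nil)) .nil (capLeft X) (capLeft X')
  | cupLeft {X X' : Color G C} (f : X.obj ≅ X'.obj) :
      ColoringIso .nil (.cons false f (.cons true f .nil)) (cupLeft X) (cupLeft X')
  | crossPos {X Y Z X' Y' Z' : Color G C} (f : X.obj ≅ X'.obj) (g : Y.obj ≅ Y'.obj)
      (h : Z.obj ≅ Z'.obj) (ψ : Z.obj ≅ (act Y.degree).obj X.obj)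
      (ψ' : Z'.obj ≅ (act Y'.degree).obj X'.obj) (hY : Y.degree = Y'.degree)
      (w : ψ.hom ≫ (act Y.degree).map f.hom =
        h.hom ≫ ψ'.hom ≫ eqToHom (by rw [hY])) :
      ColoringIso (.cons true f (.cons true g .nil)) (.cons true g (.cons true h .nil))
        (crossPos X Y Z ψ) (crossPos X' Y' Z' ψ')
  | crossNeg {X Y Z X' Y' Z' : Color G C} (f : X.obj ≅ X'.obj) (g : Y.obj ≅ Y'.obj)
      (h : Z.obj ≅ Z'.obj) (ψ : Y.obj ≅ (act X.degree).obj Z.obj)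
      (ψ' : Y'.obj ≅ (act X'.degree).obj Z'.obj) (hX : X.degree = X'.degree)
      (w : ψ.hom ≫ (act X.degree).map h.hom =
        g.hom ≫ ψ'.hom ≫ eqToHom (by rw [hX])) :
      ColoringIso (.cons true f (.cons true g .nil)) (.cons true h (.cons true f .nil))
        (crossNeg X Y Z ψ) (crossNeg X' Y' Z' ψ')
  | coupon {A A' B B'} (p : ColorIso A A') (q : ColorIso B B')
      (h : listDegree A = listDegree B) (h' : listDegree A' = listDegree B')
      (f : listValue A ⟶ listValue B) (f' : listValue A' ⟶ listValue B')
      (w : f ≫ q.value = p.value ≫ f') :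
      ColoringIso p q (coupon A B h f) (coupon A' B' h' f')

/-- Color-equivalence: the equivalence relation (compatible with stacking and juxtaposition)
generated by plane isotopies and by isomorphisms of colorings which are the identity at the inputs
and outputs. -/
inductive ColorEquivalent :
    ∀ {A B : List (SignedColor G C)}, Diagram A B → Diagram A B → Prop
  | isotopy {A B} {D E : Diagram A B} : PlaneIsotopic D E → ColorEquivalent D E
  | coloring {A B} {D E : Diagram A B} :
      ColoringIso (.refl A) (.refl B) D E → ColorEquivalent D E
  | symm {A B} {D E : Diagram A B} : ColorEquivalent D E → ColorEquivalent E D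
  | trans {A B} {D E K : Diagram A B} :
      ColorEquivalent D E → ColorEquivalent E K → ColorEquivalent D K
  | comp {A B K} {D D' : Diagram A B} {E E' : Diagram B K} :
      ColorEquivalent D D' → ColorEquivalent E E' → ColorEquivalent (D.comp E) (D'.comp E')
  | tensor {A B A' B'} {D D' : Diagram A B} {E E' : Diagram A' B'} :
      ColorEquivalent D D' → ColorEquivalent E E' →
        ColorEquivalent (D.tensor E) (D'.tensor E')

/-- Color-equivalence as a setoid. -/
instance setoid (A B : List (SignedColor G C)) : Setoid (Diagram A B) where
  r := ColorEquivalent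
  iseqv := ⟨fun D => .isotopy (.refl D), .symm, .trans⟩

end Diagram

end Diagrams

section DiagramCategory

variable (G : Type w) [Group G] (C : Type u) [Category.{v} C] [MonoidalCategory C] [Preadditive C]
  [GGradedCategory G C] [GCrossing G C] [PivotalCategory C]

/-- The category `D_C` of colored diagrams: objects are finite sequences of signed colors. -/
structure DiagramCategory where
  seq : List (SignedColor G C)

variable {G C}

namespace DiagramCategory

/-- Morphisms of `D_C` are color-equivalence classes of colored diagrams; they are composed by
stacking. -/
instance : Category (DiagramCategory G C) where
  Hom A B := Quotient (Diagram.setoid A.seq B.seq)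
  id A := Quotient.mk _ (Diagram.id A.seq)
  comp := Quotient.map₂ Diagram.comp fun _ _ h _ _ h' => Diagram.ColorEquivalent.comp h h'
  id_comp := by
    rintro A B ⟨D⟩
    exact Quotient.sound (.isotopy (.id_comp D))
  comp_id := by
    rintro A B ⟨D⟩
    exact Quotient.sound (.isotopy (.comp_id D))
  assoc := by
    rintro A B K L ⟨D⟩ ⟨E⟩ ⟨N⟩
    exact Quotient.sound (.isotopy (.assoc D E N))

/-- The morphism of `D_C` represented by a colored diagram. -/
def ofDiagram {A B : List (SignedColor G C)} (D : Diagram A B) :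
    (⟨A⟩ : DiagramCategory G C) ⟶ ⟨B⟩ := Quotient.mk _ D

theorem exists_ofDiagram {A B : DiagramCategory G C} (f : A ⟶ B) :
    ∃ D : Diagram A.seq B.seq, ofDiagram D = f := Quotient.exists_rep f

theorem ofDiagram_cast {A A' B B' : List (SignedColor G C)} (hA : A = A') (hB : B = B')
    (D : Diagram A B) :
    ofDiagram (D.cast hA hB) =
      eqToHom (by rw [hA]) ≫ ofDiagram D ≫ eqToHom (by rw [hB]) := by
  subst hA hB
  simp [Diagram.cast]

/-- The monoidal product of `D_C` is juxtaposition. -/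
instance : MonoidalCategoryStruct (DiagramCategory G C) where
  tensorObj A B := ⟨A.seq ++ B.seq⟩
  tensorUnit := ⟨[]⟩
  tensorHom := Quotient.map₂ Diagram.tensor fun _ _ h _ _ h' =>
    Diagram.ColorEquivalent.tensor h h'
  whiskerLeft A _ _ := Quotient.map (Diagram.tensor (Diagram.id A.seq)) fun _ _ h =>
    Diagram.ColorEquivalent.tensor (.isotopy (.refl _)) h
  whiskerRight f A := Quotient.map (fun D => Diagram.tensor D (Diagram.id A.seq)) (fun _ _ h =>
    Diagram.ColorEquivalent.tensor h (.isotopy (.refl _))) f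
  associator A B K := eqToIso (congrArg mk (List.append_assoc A.seq B.seq K.seq))
  leftUnitor A := eqToIso (congrArg mk (List.nil_append A.seq))
  rightUnitor A := eqToIso (congrArg mk (List.append_nil A.seq))

theorem ofDiagram_id (A : List (SignedColor G C)) :
    ofDiagram (Diagram.id A) = 𝟙 (⟨A⟩ : DiagramCategory G C) := rfl

theorem ofDiagram_comp {A B K : List (SignedColor G C)} (D : Diagram A B) (E : Diagram B K) :
    ofDiagram (D.comp E) = ofDiagram D ≫ ofDiagram E := rfl

theorem ofDiagram_tensor {A B A' B' : List (SignedColor G C)} (D : Diagram A B)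
    (E : Diagram A' B') : ofDiagram (D.tensor E) = ofDiagram D ⊗ₘ ofDiagram E := rfl

theorem tensor_id_id (A B : DiagramCategory G C) : 𝟙 A ⊗ₘ 𝟙 B = 𝟙 (A ⊗ B) :=
  Quotient.sound (.isotopy (.id_tensor_id A.seq B.seq))

theorem eqToHom_tensor_id {A A' : DiagramCategory G C} (h : A = A') (B : DiagramCategory G C) :
    eqToHom h ⊗ₘ 𝟙 B = eqToHom (by rw [h]) := by
  subst h
  exact tensor_id_id _ _

theorem id_tensor_eqToHom {A A' : DiagramCategory G C} (h : A = A') (B : DiagramCategory G C) :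
    𝟙 B ⊗ₘ eqToHom h = eqToHom (by rw [h]) := by
  subst h
  exact tensor_id_id _ _

theorem associator_hom (A B K : DiagramCategory G C) :
    (α_ A B K).hom = eqToHom (congrArg mk (List.append_assoc A.seq B.seq K.seq)) := rfl

theorem leftUnitor_hom (A : DiagramCategory G C) :
    (λ_ A).hom = eqToHom (congrArg mk (List.nil_append A.seq)) := rfl

theorem rightUnitor_hom (A : DiagramCategory G C) :
    (ρ_ A).hom = eqToHom (congrArg mk (List.append_nil A.seq)) := rfl

instance : MonoidalCategory (DiagramCategory G C) := MonoidalCategory.ofTensorHom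
  (id_tensorHom_id := tensor_id_id)
  (id_tensorHom := by
    rintro A B B' ⟨D⟩
    rfl)
  (tensorHom_id := by
    rintro A A' ⟨D⟩ B
    rfl)
  (tensorHom_comp_tensorHom := by
    rintro _ _ _ _ _ _ ⟨D⟩ ⟨D'⟩ ⟨E⟩ ⟨E'⟩
    exact Quotient.sound (.isotopy (.interchange D E D' E')))
  (associator_naturality := by
    rintro A A' A'' B B' B'' f g k
    obtain ⟨D, rfl⟩ := exists_ofDiagram f
    obtain ⟨D', rfl⟩ := exists_ofDiagram g
    obtain ⟨D'', rfl⟩ := exists_ofDiagram k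
    have h : ofDiagram _ = ofDiagram _ := Quotient.sound (.isotopy (.tensor_assoc D D' D''))
    rw [ofDiagram_cast] at h
    rw [associator_hom, associator_hom]
    change ofDiagram ((D.tensor D').tensor D'') ≫ eqToHom (_ : _ = DiagramCategory.mk _) =
      eqToHom (_ : DiagramCategory.mk _ = _) ≫ ofDiagram (D.tensor (D'.tensor D''))
    rw [← h]
    simp)
  (leftUnitor_naturality := by
    rintro A B f
    obtain ⟨D, rfl⟩ := exists_ofDiagram f
    have h : ofDiagram _ = ofDiagram _ := Quotient.sound (.isotopy (.nil_tensor D))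
    rw [leftUnitor_hom, leftUnitor_hom]
    change ofDiagram ((Diagram.id []).tensor D) ≫ 𝟙 _ = 𝟙 _ ≫ ofDiagram D
    rw [← h]
    simp)
  (rightUnitor_naturality := by
    rintro A B f
    obtain ⟨D, rfl⟩ := exists_ofDiagram f
    have h : ofDiagram _ = ofDiagram _ := Quotient.sound (.isotopy (.tensor_nil D))
    rw [ofDiagram_cast] at h
    rw [rightUnitor_hom, rightUnitor_hom]
    change ofDiagram (D.tensor (Diagram.id [])) ≫
        eqToHom (congrArg mk (List.append_nil B.seq)) =
      eqToHom (congrArg mk (List.append_nil A.seq)) ≫ ofDiagram D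
    rw [← h]
    simp)
  (pentagon := by
    intro A B K L
    rw [associator_hom, associator_hom, associator_hom, associator_hom, associator_hom,
      eqToHom_tensor_id, id_tensor_eqToHom]
    simp)
  (triangle := by
    intro A B
    rw [associator_hom, leftUnitor_hom, rightUnitor_hom, eqToHom_tensor_id, id_tensor_eqToHom]
    simp)

end DiagramCategory

end DiagramCategory

section Moves

variable {G : Type w} [Group G] {C : Type u} [Category.{v} C] [MonoidalCategory C] [Preadditive C]
  [GGradedCategory G C] [GCrossing G C] [PivotalCategory C]

namespace Diagram

/-! Curls: a strand directed downwards, colored by `X` at the bottom and by `X'` at the top, with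
one curl on its left or on its right, with a positive or a negative crossing. -/

/-- Positive curl on the left. -/
def curlLeftPos (X X' : Color G C) (ψ : X'.obj ≅ (act X.degree).obj X.obj) :
    Diagram [X.down] [X'.down] :=
  ((cupLeft X).tensor (id [X.down])).comp
    (((id [X.up]).tensor (crossPos X X X' ψ)).comp ((capRight X).tensor (id [X'.down])))

/-- Negative curl on the left. -/
def curlLeftNeg (X X' : Color G C) (ψ : X.obj ≅ (act X'.degree).obj X'.obj) :
    Diagram [X.down] [X'.down] :=
  ((cupLeft X').tensor (id [X.down])).comp
    (((id [X'.up]).tensor (crossNeg X' X X' ψ)).comp ((capRight X').tensor (id [X'.down])))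

/-- Positive curl on the right. -/
def curlRightPos (X X' : Color G C) (ψ : X'.obj ≅ (act X'.degree).obj X.obj) :
    Diagram [X.down] [X'.down] :=
  ((id [X.down]).tensor (cupRight X')).comp
    (((crossPos X X' X' ψ).tensor (id [X'.up])).comp ((id [X'.down]).tensor (capLeft X')))

/-- Negative curl on the right. -/
def curlRightNeg (X X' : Color G C) (ψ : X.obj ≅ (act X.degree).obj X'.obj) :
    Diagram [X.down] [X'.down] :=
  ((id [X.down]).tensor (cupRight X)).comp
    (((crossNeg X X X' ψ).tensor (id [X.up])).comp ((id [X'.down]).tensor (capLeft X)))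

/-! The crossings with other orientations of the strands, obtained by rotating `σ₊` and `σ₋`. -/

/-- The positive crossing of a strand directed upwards (on the bottom left, colored by `X`, below)
and a strand directed downwards (above). -/
def crossPosUD (X Y Y' : Color G C) (ψ : Y'.obj ≅ (act X.degree).obj Y.obj) :
    Diagram [X.up, Y.down] [Y'.down, X.up] :=
  ((id [X.up, Y.down]).tensor (cupRight X)).comp
    (((id [X.up]).tensor ((crossPos Y X Y' ψ).tensor (id [X.up]))).comp
      ((capRight X).tensor (id [Y'.down, X.up])))

/-- The negative crossing of a strand directed downwards (on the bottom left, above) and a strand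
directed upwards (colored by `Y`, below). -/
def crossNegDU (X Y X' : Color G C) (ψ : X.obj ≅ (act Y.degree).obj X'.obj) :
    Diagram [X.down, Y.up] [Y.up, X'.down] :=
  ((cupLeft Y).tensor (id [X.down, Y.up])).comp
    (((id [Y.up]).tensor ((crossNeg Y X X' ψ).tensor (id [Y.up]))).comp
      ((id [Y.up, X'.down]).tensor (capLeft Y)))

/-- The positive crossing of a strand directed downwards (on the bottom left, colored by `X`,
below) and a strand directed upwards (above). -/
def crossPosDU (X Y Y' : Color G C) (ψ : Y.obj ≅ (act X.degree).obj Y'.obj) :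
    Diagram [X.down, Y.up] [Y'.up, X.down] :=
  ((cupLeft Y').tensor (id [X.down, Y.up])).comp
    (((id [Y'.up]).tensor ((crossPos Y' X Y ψ).tensor (id [Y.up]))).comp
      ((id [Y'.up, X.down]).tensor (capLeft Y)))

/-- The negative crossing of a strand directed upwards (on the bottom left, above) and a strand
directed downwards (colored by `Y`, below). -/
def crossNegUD (X Y X' : Color G C) (ψ : X'.obj ≅ (act Y.degree).obj X.obj) :
    Diagram [X.up, Y.down] [Y.down, X'.up] :=
  ((id [X.up, Y.down]).tensor (cupRight X')).comp
    (((id [X.up]).tensor ((crossNeg Y X' X ψ).tensor (id [X'.up]))).comp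
      ((capRight X).tensor (id [Y.down, X'.up])))

/-- The positive crossing of two strands directed upwards; the one on the bottom left is above. -/
def crossPosUU (X Y X' : Color G C) (ψ : X.obj ≅ (act Y.degree).obj X'.obj) :
    Diagram [X.up, Y.up] [Y.up, X'.up] := rotate (crossPos X' Y X ψ)

/-- The negative crossing of two strands directed upwards; the one on the bottom left is below. -/
def crossNegUU (X Y Y' : Color G C) (ψ : Y'.obj ≅ (act X.degree).obj Y.obj) :
    Diagram [X.up, Y.up] [Y'.up, X.up] := rotate (crossNeg X Y' Y ψ)

end Diagram

open Diagram

/-- Colors of the crossings of a strand colored by `Z` with the strands `A` which it passes on the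
way from the left to the right below all of them; the signed colors of these strands are `A` on one
side and `B` on the other side, with isomorphisms `ψᵢ : Aᵢ ≅ φ_{|Z|}(Bᵢ)` (regardless of signs). -/
inductive UnderCrossings (Z : Color G C) :
    List (SignedColor G C) → List (SignedColor G C) → Type (max u v w)
  | nil : UnderCrossings Z [] []
  | cons {X Y : Color G C} (s : Bool) (ψ : X.obj ≅ (act Z.degree).obj Y.obj)
      {A B : List (SignedColor G C)} (r : UnderCrossings Z A B) :
      UnderCrossings Z (⟨X, s⟩ :: A) (⟨Y, s⟩ :: B)

namespace UnderCrossings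

variable {Z : Color G C}

/-- A single crossing of the `Z`-colored strand directed downwards. -/
def crossDown {X Y : Color G C} (ψ : X.obj ≅ (act Z.degree).obj Y.obj) :
    ∀ s : Bool, Diagram [Z.down, ⟨X, s⟩] [⟨Y, s⟩, Z.down]
  | true => crossNeg Z X Y ψ
  | false => crossPosDU Z X Y ψ

/-- A single crossing of the `Z`-colored strand directed upwards. -/
def crossUp {X Y : Color G C} (ψ : X.obj ≅ (act Z.degree).obj Y.obj) :
    ∀ s : Bool, Diagram [Z.up, ⟨Y, s⟩] [⟨X, s⟩, Z.up]
  | true => crossPosUD Z Y X ψ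
  | false => crossNegUU Z Y X ψ

/-- The `Z`-colored strand, directed downwards, goes from the bottom left to the top right below
the strands colored by `A` at the bottom and by `B` at the top. -/
def diagramDown : ∀ {A B : List (SignedColor G C)}, UnderCrossings Z A B →
    Diagram (Z.down :: A) (B ++ [Z.down])
  | _, _, nil => Diagram.id [Z.down]
  | _, _, cons (Y := Y) s ψ (A := A) r =>
      Diagram.comp (B := ⟨Y, s⟩ :: Z.down :: A)
        ((crossDown ψ s).tensor (Diagram.id A)) ((Diagram.id [⟨Y, s⟩]).tensor (diagramDown r))

/-- The `Z`-colored strand, directed upwards, goes from the bottom left to the top right below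
the strands colored by `B` at the bottom and by `A` at the top. -/
def diagramUp : ∀ {A B : List (SignedColor G C)}, UnderCrossings Z A B →
    Diagram (Z.up :: B) (A ++ [Z.up])
  | _, _, nil => Diagram.id [Z.up]
  | _, _, cons (X := X) s ψ (B := B) r =>
      Diagram.comp (B := ⟨X, s⟩ :: Z.up :: B)
        ((crossUp ψ s).tensor (Diagram.id B)) ((Diagram.id [⟨X, s⟩]).tensor (diagramUp r))

/-- The morphism `⊗ᵢ ψᵢ^εᵢ : ⊗ᵢ Aᵢ^εᵢ ⟶ ⊗ᵢ φ_{|Z|}(Bᵢ^εᵢ)`. -/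
noncomputable def value : ∀ {A B : List (SignedColor G C)}, UnderCrossings Z A B →
    (listValue A ⟶ tensorList (fun b => (act Z.degree).obj (SignedColor.value b)) B)
  | _, _, nil => 𝟙 (𝟙_ C)
  | _, _, cons (X := X) (Y := Y) s ψ (A := A) (B := B) r =>
      (tensorListCons SignedColor.value (⟨X, s⟩ : SignedColor G C) A).hom ≫
        (signedHom ψ s ⊗ₘ value r) ≫
        (tensorListCons (fun b => (act Z.degree).obj (SignedColor.value b))
          (⟨Y, s⟩ : SignedColor G C) B).inv

/-- The morphism `⊗ᵢ (ψ̄ᵢ)^εᵢ : ⊗ᵢ Bᵢ^εᵢ ⟶ ⊗ᵢ φ_{|Z|⁻¹}(Aᵢ^εᵢ)`. -/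
noncomputable def barValue : ∀ {A B : List (SignedColor G C)}, UnderCrossings Z A B →
    (listValue B ⟶ tensorList (fun a => (act Z.degree⁻¹).obj (SignedColor.value a)) A)
  | _, _, nil => 𝟙 (𝟙_ C)
  | _, _, cons (X := X) (Y := Y) s ψ (A := A) (B := B) r =>
      (tensorListCons SignedColor.value (⟨Y, s⟩ : SignedColor G C) B).hom ≫
        (signedHom (barIso ψ) s ⊗ₘ barValue r) ≫
        (tensorListCons (fun a => (act Z.degree⁻¹).obj (SignedColor.value a))
          (⟨X, s⟩ : SignedColor G C) A).inv

end UnderCrossings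

/-- Colors on a strand which passes on the way from the left to the right above the strands `A`:
`OverCrossings X₀ A Xₘ` records the successive colors `X₀, …, Xₘ` of the strand and the colors
`ψᵢ` of the crossings. -/
inductive OverCrossings : Color G C → List (SignedColor G C) → Color G C → Type (max u v w)
  | nil (X : Color G C) : OverCrossings X [] X
  | consPos {X X' X'' Y : Color G C} (ψ : X'.obj ≅ (act Y.degree).obj X.obj)
      {A : List (SignedColor G C)} (r : OverCrossings X' A X'') : OverCrossings X (Y.down :: A) X''
  | consNeg {X X' X'' Y : Color G C} (ψ : X.obj ≅ (act Y.degree).obj X'.obj)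
      {A : List (SignedColor G C)} (r : OverCrossings X' A X'') : OverCrossings X (Y.up :: A) X''

namespace OverCrossings

/-- The strand, directed downwards, goes from the bottom left to the top right. -/
def diagramDown : ∀ {X X' : Color G C} {A : List (SignedColor G C)}, OverCrossings X A X' →
    Diagram (X.down :: A) (A ++ [X'.down])
  | _, _, _, nil X => Diagram.id [X.down]
  | _, _, _, consPos (X := X) (X' := X') (Y := Y) ψ (A := A) r =>
      Diagram.comp (B := Y.down :: X'.down :: A)
        ((crossPos X Y X' ψ).tensor (Diagram.id A)) ((Diagram.id [Y.down]).tensor (diagramDown r))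
  | _, _, _, consNeg (X := X) (X' := X') (Y := Y) ψ (A := A) r =>
      Diagram.comp (B := Y.up :: X'.down :: A)
        ((crossNegDU X Y X' ψ).tensor (Diagram.id A)) ((Diagram.id [Y.up]).tensor (diagramDown r))

/-- The strand, directed upwards, goes from the bottom left to the top right. -/
def diagramUp : ∀ {X X' : Color G C} {A : List (SignedColor G C)}, OverCrossings X A X' →
    Diagram (X.up :: A) (A ++ [X'.up])
  | _, _, _, nil X => Diagram.id [X.up]
  | _, _, _, consPos (X := X) (X' := X') (Y := Y) ψ (A := A) r =>
      Diagram.comp (B := Y.down :: X'.up :: A)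
        ((crossNegUD X Y X' ψ).tensor (Diagram.id A)) ((Diagram.id [Y.down]).tensor (diagramUp r))
  | _, _, _, consNeg (X := X) (X' := X') (Y := Y) ψ (A := A) r =>
      Diagram.comp (B := Y.up :: X'.up :: A)
        ((crossPosUU X Y X' ψ).tensor (Diagram.id A)) ((Diagram.id [Y.up]).tensor (diagramUp r))

/-- The composition
`Xₘ → φ_{yₘ}(X_{m-1}) → φ_{yₘ} φ_{y_{m-1}}(X_{m-2}) → ⋯ → φ_{yₘ} ⋯ φ_{y₁}(X₀) → φ_{y₁ ⋯ yₘ}(X₀)`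
where `yᵢ = |Yᵢ|^εᵢ`, induced by the `ψᵢ` (replaced with `ψ̄ᵢ` if `εᵢ = -`) and by the constraints
`φ_2`, `φ_0` of the crossing. -/
def value : ∀ {X X' : Color G C} {A : List (SignedColor G C)}, OverCrossings X A X' →
    (X'.obj ⟶ (act (listDegree A)).obj X.obj)
  | _, _, _, nil X => actOne.hom.app X.obj
  | _, _, _, consPos (X := X) (Y := Y) ψ (A := A) r =>
      value r ≫ (act (listDegree A)).map ψ.hom ≫
        (actMulIso (listDegree A) Y.degree (listDegree (Y.down :: A)) rfl X.obj).hom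
  | _, _, _, consNeg (X := X) (Y := Y) ψ (A := A) r =>
      value r ≫ (act (listDegree A)).map (barIso ψ).hom ≫
        (actMulIso (listDegree A) Y.degree⁻¹ (listDegree (Y.up :: A)) rfl X.obj).hom

end OverCrossings

/-- The local pictures before (first diagram) and after (second diagram) a colored Reidemeister
move. -/
inductive LocalReidemeister :
    ∀ {A B : List (SignedColor G C)}, Diagram A B → Diagram A B → Prop
  /- type 1 -/
  | type1a (X X' : Color G C) (ψ : X'.obj ≅ (act X.degree).obj X.obj) :
      LocalReidemeister (Diagram.id [X.down]) ((curlLeftPos X X' ψ).comp (curlLeftNeg X' X ψ))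
  | type1b (X X' : Color G C) (ψ : X.obj ≅ (act X'.degree).obj X'.obj) :
      LocalReidemeister (Diagram.id [X.down]) ((curlLeftNeg X X' ψ).comp (curlLeftPos X' X ψ))
  | type1c (X X' : Color G C) (ψ : X.obj ≅ (act X.degree).obj X'.obj) :
      LocalReidemeister (Diagram.id [X.down]) ((curlRightNeg X X' ψ).comp (curlRightPos X' X ψ))
  | type1d (X X' : Color G C) (ψ : X'.obj ≅ (act X'.degree).obj X.obj) :
      LocalReidemeister (Diagram.id [X.down]) ((curlRightPos X X' ψ).comp (curlRightNeg X' X ψ))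
  /- type 2 -/
  | type2a (X Y Y' : Color G C) (ψ : Y.obj ≅ (act X.degree).obj Y'.obj) :
      LocalReidemeister (Diagram.id [X.down, Y.down]) ((crossNeg X Y Y' ψ).comp (crossPos Y' X Y ψ))
  | type2b (X Y X' : Color G C) (ψ : X'.obj ≅ (act Y.degree).obj X.obj) :
      LocalReidemeister (Diagram.id [X.down, Y.down]) ((crossPos X Y X' ψ).comp (crossNeg Y X' X ψ))
  | type2c (X Y Y' : Color G C) (ψ : Y'.obj ≅ (act X.degree).obj Y.obj) :
      LocalReidemeister (Diagram.id [X.up, Y.down]) ((crossPosUD X Y Y' ψ).comp (crossNegDU Y' X Y ψ))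
  | type2d (X Y Y' : Color G C) (ψ : Y.obj ≅ (act X.degree).obj Y'.obj) :
      LocalReidemeister (Diagram.id [X.down, Y.up]) ((crossPosDU X Y Y' ψ).comp (crossNegUD Y' X Y ψ))
  /- type 3 -/
  | type3 (X Y Z X' X'' Xt Y' : Color G C)
      (a : X'.obj ≅ (act Y.degree).obj X.obj) (b : X''.obj ≅ (act Z.degree).obj X'.obj)
      (c : Y'.obj ≅ (act Z.degree).obj Y.obj) (a' : Xt.obj ≅ (act Z.degree).obj X.obj)
      (b' : X''.obj ≅ (act Y'.degree).obj Xt.obj)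
      (h : Z.degree * Y'.degree = Y.degree * Z.degree)
      (w : b'.hom ≫ (act Y'.degree).map a'.hom ≫
          (actMulIso Y'.degree Z.degree (Y.degree * Z.degree) h X.obj).hom =
        b.hom ≫ (act Z.degree).map a.hom ≫
          (actMulIso Z.degree Y.degree (Y.degree * Z.degree) rfl X.obj).hom) :
      LocalReidemeister
        (((crossPos X Y X' a).tensor (Diagram.id [Z.down])).comp
          (((Diagram.id [Y.down]).tensor (crossPos X' Z X'' b)).comp
            ((crossPos Y Z Y' c).tensor (Diagram.id [X''.down]))))
        (((Diagram.id [X.down]).tensor (crossPos Y Z Y' c)).comp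
          (((crossPos X Z Xt a').tensor (Diagram.id [Y'.down])).comp
            ((Diagram.id [Z.down]).tensor (crossPos Xt Y' X'' b'))))
  /- type 4: pushing a strand behind a coupon -/
  | type4a (Z : Color G C) {A A' B B' : List (SignedColor G C)}
      (p : UnderCrossings Z A B) (q : UnderCrossings Z A' B')
      (h₀ : listDegree A = listDegree A') (h₁ : listDegree B = listDegree B')
      (f₀ : listValue A ⟶ listValue A') (f₁ : listValue B ⟶ listValue B')
      (w : f₀ ≫ q.value ≫ tensorListConstraint (act Z.degree) SignedColor.value B' =
        p.value ≫ tensorListConstraint (act Z.degree) SignedColor.value B ≫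
          (act Z.degree).map f₁) :
      LocalReidemeister
        (((Diagram.id [Z.down]).tensor (coupon A A' h₀ f₀)).comp q.diagramDown)
        (p.diagramDown.comp ((coupon B B' h₁ f₁).tensor (Diagram.id [Z.down])))
  | type4b (Z : Color G C) {A A' B B' : List (SignedColor G C)}
      (p : UnderCrossings Z B A) (q : UnderCrossings Z B' A')
      (h₀ : listDegree A = listDegree A') (h₁ : listDegree B = listDegree B')
      (f₀ : listValue A ⟶ listValue A') (f₁ : listValue B ⟶ listValue B')
      (w : f₀ ≫ q.barValue ≫ tensorListConstraint (act Z.degree⁻¹) SignedColor.value B' =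
        p.barValue ≫ tensorListConstraint (act Z.degree⁻¹) SignedColor.value B ≫
          (act Z.degree⁻¹).map f₁) :
      LocalReidemeister
        (((Diagram.id [Z.up]).tensor (coupon A A' h₀ f₀)).comp q.diagramUp)
        (p.diagramUp.comp ((coupon B B' h₁ f₁).tensor (Diagram.id [Z.up])))
  /- type 4: pushing a strand in front of a coupon -/
  | type4c (X X' : Color G C) {A B : List (SignedColor G C)}
      (p : OverCrossings X A X') (q : OverCrossings X B X')
      (h : listDegree A = listDegree B) (f : listValue A ⟶ listValue B)
      (w : p.value ≫ eqToHom (by rw [h]) = q.value) :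
      LocalReidemeister
        (((Diagram.id [X.down]).tensor (coupon A B h f)).comp q.diagramDown)
        (p.diagramDown.comp ((coupon A B h f).tensor (Diagram.id [X'.down])))
  | type4d (X X' : Color G C) {A B : List (SignedColor G C)}
      (p : OverCrossings X A X') (q : OverCrossings X B X')
      (h : listDegree A = listDegree B) (f : listValue A ⟶ listValue B)
      (w : p.value ≫ eqToHom (by rw [h]) = q.value) :
      LocalReidemeister
        (((Diagram.id [X.up]).tensor (coupon A B h f)).comp q.diagramUp)
        (p.diagramUp.comp ((coupon A B h f).tensor (Diagram.id [X'.up])))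

/-- The local pictures before and after stabilization. -/
inductive LocalStabilization :
    ∀ {A B : List (SignedColor G C)}, Diagram A B → Diagram A B → Prop
  | stabilization (X : Color G C) :
      LocalStabilization (Diagram.id [X.down]) (coupon [X.down] [X.down] rfl (𝟙 _))

/-- `Transforms R D E` : the colored diagrams `D` and `E` are, up to color-equivalence, identical
outside a disk in which they are given by two local pictures related by `R`. -/
inductive Transforms
    (R : ∀ {A B : List (SignedColor G C)}, Diagram A B → Diagram A B → Prop)
    {A B : List (SignedColor G C)} (D E : Diagram A B) : Prop
  | intro (L N : List (SignedColor G C)) {P Q : List (SignedColor G C)} (T T' : Diagram P Q)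
      (hT : R T T') (K : Diagram A (L ++ (P ++ N))) (M : Diagram (L ++ (Q ++ N)) B)
      (hD : ColorEquivalent D (K.comp ((insert L N T).comp M)))
      (hE : ColorEquivalent E (K.comp ((insert L N T').comp M)))

/-- The colored Reidemeister moves (of types 1-4, and their inverses). -/
def ReidemeisterMove {A B : List (SignedColor G C)} (D E : Diagram A B) : Prop :=
  Transforms LocalReidemeister D E ∨ Transforms LocalReidemeister E D

/-- Stabilization. -/
def Stabilization {A B : List (SignedColor G C)} (D E : Diagram A B) : Prop :=
  Transforms LocalStabilization D E

end Moves

section Functor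

/-- A strong monoidal functor. -/
structure StrongMonoidalFunctor (D : Type*) [Category D] [MonoidalCategory D] (C : Type*)
    [Category C] [MonoidalCategory C] where
  toFunctor : D ⥤ C
  [monoidal : toFunctor.Monoidal]

attribute [instance] StrongMonoidalFunctor.monoidal

variable {G : Type w} [Group G] {C : Type u} [Category.{v} C] [MonoidalCategory C] [Preadditive C]
  [GGradedCategory G C] [GCrossing G C] [PivotalCategory C] [GBraiding G C]

open DiagramCategory GBraiding

/-- The functor `F` carries the diagram `D` to the morphism `f`. -/
def Carries {F : DiagramCategory G C ⥤ C}
    (hF : ∀ A : List (SignedColor G C), F.obj ⟨A⟩ = listValue A)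
    {A B : List (SignedColor G C)} (D : Diagram A B) (f : listValue A ⟶ listValue B) : Prop :=
  F.map (ofDiagram D) = eqToHom (hF A) ≫ f ≫ eqToHom (hF B).symm

/-- The properties which characterize the functor `D_C ⥤ C`. -/
structure IsEvaluationFunctor (F : StrongMonoidalFunctor (DiagramCategory G C) C) : Prop where
  obj_eq (A : List (SignedColor G C)) : F.toFunctor.obj ⟨A⟩ = listValue A
  constraint_zero : Functor.LaxMonoidal.ε F.toFunctor = eqToHom (obj_eq []).symm
  constraint_two (A B : List (SignedColor G C)) :
    Functor.LaxMonoidal.μ F.toFunctor ⟨A⟩ ⟨B⟩ =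
      (eqToHom (obj_eq A) ⊗ₘ eqToHom (obj_eq B)) ≫
        (tensorListAppend SignedColor.value A B).hom ≫ eqToHom (obj_eq (A ++ B)).symm
  capRight (X : Color G C) : Carries obj_eq (.capRight X) (ev X.obj)
  capLeft (X : Color G C) : Carries obj_eq (.capLeft X) (evt X.obj)
  cupRight (X : Color G C) : Carries obj_eq (.cupRight X) (coev X.obj)
  cupLeft (X : Color G C) : Carries obj_eq (.cupLeft X) (coevt X.obj)
  coupon (A B : List (SignedColor G C)) (h : listDegree A = listDegree B)
    (f : listValue A ⟶ listValue B) : Carries obj_eq (.coupon A B h f) f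
  crossPos (X Y X' : Color G C) (ψ : X'.obj ≅ (act Y.degree).obj X.obj) :
    Carries obj_eq (.crossPos X Y X' ψ) ((braid X.obj Y.mem).hom ≫ Y.obj ◁ ψ.inv)
  crossNeg (X Y Y' : Color G C) (ψ : Y.obj ≅ (act X.degree).obj Y'.obj) :
    Carries obj_eq (.crossNeg X Y Y' ψ) (X.obj ◁ ψ.hom ≫ (braid Y'.obj X.mem).inv)

end Functor

end GRibbon

open GRibbon GRibbon.DiagramCategory

/-! The functor is forced. Every colored diagram is built from elementary ones by stacking and
juxtaposition, so the prescribed values define `Diagram.eval` by recursion, and a strong monoidal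
functor with the prescribed constraints must agree with it on each diagram
(`IsEvaluationFunctor.carries_eval`). What remains is that `eval` depends only on the
color-equivalence class and respects the moves.

Plane isotopy: coherence in `C` handles the different ways of cutting a picture, and the duality
identities straighten zigzags. The essential relation is the full turn: the left and the right mate
of a morphism between tensor products of signed colors must agree when computed with nested caps and
cups. `PivotalDual` records a left and a right duality matched with the chosen ones by a single
isomorphism. This notion holds for the unit, for `X` as a dual of `X^*`, and is stable under tensor
products and transport, so it holds for a list and its reverse (`pivotalDualList`), and
`PivotalDual.rotate_eq` applies. An isomorphism of colorings gives a commutative square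
(`ColoringIso.eval_value`) by naturality of all elementary pieces.

Moves: every crossing is an instance of one isomorphism `crossIso Y hZ ψ : Y ⊗ Z ≅ Z ⊗ X` or of its
inverse, where `Z` passes below, and so are the rotated crossings: dualizing `Z` replaces `ψ` with
`ψ̄`, dualizing `Y` replaces `ψ` with `ψ^-`. These rotation formulas come from naturality of the
braiding at evaluations and coevaluations, together with the tensor axioms and its values at the
unit. Type 2 is then cancellation of an isomorphism with its inverse. Type 3 (`yang_baxter`) slides
a crossing behind a third strand. In type 4, passing a whole list of strands is again a single
`crossIso` for the tensor product, and the coupon slides by naturality of the braiding in the first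
variable (strand behind it) or in the second (strand in front of it).

Type 1: curls are partial traces of crossings. Sliding a curl through a crossing shows, without the
ribbon axiom, that a curl on one side is cancelled by the opposite crossing closed on the other side
(`traceR_cross_traceL`, `traceL_cross_traceR`). Self-duality of the twist identifies left and right
traces of a crossing (`twist_eq_traceR`), which gives cancellation on one side in one order; the
other order follows because the trace is invertible (`isIso_traceL_cross`). -/

namespace GRibbon

open PivotalCategory

/-! ### Bending strands: mates of morphisms and dual morphisms. -/

section Pivotal

variable {C : Type u} [Category.{v} C] [MonoidalCategory C] [PivotalCategory C]

/-- The rotation of `c : A ⊗ X ⟶ Y ⊗ B` given by `coev X` and `ev Y`. -/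
def rotL {A B X Y : C} (c : A ⊗ X ⟶ Y ⊗ B) : dual Y ⊗ A ⟶ B ⊗ dual X :=
  𝟙 (dual Y ⊗ A) ⊗≫ (dual Y ⊗ A) ◁ coev X ⊗≫ dual Y ◁ c ▷ dual X ⊗≫ ev Y ▷ (B ⊗ dual X) ⊗≫
    𝟙 (B ⊗ dual X)

/-- The rotation of `c : X ⊗ A ⟶ B ⊗ Y` given by `coevt X` and `evt Y`. -/
def rotR {A B X Y : C} (c : X ⊗ A ⟶ B ⊗ Y) : A ⊗ dual Y ⟶ dual X ⊗ B :=
  𝟙 (A ⊗ dual Y) ⊗≫ coevt X ▷ (A ⊗ dual Y) ⊗≫ dual X ◁ c ▷ dual Y ⊗≫ (dual X ⊗ B) ◁ evt Y ⊗≫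
    𝟙 (dual X ⊗ B)

theorem coev_ev' (X : C) :
    (λ_ X).inv ≫ coev X ▷ X ≫ (α_ _ _ _).hom ≫ X ◁ ev X ≫ (ρ_ X).hom = 𝟙 X :=
  Eq.trans (by monoidal) (coev_ev X)

theorem coevt_evt' (X : C) :
    (ρ_ X).inv ≫ X ◁ coevt X ≫ (α_ _ _ _).inv ≫ evt X ▷ X ≫ (λ_ X).hom = 𝟙 X :=
  Eq.trans (by monoidal) (coevt_evt X)

/-- Bending the strand `X` back creates a zigzag, which straightens. With `hom_ext_ev` this
characterizes `rotL c`, so rotated crossings can be identified without unfolding. -/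
theorem rotL_ev {A B X Y : C} (c : A ⊗ X ⟶ Y ⊗ B) :
    rotL c ▷ X ⊗≫ B ◁ ev X = 𝟙 ((dual Y ⊗ A) ⊗ X) ⊗≫ dual Y ◁ c ⊗≫ ev Y ▷ B ⊗≫ 𝟙 (B ⊗ 𝟙_ C) := by
  calc
    _ = 𝟙 _ ⊗≫ (dual Y ⊗ A) ◁ coev X ▷ X ⊗≫ dual Y ◁ c ▷ (dual X ⊗ X) ⊗≫
        (ev Y ▷ ((B ⊗ dual X) ⊗ X) ≫ _ ◁ (𝟙 _ ⊗≫ B ◁ ev X)) ⊗≫ 𝟙 _ := by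
      dsimp only [rotL]; monoidal
    _ = 𝟙 _ ⊗≫ (dual Y ⊗ A) ◁ coev X ▷ X ⊗≫ dual Y ◁ (c ▷ (dual X ⊗ X) ≫ _ ◁ ev X) ⊗≫
        ev Y ▷ B ⊗≫ 𝟙 _ := by
      rw [← whisker_exchange]; monoidal
    _ = 𝟙 _ ⊗≫ (dual Y ⊗ A) ◁ (𝟙 X ⊗≫ coev X ▷ X ⊗≫ X ◁ ev X ⊗≫ 𝟙 X) ⊗≫ dual Y ◁ c ⊗≫
        ev Y ▷ B ⊗≫ 𝟙 _ := by
      rw [← whisker_exchange]; monoidal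
    _ = _ := by
      rw [coev_ev]; monoidal

theorem rotR_evt {A B X Y : C} (c : X ⊗ A ⟶ B ⊗ Y) :
    X ◁ rotR c ⊗≫ evt X ▷ B = 𝟙 (X ⊗ (A ⊗ dual Y)) ⊗≫ c ▷ dual Y ⊗≫ B ◁ evt Y ⊗≫ 𝟙 (𝟙_ C ⊗ B) := by
  calc
    _ = 𝟙 _ ⊗≫ X ◁ coevt X ▷ (A ⊗ dual Y) ⊗≫ (X ⊗ dual X) ◁ c ▷ dual Y ⊗≫
        ((X ⊗ dual X) ◁ (B ◁ evt Y ≫ (ρ_ B).hom) ≫ evt X ▷ B) ⊗≫ 𝟙 _ := by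
      dsimp only [rotR]; monoidal
    _ = 𝟙 _ ⊗≫ X ◁ coevt X ▷ (A ⊗ dual Y) ⊗≫ ((X ⊗ dual X) ◁ c ≫ evt X ▷ (B ⊗ Y)) ▷ dual Y ⊗≫
        B ◁ evt Y ⊗≫ 𝟙 _ := by
      rw [whisker_exchange]; monoidal
    _ = 𝟙 _ ⊗≫ (𝟙 X ⊗≫ X ◁ coevt X ⊗≫ evt X ▷ X ⊗≫ 𝟙 X) ▷ (A ⊗ dual Y) ⊗≫ c ▷ dual Y ⊗≫
        B ◁ evt Y ⊗≫ 𝟙 _ := by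
      rw [whisker_exchange]; monoidal
    _ = _ := by
      rw [coevt_evt]; monoidal

/-- Bending down the strand `X^*` is injective: a zigzag recovers the morphism. The next three
extensionality lemmas are the variants for the other caps and cups. -/
theorem hom_ext_ev {P B X : C} {f g : P ⟶ B ⊗ dual X}
    (h : f ▷ X ⊗≫ B ◁ ev X = g ▷ X ⊗≫ B ◁ ev X) : f = g := by
  have key : ∀ f : P ⟶ B ⊗ dual X,
      f = 𝟙 P ⊗≫ P ◁ coev X ⊗≫ (f ▷ X ⊗≫ B ◁ ev X) ▷ dual X ⊗≫ 𝟙 _ := by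
    intro f
    symm
    calc
      _ = 𝟙 _ ⊗≫ (P ◁ coev X ≫ f ▷ (X ⊗ dual X)) ⊗≫ B ◁ ev X ▷ dual X ⊗≫ 𝟙 _ := by monoidal
      _ = f ⊗≫ B ◁ (𝟙 (dual X) ⊗≫ dual X ◁ coev X ⊗≫ ev X ▷ dual X ⊗≫ 𝟙 (dual X)) := by
        rw [whisker_exchange]; monoidal
      _ = f := by rw [ev_coev]; monoidal
  rw [key f, key g, h]

theorem hom_ext_evt {P B X : C} {f g : P ⟶ dual X ⊗ B}
    (h : X ◁ f ⊗≫ evt X ▷ B = X ◁ g ⊗≫ evt X ▷ B) : f = g := by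
  have key : ∀ f : P ⟶ dual X ⊗ B,
      f = 𝟙 P ⊗≫ coevt X ▷ P ⊗≫ dual X ◁ (X ◁ f ⊗≫ evt X ▷ B) ⊗≫ 𝟙 _ := by
    intro f
    symm
    calc
      _ = 𝟙 _ ⊗≫ (coevt X ▷ P ≫ (dual X ⊗ X) ◁ f) ⊗≫ dual X ◁ evt X ▷ B ⊗≫ 𝟙 _ := by monoidal
      _ = f ⊗≫ (𝟙 (dual X) ⊗≫ coevt X ▷ dual X ⊗≫ dual X ◁ evt X ⊗≫ 𝟙 (dual X)) ▷ B := by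
        rw [← whisker_exchange]; monoidal
      _ = f := by rw [evt_coevt]; monoidal
  rw [key f, key g, h]

theorem hom_ext_coev {X Y : C} {f g : X ⟶ Y}
    (h : coev X ≫ f ▷ dual X = coev X ≫ g ▷ dual X) : f = g := by
  have key : ∀ f : X ⟶ Y, f = 𝟙 X ⊗≫ (coev X ≫ f ▷ dual X) ▷ X ⊗≫ Y ◁ ev X ⊗≫ 𝟙 Y := by
    intro f
    symm
    calc
      _ = 𝟙 _ ⊗≫ coev X ▷ X ⊗≫ (f ▷ (dual X ⊗ X) ≫ Y ◁ ev X) ⊗≫ 𝟙 _ := by monoidal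
      _ = (𝟙 X ⊗≫ coev X ▷ X ⊗≫ X ◁ ev X ⊗≫ 𝟙 X) ⊗≫ f := by
        rw [← whisker_exchange]; monoidal
      _ = f := by rw [coev_ev]; monoidal
  rw [key f, key g, h]

theorem hom_ext_coevt {X Y : C} {f g : X ⟶ Y}
    (h : coevt X ≫ dual X ◁ f = coevt X ≫ dual X ◁ g) : f = g := by
  have key : ∀ f : X ⟶ Y, f = 𝟙 X ⊗≫ X ◁ (coevt X ≫ dual X ◁ f) ⊗≫ evt X ▷ Y ⊗≫ 𝟙 Y := by
    intro f
    symm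
    calc
      _ = 𝟙 _ ⊗≫ X ◁ coevt X ⊗≫ ((X ⊗ dual X) ◁ f ≫ evt X ▷ Y) ⊗≫ 𝟙 _ := by monoidal
      _ = (𝟙 X ⊗≫ X ◁ coevt X ⊗≫ evt X ▷ X ⊗≫ 𝟙 X) ⊗≫ f := by
        rw [whisker_exchange]; monoidal
      _ = f := by rw [coevt_evt]; monoidal
  rw [key f, key g, h]

theorem dualMap_eq_right {X Y : C} (f : X ⟶ Y) :
    dualMap f = 𝟙 (dual Y) ⊗≫ coevt X ▷ dual Y ⊗≫ dual X ◁ f ▷ dual Y ⊗≫ dual X ◁ evt Y ⊗≫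
      𝟙 (dual X) := left_dual_eq_right_dual f

/-- A morphism slides around a cap and becomes its dual. The versions for `evt` and `coevt` hold for
the same `dualMap` because left and right dual morphisms coincide. -/
theorem dualMap_ev {X Y : C} (f : X ⟶ Y) : dualMap f ▷ X ≫ ev X = dual Y ◁ f ≫ ev Y := by
  calc
    _ = 𝟙 _ ⊗≫ dual Y ◁ coev X ▷ X ⊗≫ dual Y ◁ f ▷ (dual X ⊗ X) ⊗≫
        (ev Y ▷ (dual X ⊗ X) ≫ 𝟙_ C ◁ ev X) ⊗≫ 𝟙 _ := by
      dsimp only [dualMap]; monoidal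
    _ = 𝟙 _ ⊗≫ dual Y ◁ coev X ▷ X ⊗≫ dual Y ◁ (f ▷ (dual X ⊗ X) ≫ Y ◁ ev X) ⊗≫
        ev Y ⊗≫ 𝟙 _ := by
      rw [← whisker_exchange]; monoidal
    _ = 𝟙 _ ⊗≫ dual Y ◁ (𝟙 X ⊗≫ coev X ▷ X ⊗≫ X ◁ ev X ⊗≫ 𝟙 X) ⊗≫ dual Y ◁ f ⊗≫
        ev Y ⊗≫ 𝟙 _ := by
      rw [← whisker_exchange]; monoidal
    _ = _ := by
      rw [coev_ev]; monoidal

theorem dualMap_evt {X Y : C} (f : X ⟶ Y) : X ◁ dualMap f ≫ evt X = f ▷ dual Y ≫ evt Y := by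
  calc
    _ = 𝟙 _ ⊗≫ X ◁ coevt X ▷ dual Y ⊗≫ (X ⊗ dual X) ◁ f ▷ dual Y ⊗≫
        ((X ⊗ dual X) ◁ evt Y ≫ evt X ▷ 𝟙_ C) ⊗≫ 𝟙 _ := by
      rw [dualMap_eq_right]; monoidal
    _ = 𝟙 _ ⊗≫ X ◁ coevt X ▷ dual Y ⊗≫ ((X ⊗ dual X) ◁ f ≫ evt X ▷ Y) ▷ dual Y ⊗≫
        evt Y ⊗≫ 𝟙 _ := by
      rw [whisker_exchange]; monoidal
    _ = 𝟙 _ ⊗≫ (𝟙 X ⊗≫ X ◁ coevt X ⊗≫ evt X ▷ X ⊗≫ 𝟙 X) ▷ dual Y ⊗≫ f ▷ dual Y ⊗≫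
        evt Y ⊗≫ 𝟙 _ := by
      rw [whisker_exchange]; monoidal
    _ = _ := by
      rw [coevt_evt]; monoidal

theorem coev_dualMap {X Y : C} (f : X ⟶ Y) :
    coev Y ≫ Y ◁ dualMap f = coev X ≫ f ▷ dual X := by
  apply hom_ext_ev
  calc
    _ = coev Y ▷ X ⊗≫ Y ◁ (dualMap f ▷ X ≫ ev X) := by monoidal
    _ = 𝟙 _ ⊗≫ (coev Y ▷ X ≫ (Y ⊗ dual Y) ◁ f) ⊗≫ Y ◁ ev Y := by rw [dualMap_ev]; monoidal
    _ = 𝟙 _ ⊗≫ f ⊗≫ (𝟙 Y ⊗≫ coev Y ▷ Y ⊗≫ Y ◁ ev Y ⊗≫ 𝟙 Y) ⊗≫ 𝟙 _ := by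
      rw [← whisker_exchange]; monoidal
    _ = 𝟙 _ ⊗≫ (𝟙 X ⊗≫ coev X ▷ X ⊗≫ X ◁ ev X ⊗≫ 𝟙 X) ⊗≫ f ⊗≫ 𝟙 _ := by
      rw [coev_ev, coev_ev]; monoidal
    _ = 𝟙 _ ⊗≫ coev X ▷ X ⊗≫ (X ◁ ev X ≫ f ▷ _) ⊗≫ 𝟙 _ := by monoidal
    _ = _ := by rw [whisker_exchange]; monoidal

theorem coevt_dualMap {X Y : C} (f : X ⟶ Y) :
    coevt Y ≫ dualMap f ▷ Y = coevt X ≫ dual X ◁ f := by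
  apply hom_ext_evt
  calc
    _ = X ◁ coevt Y ⊗≫ (X ◁ dualMap f ≫ evt X) ▷ Y := by monoidal
    _ = 𝟙 _ ⊗≫ (X ◁ coevt Y ≫ f ▷ (dual Y ⊗ Y)) ⊗≫ evt Y ▷ Y := by rw [dualMap_evt]; monoidal
    _ = 𝟙 _ ⊗≫ f ⊗≫ (𝟙 Y ⊗≫ Y ◁ coevt Y ⊗≫ evt Y ▷ Y ⊗≫ 𝟙 Y) ⊗≫ 𝟙 _ := by
      rw [whisker_exchange]; monoidal
    _ = 𝟙 _ ⊗≫ (𝟙 X ⊗≫ X ◁ coevt X ⊗≫ evt X ▷ X ⊗≫ 𝟙 X) ⊗≫ f ⊗≫ 𝟙 _ := by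
      rw [coevt_evt, coevt_evt]; monoidal
    _ = 𝟙 _ ⊗≫ X ◁ coevt X ⊗≫ (evt X ▷ X ≫ _ ◁ f) ⊗≫ 𝟙 _ := by monoidal
    _ = _ := by rw [← whisker_exchange]; monoidal

theorem hom_ext_dual {X W : C} {f g : W ⟶ dual X} (h : f ▷ X ≫ ev X = g ▷ X ≫ ev X) : f = g := by
  have : f ≫ (λ_ _).inv = g ≫ (λ_ _).inv := by
    apply hom_ext_ev
    calc
      _ = (f ▷ X ≫ ev X) ⊗≫ 𝟙 (𝟙_ C ⊗ 𝟙_ C) := by monoidal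
      _ = _ := by rw [h]; monoidal
  simpa using this

theorem dualMap_id (X : C) : dualMap (𝟙 X) = 𝟙 (dual X) := by
  apply hom_ext_dual; rw [dualMap_ev]; simp

theorem dualMap_comp {X Y Z : C} (f : X ⟶ Y) (g : Y ⟶ Z) :
    dualMap (f ≫ g) = dualMap g ≫ dualMap f := by
  apply hom_ext_dual
  rw [dualMap_ev, comp_whiskerRight, Category.assoc, dualMap_ev, ← whisker_exchange_assoc,
    dualMap_ev, whiskerLeft_comp, Category.assoc]

theorem dualMap_injective {X Y : C} {f g : X ⟶ Y} (h : dualMap f = dualMap g) : f = g := by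
  apply hom_ext_coev
  rw [← coev_dualMap, ← coev_dualMap, h]

/-- The isomorphism `f^* : Y^* ≅ X^*`. -/
@[simps]
def dualIso {X Y : C} (f : X ≅ Y) : dual Y ≅ dual X where
  hom := dualMap f.hom
  inv := dualMap f.inv
  hom_inv_id := by rw [← dualMap_comp, f.inv_hom_id, dualMap_id]
  inv_hom_id := by rw [← dualMap_comp, f.hom_inv_id, dualMap_id]

end Pivotal
end GRibbon

namespace GRibbon

open PivotalCategory

/-! ### Objects that are left and right duals in a compatible way. -/

section PivotalDual

variable {C : Type u} [Category.{v} C] [MonoidalCategory C]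

theorem PivotalCategory.evt_unit [PivotalCategory C] :
    evt (𝟙_ C) = (λ_ (dual (𝟙_ C))).hom ≫ (ρ_ (dual (𝟙_ C))).inv ≫ ev (𝟙_ C) := by
  rw [ev_unit]; simp

/-- The morphisms `capL`, `cupL` (for the left duality) and `capR`, `cupR` (for the right duality)
are carried to the chosen duality morphisms of `V` by the isomorphism `iso : W ≅ V^*`. -/
structure PivotalDual [PivotalCategory C] (V W : C) (capL : W ⊗ V ⟶ 𝟙_ C) (cupL : 𝟙_ C ⟶ V ⊗ W)
    (capR : V ⊗ W ⟶ 𝟙_ C) (cupR : 𝟙_ C ⟶ W ⊗ V) where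
  iso : W ≅ dual V
  capL_eq : capL = iso.hom ▷ V ≫ ev V
  cupL_eq : cupL = coev V ≫ V ◁ iso.inv
  capR_eq : capR = V ◁ iso.hom ≫ evt V
  cupR_eq : cupR = coevt V ≫ iso.inv ▷ V

variable [PivotalCategory C]

/-- A pivotal dual from the snake identities and a morphism `W ⟶ V^*` compatible with the caps. -/
def PivotalDual.ofSnakes {V W : C} {capL : W ⊗ V ⟶ 𝟙_ C} {cupL : 𝟙_ C ⟶ V ⊗ W}
    {capR : V ⊗ W ⟶ 𝟙_ C} {cupR : 𝟙_ C ⟶ W ⊗ V} (j : W ⟶ dual V)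
    (hL : capL = j ▷ V ≫ ev V) (hR : capR = V ◁ j ≫ evt V)
    (hL₁ : 𝟙 V ⊗≫ cupL ▷ V ⊗≫ V ◁ capL ⊗≫ 𝟙 V = 𝟙 V)
    (hL₂ : 𝟙 W ⊗≫ W ◁ cupL ⊗≫ capL ▷ W ⊗≫ 𝟙 W = 𝟙 W)
    (hR₁ : 𝟙 V ⊗≫ V ◁ cupR ⊗≫ capR ▷ V ⊗≫ 𝟙 V = 𝟙 V) :
    PivotalDual V W capL cupL capR cupR :=
  -- A cup is determined by its zigzag with a given cap, so compatibility of `j` with the caps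
  -- forces compatibility with the cups.
  have cup : cupL ≫ V ◁ j = coev V := by
    apply hom_ext_ev
    calc
      _ = cupL ▷ V ⊗≫ V ◁ (j ▷ V ≫ ev V) := by monoidal
      _ = 𝟙 _ ⊗≫ (𝟙 V ⊗≫ cupL ▷ V ⊗≫ V ◁ capL ⊗≫ 𝟙 V) ⊗≫ 𝟙 _ := by rw [← hL]; monoidal
      _ = 𝟙 _ ⊗≫ (𝟙 V ⊗≫ coev V ▷ V ⊗≫ V ◁ ev V ⊗≫ 𝟙 V) ⊗≫ 𝟙 _ := by rw [hL₁, coev_ev]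
      _ = _ := by monoidal
  have cup' : cupR ≫ j ▷ V = coevt V := by
    apply hom_ext_evt
    calc
      _ = V ◁ cupR ⊗≫ (V ◁ j ≫ evt V) ▷ V := by monoidal
      _ = 𝟙 _ ⊗≫ (𝟙 V ⊗≫ V ◁ cupR ⊗≫ capR ▷ V ⊗≫ 𝟙 V) ⊗≫ 𝟙 _ := by rw [← hR]; monoidal
      _ = 𝟙 _ ⊗≫ (𝟙 V ⊗≫ V ◁ coevt V ⊗≫ evt V ▷ V ⊗≫ 𝟙 V) ⊗≫ 𝟙 _ := by rw [hR₁, coevt_evt]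
      _ = _ := by monoidal
  let i : W ≅ dual V :=
    { hom := j
      inv := 𝟙 (dual V) ⊗≫ dual V ◁ cupL ⊗≫ ev V ▷ W ⊗≫ 𝟙 W
      hom_inv_id := by
        calc
          _ = 𝟙 _ ⊗≫ (j ▷ 𝟙_ C ≫ dual V ◁ cupL) ⊗≫ ev V ▷ W ⊗≫ 𝟙 W := by monoidal
          _ = 𝟙 W ⊗≫ W ◁ cupL ⊗≫ (j ▷ V ≫ ev V) ▷ W ⊗≫ 𝟙 W := by
            rw [← whisker_exchange]; monoidal
          _ = _ := by rw [← hL, hL₂]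
      inv_hom_id := by
        calc
          _ = 𝟙 _ ⊗≫ dual V ◁ cupL ⊗≫ (ev V ▷ W ≫ 𝟙_ C ◁ j) ⊗≫ 𝟙 _ := by monoidal
          _ = 𝟙 _ ⊗≫ dual V ◁ (cupL ≫ V ◁ j) ⊗≫ ev V ▷ dual V ⊗≫ 𝟙 _ := by
            rw [← whisker_exchange]; monoidal
          _ = _ := by rw [cup, ev_coev] }
  { iso := i
    capL_eq := hL
    cupL_eq := by
      rw [← cup, Category.assoc, ← whiskerLeft_comp, show j ≫ i.inv = 𝟙 W from i.hom_inv_id]; simp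
    capR_eq := hR
    cupR_eq := by
      rw [← cup', Category.assoc, ← comp_whiskerRight, show j ≫ i.inv = 𝟙 W from i.hom_inv_id]
      simp }

/-- The chosen dual. -/
def PivotalDual.self (X : C) : PivotalDual X (dual X) (ev X) (coev X) (evt X) (coevt X) where
  iso := Iso.refl _
  capL_eq := by simp
  cupL_eq := by simp
  capR_eq := by simp
  cupR_eq := by simp

/-- By `ev_unit` the two caps of the unit agree up to unitors, so the isomorphism matching the left
cap also matches the right one; both cases reduce to the zigzag of `coev` and `ev`. -/
theorem PivotalCategory.unitDual_evt :
    (λ_ (𝟙_ C)).hom = 𝟙_ C ◁ (coev (𝟙_ C) ≫ (λ_ _).hom) ≫ evt (𝟙_ C) := by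
  symm
  calc
    _ = 𝟙 _ ⊗≫ ((λ_ (𝟙_ C)).inv ≫ coev (𝟙_ C) ▷ 𝟙_ C ≫ (α_ _ _ _).hom ≫ 𝟙_ C ◁ ev (𝟙_ C) ≫ (ρ_ (𝟙_ C)).hom) := by
      rw [evt_unit]; monoidal
    _ = _ := by rw [coev_ev']; monoidal

theorem PivotalCategory.unitDual_ev :
    (λ_ (𝟙_ C)).hom = (coev (𝟙_ C) ≫ (λ_ _).hom) ▷ 𝟙_ C ≫ ev (𝟙_ C) := by
  symm
  calc
    _ = 𝟙 _ ⊗≫ ((λ_ (𝟙_ C)).inv ≫ coev (𝟙_ C) ▷ 𝟙_ C ≫ (α_ _ _ _).hom ≫ 𝟙_ C ◁ ev (𝟙_ C) ≫ (ρ_ (𝟙_ C)).hom) := by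
      monoidal
    _ = _ := by rw [coev_ev']; monoidal

/-- The unit object is dual to itself. -/
def PivotalDual.unit :
    PivotalDual (𝟙_ C) (𝟙_ C) (λ_ (𝟙_ C)).hom (λ_ (𝟙_ C)).inv (λ_ (𝟙_ C)).hom (λ_ (𝟙_ C)).inv :=
  .ofSnakes (coev (𝟙_ C) ≫ (λ_ _).hom) unitDual_ev unitDual_evt (by monoidal) (by monoidal)
    (by monoidal)

/-- The constraint `X^* ⊗ Y^* ⟶ (Y ⊗ X)^*`. -/
def dualTensor (X Y : C) : dual X ⊗ dual Y ⟶ dual (Y ⊗ X) :=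
  𝟙 (dual X ⊗ dual Y) ⊗≫ (dual X ⊗ dual Y) ◁ coev (Y ⊗ X) ⊗≫
    dual X ◁ ev Y ▷ (X ⊗ dual (Y ⊗ X)) ⊗≫ ev X ▷ dual (Y ⊗ X) ⊗≫ 𝟙 (dual (Y ⊗ X))

/-- Straightening the zigzag of `Y ⊗ X` leaves the nested left caps. -/
theorem dualTensor_ev (X Y : C) : dualTensor X Y ▷ (Y ⊗ X) ≫ ev (Y ⊗ X) =
    𝟙 _ ⊗≫ dual X ◁ ev Y ▷ X ⊗≫ ev X := by
  calc
    _ = 𝟙 _ ⊗≫ (dual X ⊗ dual Y) ◁ coev (Y ⊗ X) ▷ (Y ⊗ X) ⊗≫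
      ((𝟙 ((dual X ⊗ dual Y) ⊗ Y ⊗ X) ⊗≫ dual X ◁ ev Y ▷ X ⊗≫ ev X) ▷ (dual (Y ⊗ X) ⊗ (Y ⊗ X)) ≫ 𝟙_ C ◁ ev (Y ⊗ X)) ⊗≫
      𝟙 _ := by
      dsimp only [dualTensor]; monoidal
    _ = 𝟙 _ ⊗≫ (dual X ⊗ dual Y) ◁
        ((λ_ (Y ⊗ X)).inv ≫ coev (Y ⊗ X) ▷ (Y ⊗ X) ≫ (α_ _ _ _).hom ≫ (Y ⊗ X) ◁ ev (Y ⊗ X) ≫ (ρ_ (Y ⊗ X)).hom) ⊗≫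
      dual X ◁ ev Y ▷ X ⊗≫ ev X ⊗≫ 𝟙 _ := by
      rw [← whisker_exchange]; monoidal
    _ = _ := by rw [coev_ev']; monoidal

/-- The constraint defined by the left duality equals the one defined by the right duality; in the
latter form it straightens against the right caps. -/
theorem dualTensor_evt (X Y : C) : (Y ⊗ X) ◁ dualTensor X Y ≫ evt (Y ⊗ X) =
    𝟙 _ ⊗≫ Y ◁ evt X ▷ dual Y ⊗≫ evt Y := by
  have h : dualTensor X Y = _ := left_constraint_eq_right_constraint X Y
  rw [h]
  calc
    _ = 𝟙 _ ⊗≫ (Y ⊗ X) ◁ coevt (Y ⊗ X) ▷ (dual X ⊗ dual Y) ⊗≫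
      (((Y ⊗ X) ⊗ dual (Y ⊗ X)) ◁ (𝟙 ((Y ⊗ X) ⊗ dual X ⊗ dual Y) ⊗≫ Y ◁ evt X ▷ dual Y ⊗≫ evt Y) ≫ evt (Y ⊗ X) ▷ 𝟙_ C) ⊗≫
      𝟙 _ := by
      monoidal
    _ = 𝟙 _ ⊗≫ ((ρ_ (Y ⊗ X)).inv ≫ (Y ⊗ X) ◁ coevt (Y ⊗ X) ≫ (α_ _ _ _).inv ≫ evt (Y ⊗ X) ▷ (Y ⊗ X) ≫ (λ_ (Y ⊗ X)).hom) ▷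
        (dual X ⊗ dual Y) ⊗≫ Y ◁ evt X ▷ dual Y ⊗≫ evt Y ⊗≫ 𝟙 _ := by
      rw [whisker_exchange]; monoidal
    _ = _ := by rw [coevt_evt']; monoidal

theorem PivotalDual.snakeL₁ {V W : C} {capL : W ⊗ V ⟶ 𝟙_ C} {cupL : 𝟙_ C ⟶ V ⊗ W}
    {capR : V ⊗ W ⟶ 𝟙_ C} {cupR : 𝟙_ C ⟶ W ⊗ V} (d : PivotalDual V W capL cupL capR cupR) :
    𝟙 V ⊗≫ cupL ▷ V ⊗≫ V ◁ capL ⊗≫ 𝟙 V = 𝟙 V := by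
  obtain ⟨j, rfl, rfl, rfl, rfl⟩ := d
  calc
    _ = 𝟙 V ⊗≫ coev V ▷ V ⊗≫ V ◁ (j.inv ≫ j.hom) ▷ V ⊗≫ V ◁ ev V ⊗≫ 𝟙 V := by
      monoidal
    _ = _ := by
      rw [j.inv_hom_id]
      exact Eq.trans (by monoidal) (coev_ev V)

theorem PivotalDual.snakeL₂ {V W : C} {capL : W ⊗ V ⟶ 𝟙_ C} {cupL : 𝟙_ C ⟶ V ⊗ W}
    {capR : V ⊗ W ⟶ 𝟙_ C} {cupR : 𝟙_ C ⟶ W ⊗ V} (d : PivotalDual V W capL cupL capR cupR) :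
    𝟙 W ⊗≫ W ◁ cupL ⊗≫ capL ▷ W ⊗≫ 𝟙 W = 𝟙 W := by
  obtain ⟨j, rfl, rfl, rfl, rfl⟩ := d
  calc
    _ = 𝟙 W ⊗≫ W ◁ coev V ⊗≫ (j.hom ▷ (V ⊗ dual V) ≫ dual V ◁ (V ◁ j.inv)) ⊗≫
        ev V ▷ W ⊗≫ 𝟙 W := by
      rw [← whisker_exchange]; monoidal
    _ = 𝟙 W ⊗≫ (W ◁ coev V ≫ j.hom ▷ (V ⊗ dual V)) ⊗≫
        ((dual V ⊗ V) ◁ j.inv ≫ ev V ▷ W) ⊗≫ 𝟙 W := by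
      monoidal
    _ = j.hom ⊗≫ (𝟙 (dual V) ⊗≫ dual V ◁ coev V ⊗≫ ev V ▷ dual V ⊗≫ 𝟙 (dual V)) ⊗≫ j.inv := by
      rw [whisker_exchange, whisker_exchange]; monoidal
    _ = _ := by
      rw [ev_coev]
      exact Eq.trans (by monoidal) j.hom_inv_id

theorem PivotalDual.snakeR₁ {V W : C} {capL : W ⊗ V ⟶ 𝟙_ C} {cupL : 𝟙_ C ⟶ V ⊗ W}
    {capR : V ⊗ W ⟶ 𝟙_ C} {cupR : 𝟙_ C ⟶ W ⊗ V} (d : PivotalDual V W capL cupL capR cupR) :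
    𝟙 V ⊗≫ V ◁ cupR ⊗≫ capR ▷ V ⊗≫ 𝟙 V = 𝟙 V := by
  obtain ⟨j, rfl, rfl, rfl, rfl⟩ := d
  calc
    _ = 𝟙 V ⊗≫ V ◁ coevt V ⊗≫ V ◁ (j.inv ≫ j.hom) ▷ V ⊗≫ evt V ▷ V ⊗≫ 𝟙 V := by
      monoidal
    _ = _ := by
      rw [j.inv_hom_id]
      exact Eq.trans (by monoidal) (coevt_evt V)

/-- The tensor product of pivotal duals, with nested caps and cups. -/
def PivotalDual.tensor {V W V' W' : C} {capL : W ⊗ V ⟶ 𝟙_ C} {cupL : 𝟙_ C ⟶ V ⊗ W}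
    {capR : V ⊗ W ⟶ 𝟙_ C} {cupR : 𝟙_ C ⟶ W ⊗ V} {capL' : W' ⊗ V' ⟶ 𝟙_ C}
    {cupL' : 𝟙_ C ⟶ V' ⊗ W'} {capR' : V' ⊗ W' ⟶ 𝟙_ C} {cupR' : 𝟙_ C ⟶ W' ⊗ V'}
    (d : PivotalDual V W capL cupL capR cupR) (d' : PivotalDual V' W' capL' cupL' capR' cupR') :
    PivotalDual (V ⊗ V') (W' ⊗ W) (𝟙 _ ⊗≫ W' ◁ capL ▷ V' ⊗≫ capL')
      (cupL ⊗≫ V ◁ cupL' ▷ W ⊗≫ 𝟙 _) (𝟙 _ ⊗≫ V ◁ capR' ▷ W ⊗≫ capR)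
      (cupR' ⊗≫ W' ◁ cupR ▷ V' ⊗≫ 𝟙 _) :=
  -- The comparison with the chosen dual is the product of the given comparisons followed by the
  -- monoidal constraint of duality; all snakes factor into those of `d` and `d'`.
  .ofSnakes ((d'.iso.hom ⊗ₘ d.iso.hom) ≫ dualTensor V' V)
    (by
      symm
      calc
        _ = (d'.iso.hom ⊗ₘ d.iso.hom) ▷ (V ⊗ V') ≫ (dualTensor V' V ▷ (V ⊗ V') ≫ ev _) := by
          monoidal
        _ = 𝟙 _ ⊗≫ W' ◁ (d.iso.hom ▷ V) ▷ V' ⊗≫ (d'.iso.hom ▷ (dual V ⊗ V) ≫ dual V' ◁ ev V) ▷ V'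
            ⊗≫ ev V' := by
          rw [dualTensor_ev, tensorHom_def']; monoidal
        _ = 𝟙 _ ⊗≫ W' ◁ (d.iso.hom ▷ V ≫ ev V) ▷ V' ⊗≫ (d'.iso.hom ▷ V' ≫ ev V') := by
          rw [← whisker_exchange]; monoidal
        _ = _ := by rw [← d.capL_eq, ← d'.capL_eq])
    (by
      symm
      calc
        _ = (V ⊗ V') ◁ (d'.iso.hom ⊗ₘ d.iso.hom) ≫ ((V ⊗ V') ◁ dualTensor V' V ≫ evt _) := by
          monoidal
        _ = 𝟙 _ ⊗≫ V ◁ ((V' ◁ d'.iso.hom) ▷ W) ⊗≫ V ◁ ((V' ⊗ dual V') ◁ d.iso.hom ≫ evt V' ▷ dual V)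
            ⊗≫ evt V := by
          rw [dualTensor_evt, MonoidalCategory.tensorHom_def]; monoidal
        _ = 𝟙 _ ⊗≫ V ◁ (V' ◁ d'.iso.hom ≫ evt V') ▷ W ⊗≫ (V ◁ d.iso.hom ≫ evt V) := by
          rw [whisker_exchange]; monoidal
        _ = _ := by rw [← d.capR_eq, ← d'.capR_eq])
    (by
      calc
        _ = 𝟙 _ ⊗≫ cupL ▷ (V ⊗ V') ⊗≫ V ◁ (cupL' ▷ (W ⊗ V) ≫ (V' ⊗ W') ◁ capL) ▷ V' ⊗≫
            (V ⊗ V') ◁ capL' ⊗≫ 𝟙 _ := by monoidal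
        _ = 𝟙 _ ⊗≫ (𝟙 V ⊗≫ cupL ▷ V ⊗≫ V ◁ capL ⊗≫ 𝟙 V) ▷ V' ⊗≫
            V ◁ (𝟙 V' ⊗≫ cupL' ▷ V' ⊗≫ V' ◁ capL' ⊗≫ 𝟙 V') ⊗≫ 𝟙 _ := by
          rw [← whisker_exchange]; monoidal
        _ = _ := by rw [d.snakeL₁, d'.snakeL₁]; monoidal)
    (by
      calc
        _ = 𝟙 _ ⊗≫ (W' ⊗ W) ◁ cupL ⊗≫ W' ◁ ((W ⊗ V) ◁ cupL' ≫ capL ▷ (V' ⊗ W')) ▷ W ⊗≫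
            capL' ▷ (W' ⊗ W) ⊗≫ 𝟙 _ := by monoidal
        _ = 𝟙 _ ⊗≫ W' ◁ (𝟙 W ⊗≫ W ◁ cupL ⊗≫ capL ▷ W ⊗≫ 𝟙 W) ⊗≫
            (𝟙 W' ⊗≫ W' ◁ cupL' ⊗≫ capL' ▷ W' ⊗≫ 𝟙 W') ▷ W ⊗≫ 𝟙 _ := by
          rw [whisker_exchange]; monoidal
        _ = _ := by rw [d.snakeL₂, d'.snakeL₂]; monoidal)
    (by
      calc
        _ = 𝟙 _ ⊗≫ (V ⊗ V') ◁ cupR' ⊗≫ V ◁ ((V' ⊗ W') ◁ cupR ≫ capR' ▷ (W ⊗ V)) ▷ V' ⊗≫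
            capR ▷ (V ⊗ V') ⊗≫ 𝟙 _ := by monoidal
        _ = 𝟙 _ ⊗≫ V ◁ (𝟙 V' ⊗≫ V' ◁ cupR' ⊗≫ capR' ▷ V' ⊗≫ 𝟙 V') ⊗≫
            (𝟙 V ⊗≫ V ◁ cupR ⊗≫ capR ▷ V ⊗≫ 𝟙 V) ▷ V' ⊗≫ 𝟙 _ := by
          rw [whisker_exchange]; monoidal
        _ = _ := by rw [d.snakeR₁, d'.snakeR₁]; monoidal)

/-- The canonical morphism `X ⟶ X^{**}` defined by `evt X` and `coev X^*`. -/
def doubleDual (X : C) : X ⟶ dual (dual X) :=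
  𝟙 X ⊗≫ X ◁ coev (dual X) ⊗≫ evt X ▷ dual (dual X) ⊗≫ 𝟙 (dual (dual X))

theorem doubleDual_ev (X : C) : evt X = doubleDual X ▷ dual X ≫ ev (dual X) := by
  symm
  calc
    _ = 𝟙 _ ⊗≫ X ◁ coev (dual X) ▷ dual X ⊗≫ (evt X ▷ (dual (dual X) ⊗ dual X) ≫
        𝟙_ C ◁ ev (dual X)) ⊗≫ 𝟙 _ := by
      dsimp only [doubleDual]; monoidal
    _ = 𝟙 _ ⊗≫ X ◁ (𝟙 (dual X) ⊗≫ coev (dual X) ▷ dual X ⊗≫ dual X ◁ ev (dual X) ⊗≫ 𝟙 (dual X)) ⊗≫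
        evt X ⊗≫ 𝟙 _ := by
      rw [← whisker_exchange]; monoidal
    _ = _ := by rw [coev_ev]; monoidal

/-- The left and the right dual of a morphism agree. -/
theorem PivotalDual.rotate_eq {V W V' W' : C} {capL : W ⊗ V ⟶ 𝟙_ C} {cupL : 𝟙_ C ⟶ V ⊗ W}
    {capR : V ⊗ W ⟶ 𝟙_ C} {cupR : 𝟙_ C ⟶ W ⊗ V} {capL' : W' ⊗ V' ⟶ 𝟙_ C}
    {cupL' : 𝟙_ C ⟶ V' ⊗ W'} {capR' : V' ⊗ W' ⟶ 𝟙_ C} {cupR' : 𝟙_ C ⟶ W' ⊗ V'}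
    (d : PivotalDual V W capL cupL capR cupR) (d' : PivotalDual V' W' capL' cupL' capR' cupR')
    (f : V ⟶ V') :
    𝟙 W' ⊗≫ W' ◁ cupL ⊗≫ W' ◁ f ▷ W ⊗≫ capL' ▷ W ⊗≫ 𝟙 W =
      𝟙 W' ⊗≫ cupR ▷ W' ⊗≫ W ◁ f ▷ W' ⊗≫ W ◁ capR' ⊗≫ 𝟙 W := by
  obtain ⟨j, rfl, rfl, rfl, rfl⟩ := d
  obtain ⟨j', rfl, rfl, rfl, rfl⟩ := d'
  calc
    _ = 𝟙 W' ⊗≫ (W' ◁ coev V ≫ j'.hom ▷ (V ⊗ dual V)) ⊗≫ dual V' ◁ f ▷ dual V ⊗≫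
        ((dual V' ⊗ V') ◁ j.inv ≫ ev V' ▷ W) ⊗≫ 𝟙 W := by
      calc
        _ = 𝟙 W' ⊗≫ W' ◁ coev V ⊗≫ W' ◁ (V ◁ j.inv ≫ f ▷ W) ⊗≫ j'.hom ▷ (V' ⊗ W) ⊗≫
            ev V' ▷ W ⊗≫ 𝟙 W := by monoidal
        _ = 𝟙 W' ⊗≫ W' ◁ coev V ⊗≫ W' ◁ f ▷ dual V ⊗≫
            (W' ◁ (V' ◁ j.inv) ≫ j'.hom ▷ (V' ⊗ W)) ⊗≫ ev V' ▷ W ⊗≫ 𝟙 W := by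
          rw [whisker_exchange]; monoidal
        _ = 𝟙 W' ⊗≫ W' ◁ coev V ⊗≫ (W' ◁ (f ▷ dual V) ≫
            j'.hom ▷ (V' ⊗ dual V)) ⊗≫ (dual V' ⊗ V') ◁ j.inv ⊗≫ ev V' ▷ W ⊗≫ 𝟙 W := by
          rw [whisker_exchange]; monoidal
        _ = _ := by rw [whisker_exchange]; monoidal
    -- Both mates are conjugate, by the same two isomorphisms, to the dual morphism `f^*`, whose
    -- left and right descriptions coincide.
    _ = j'.hom ≫ dualMap f ≫ j.inv := by
      rw [whisker_exchange, whisker_exchange]; dsimp only [dualMap]; monoidal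
    _ = 𝟙 W' ⊗≫ (𝟙_ C ◁ j'.hom ≫ coevt V ▷ dual V') ⊗≫ dual V ◁ f ▷ dual V' ⊗≫
        (dual V ◁ evt V' ≫ j.inv ▷ 𝟙_ C) ⊗≫ 𝟙 W := by
      rw [dualMap_eq_right]; monoidal
    _ = 𝟙 W' ⊗≫ coevt V ▷ W' ⊗≫ dual V ◁ (V ◁ j'.hom ≫ f ▷ dual V') ⊗≫
        j.inv ▷ (V' ⊗ dual V') ⊗≫ W ◁ evt V' ⊗≫ 𝟙 W := by
      rw [whisker_exchange, whisker_exchange]; monoidal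
    _ = 𝟙 W' ⊗≫ coevt V ▷ W' ⊗≫ (dual V ◁ (f ▷ W' ≫ V' ◁ j'.hom) ≫
        j.inv ▷ (V' ⊗ dual V')) ⊗≫ W ◁ evt V' ⊗≫ 𝟙 W := by
      rw [whisker_exchange]; monoidal
    _ = _ := by
      rw [whisker_exchange]; monoidal

/-- The dual of `ev X`, computed with the left and with the right duality. -/
theorem coevt_eq_coev_dual (X : C) : coev (dual X) = coevt X ≫ dual X ◁
    (𝟙 X ⊗≫ coevt (dual X) ▷ X ⊗≫ dual (dual X) ◁ ev X ⊗≫ 𝟙 (dual (dual X))) := by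
  -- The left and right mates of `ev X : X^* ⊗ X ⟶ 𝟙`, for the nested duality of the source and the
  -- self-duality of the unit.
  have h := ((PivotalDual.self (dual X)).tensor (PivotalDual.self X)).rotate_eq
    PivotalDual.unit (ev X)
  calc
    _ = coev (dual X) ⊗≫ (𝟙 (dual X) ⊗≫ dual X ◁ coev X ⊗≫ ev X ▷ dual X ⊗≫ 𝟙 (dual X)) ▷
        dual (dual X) ⊗≫ 𝟙 _ := by rw [ev_coev]; monoidal
    _ = _ := Eq.trans (by monoidal) h
    _ = _ := by monoidal

/-- Rewriting `coev (dual X)` through `coevt X` leaves a zigzag of `X`, which straightens. In this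
form the morphism is compatible with the other cap, so a single isomorphism `X ≅ X^{**}` serves both
dualities. -/
theorem doubleDual_eq (X : C) : doubleDual X =
    𝟙 X ⊗≫ coevt (dual X) ▷ X ⊗≫ dual (dual X) ◁ ev X ⊗≫ 𝟙 (dual (dual X)) := by
  rw [doubleDual, coevt_eq_coev_dual]
  generalize (𝟙 X ⊗≫ coevt (dual X) ▷ X ⊗≫ dual (dual X) ◁ ev X ⊗≫ 𝟙 (dual (dual X))) = f
  calc
    _ = 𝟙 _ ⊗≫ X ◁ coevt X ⊗≫ ((X ⊗ dual X) ◁ f ≫ evt X ▷ dual (dual X)) ⊗≫ 𝟙 _ := by monoidal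
    _ = (𝟙 X ⊗≫ X ◁ coevt X ⊗≫ evt X ▷ X ⊗≫ 𝟙 X) ≫ f := by rw [whisker_exchange]; monoidal
    _ = f := by rw [coevt_evt]; monoidal

theorem doubleDual_evt (X : C) : ev X = dual X ◁ doubleDual X ≫ evt (dual X) := by
  rw [doubleDual_eq]
  symm
  calc
    _ = 𝟙 _ ⊗≫ dual X ◁ coevt (dual X) ▷ X ⊗≫
        ((dual X ⊗ dual (dual X)) ◁ ev X ≫ evt (dual X) ▷ 𝟙_ C) ⊗≫ 𝟙 _ := by monoidal
    _ = 𝟙 _ ⊗≫ (𝟙 (dual X) ⊗≫ dual X ◁ coevt (dual X) ⊗≫ evt (dual X) ▷ dual X ⊗≫ 𝟙 (dual X)) ▷ X ⊗≫ ev X ⊗≫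
        𝟙 _ := by rw [whisker_exchange]; monoidal
    _ = _ := by rw [coevt_evt]; monoidal

/-- The object `X` is dual to `X^*`. -/
def PivotalDual.double (X : C) :
    PivotalDual (dual X) X (evt X) (coevt X) (ev X) (coev X) :=
  .ofSnakes (doubleDual X) (doubleDual_ev X) (doubleDual_evt X) (evt_coevt X) (coevt_evt X)
    (ev_coev X)

/-- A zigzag of `F(Y)` straightens. This is the characterization of the comparison morphism: it
carries the chosen cap of `F(Y)` to the image of the cap of `Y`. -/
theorem leftComparison_ev (F : C ⥤ C) [F.Monoidal] (Y : C) :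
    leftComparison F Y ▷ F.obj Y ≫ ev (F.obj Y) = Functor.LaxMonoidal.μ F (dual Y) Y ≫
      F.map (ev Y) ≫ Functor.OplaxMonoidal.η F := by
  rw [leftComparison]
  generalize Functor.LaxMonoidal.μ F (dual Y) Y ≫ F.map (ev Y) ≫ Functor.OplaxMonoidal.η F = f
  calc
    _ = 𝟙 _ ⊗≫ F.obj (dual Y) ◁ coev (F.obj Y) ▷ F.obj Y ⊗≫
        (f ▷ (dual (F.obj Y) ⊗ F.obj Y) ≫ 𝟙_ C ◁ ev (F.obj Y)) ⊗≫ 𝟙 _ := by monoidal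
    _ = 𝟙 _ ⊗≫ F.obj (dual Y) ◁ (𝟙 (F.obj Y) ⊗≫ coev (F.obj Y) ▷ F.obj Y ⊗≫
        F.obj Y ◁ ev (F.obj Y) ⊗≫ 𝟙 (F.obj Y)) ⊗≫ f := by
      rw [← whisker_exchange]; monoidal
    _ = f := by rw [coev_ev]; monoidal

theorem rightComparison_evt (F : C ⥤ C) [F.Monoidal] (Y : C) :
    F.obj Y ◁ rightComparison F Y ≫ evt (F.obj Y) = Functor.LaxMonoidal.μ F Y (dual Y) ≫
      F.map (evt Y) ≫ Functor.OplaxMonoidal.η F := by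
  rw [rightComparison]
  generalize Functor.LaxMonoidal.μ F Y (dual Y) ≫ F.map (evt Y) ≫ Functor.OplaxMonoidal.η F = f
  calc
    _ = 𝟙 _ ⊗≫ F.obj Y ◁ coevt (F.obj Y) ▷ F.obj (dual Y) ⊗≫
        ((F.obj Y ⊗ dual (F.obj Y)) ◁ f ≫ evt (F.obj Y) ▷ 𝟙_ C) ⊗≫ 𝟙 _ := by monoidal
    _ = 𝟙 _ ⊗≫ (𝟙 (F.obj Y) ⊗≫ F.obj Y ◁ coevt (F.obj Y) ⊗≫ evt (F.obj Y) ▷ F.obj Y ⊗≫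
        𝟙 (F.obj Y)) ▷ F.obj (dual Y) ⊗≫ f := by
      rw [whisker_exchange]; monoidal
    _ = f := by rw [coevt_evt]; monoidal

end PivotalDual
end GRibbon

namespace GRibbon

open PivotalCategory GGradedCategory GCrossing GBraiding

/-! ### The braiding at the unit, and crossings with rotated strands. -/

section BraidingLemmas

variable {G : Type w} [Group G] {C : Type u} [Category.{v} C] [MonoidalCategory C] [Preadditive C]
  [GGradedCategory G C] [GCrossing G C] [GBraiding G C]

theorem braid_natural_left {X X' Y : C} {β : G} (hY : component β Y) (f : X ⟶ X') :
    f ▷ Y ≫ (braid X' hY).hom = (braid X hY).hom ≫ Y ◁ (act β).map f := by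
  simpa using braid_naturality hY hY f (𝟙 Y)

theorem braid_natural_left_assoc {X X' Y W : C} {β : G} (hY : component β Y) (f : X ⟶ X')
    (h : Y ⊗ (act β).obj X' ⟶ W) :
    f ▷ Y ≫ (braid X' hY).hom ≫ h = (braid X hY).hom ≫ Y ◁ (act β).map f ≫ h := by
  rw [← Category.assoc, braid_natural_left, Category.assoc]

theorem braid_natural_right (X : C) {Y Y' : C} {β : G} (hY : component β Y)
    (hY' : component β Y') (g : Y ⟶ Y') :
    X ◁ g ≫ (braid X hY').hom = (braid X hY).hom ≫ g ▷ (act β).obj X := by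
  simpa using braid_naturality hY hY' (𝟙 X) g

theorem braid_natural_right_assoc (X : C) {Y Y' W : C} {β : G} (hY : component β Y)
    (hY' : component β Y') (g : Y ⟶ Y') (h : Y' ⊗ (act β).obj X ⟶ W) :
    X ◁ g ≫ (braid X hY').hom ≫ h = (braid X hY).hom ≫ g ▷ (act β).obj X ≫ h := by
  rw [← Category.assoc, braid_natural_right X hY hY', Category.assoc]

theorem braid_tensor_right' (X : C) {Y Z : C} {β γ δ : G} (hY : component β Y)
    (hZ : component γ Z) (h : β * γ = δ) (hYZ : component δ (Y ⊗ Z)) :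
    (braid X hYZ).hom =
      𝟙 (X ⊗ (Y ⊗ Z)) ⊗≫ (braid X hY).hom ▷ Z ⊗≫ Y ◁ (braid ((act β).obj X) hZ).hom ⊗≫
        (Y ⊗ Z) ◁ (actMulIso γ β δ h X).hom ⊗≫ 𝟙 ((Y ⊗ Z) ⊗ (act δ).obj X) := by
  subst h
  exact braid_tensor_right X hY hZ

variable (G) in
/-- The isomorphism `φ_0 : X ≅ φ_1(X)`. -/
def actOneIso (X : C) : X ≅ (act (1 : G)).obj X := actOne.app X

/-- The tensor axiom for `𝟙 ⊗ 𝟙` determines the braiding with the unit at objects of the form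
`φ_1(X)`; naturality along `φ_0 : X ≅ φ_1(X)` transfers the result to every `X`. -/
theorem braid_unit_right (X : C) (h : component (1 : G) (𝟙_ C)) :
    (braid X h).hom = (ρ_ X).hom ≫ (λ_ X).inv ≫ 𝟙_ C ◁ (actOneIso G X).hom := by
  let t (X : C) : X ⟶ (act (1 : G)).obj X := (ρ_ X).inv ≫ (braid X h).hom ≫ (λ_ _).hom
  have braid_t (X : C) : (braid X h).hom = (ρ_ X).hom ≫ t X ≫ (λ_ _).inv := by simp [t]
  have nat {X Y : C} (f : X ⟶ Y) : t X ≫ (act (1 : G)).map f = f ≫ t Y := by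
    have := braid_natural_left h f
    rw [braid_t, braid_t] at this
    calc
      _ = (ρ_ X).inv ≫ (((ρ_ X).hom ≫ t X ≫ (λ_ _).inv) ≫ 𝟙_ C ◁ (act (1 : G)).map f) ≫
          (λ_ _).hom := by simp
      _ = _ := by rw [← this]; simp
  have ht (X : C) : IsIso (t X) := by dsimp only [t]; infer_instance
  -- Cancelling `t X` makes `t` at `φ_1(X)` a one-sided inverse of `φ_2(1,1)`; coherence says the
  -- same of `φ_0`.
  have sq (X : C) : t X = t X ≫ t ((act (1 : G)).obj X) ≫
      (actMulIso (1 : G) 1 1 (one_mul 1) X).hom := by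
    have h1 := braid_natural_right X (by simpa using tensor_mem h h) h (λ_ (𝟙_ C)).hom
    rw [braid_tensor_right' X h h (one_mul 1), braid_t, braid_t] at h1
    calc
      _ = (ρ_ X).inv ≫ X ◁ (λ_ (𝟙_ C)).inv ≫ (X ◁ (λ_ (𝟙_ C)).hom ≫
          (ρ_ X).hom ≫ t X ≫ (λ_ _).inv) ≫ (λ_ _).hom := by simp
      _ = _ := by rw [h1]; monoidal
  have key (X : C) : t ((act (1 : G)).obj X) = actOne.hom.app ((act (1 : G)).obj X) := by
    have h1 : t ((act (1 : G)).obj X) ≫ (actMulIso (1 : G) 1 1 (one_mul 1) X).hom = 𝟙 _ := by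
      rw [← cancel_epi (t X), ← sq X]; simp
    have h2 : actOne.hom.app ((act (1 : G)).obj X) ≫
        (actMulIso (1 : G) 1 1 (one_mul 1) X).hom = 𝟙 _ := by
      have := actOne_act (1 : G) X
      simp only [actMulIso, Iso.trans_hom, Iso.app_hom, eqToIso.hom]
      rw [← Category.assoc, this]; simp
    exact (cancel_mono (actMulIso (1 : G) 1 1 (one_mul 1) X).hom).1 (h1.trans h2.symm)
  have : t X = (actOneIso G X).hom := by
    change t X = (actOne (G := G)).hom.app X
    have : IsIso ((act (1 : G)).map ((actOne (G := G)).hom.app X)) :=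
      ((act (1 : G)).mapIso ((actOne (G := G)).app X)).isIso_hom
    rw [← cancel_mono ((act (1 : G)).map ((actOne (G := G)).hom.app X)), nat, key]
    simpa using (actOne (G := G)).hom.naturality ((actOne (G := G)).hom.app X)
  rw [braid_t, this]; simp

/-- After removal of the monoidal unit constraint of `φ_γ`, the braiding with `𝟙 ⊗ 𝟙` shows that
what is left is an idempotent automorphism of `Z`, hence the identity. -/
theorem braid_unit_left {Z : C} {γ : G} (hZ : component γ Z) :
    (braid (𝟙_ C) hZ).hom = (λ_ Z).hom ≫ (ρ_ Z).inv ≫ Z ◁ Functor.LaxMonoidal.ε (act γ) := by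
  let t : Z ⟶ Z := (λ_ Z).inv ≫ (braid (𝟙_ C) hZ).hom ≫
    Z ◁ Functor.OplaxMonoidal.η (act γ) ≫ (ρ_ Z).hom
  have braid_t : (braid (𝟙_ C) hZ).hom =
      (λ_ Z).hom ≫ t ≫ (ρ_ Z).inv ≫ Z ◁ Functor.LaxMonoidal.ε (act γ) := by
    simp [t, ← whiskerLeft_comp]
  have ht : IsIso t := by dsimp only [t]; infer_instance
  have h1 := braid_natural_left hZ (λ_ (𝟙_ C)).hom
  rw [braid_tensor_left, braid_t] at h1
  have h2 : t ≫ t = t := by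
    have h3 : (λ_ (𝟙_ C)).hom ▷ Z ≫ (λ_ Z).hom ≫ t ≫ (ρ_ Z).inv ≫
        Z ◁ Functor.LaxMonoidal.ε (act γ) = (λ_ (𝟙_ C)).hom ▷ Z ≫ (λ_ Z).hom ≫ t ≫ t ≫
          (ρ_ Z).inv ≫ Z ◁ Functor.LaxMonoidal.ε (act γ) := by
      rw [h1]
      calc
        _ = 𝟙 _ ⊗≫ t ⊗≫ (Z ◁ Functor.LaxMonoidal.ε (act γ) ≫ t ▷ _) ⊗≫
            Z ◁ (Functor.LaxMonoidal.ε (act γ) ▷ _ ≫ Functor.LaxMonoidal.μ (act γ) (𝟙_ C) (𝟙_ C) ≫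
              (act γ).map (λ_ (𝟙_ C)).hom) := by monoidal
        _ = _ := by
          rw [← Functor.LaxMonoidal.left_unitality, whisker_exchange]; monoidal
    rw [← cancel_mono ((ρ_ Z).inv ≫ Z ◁ Functor.LaxMonoidal.ε (act γ)),
      ← cancel_epi ((λ_ (𝟙_ C)).hom ▷ Z ≫ (λ_ Z).hom)]
    simpa using h3.symm
  have h3 : t = 𝟙 Z := by rw [← cancel_epi t, h2, Category.comp_id]
  rw [braid_t, h3, Category.id_comp]

/-- The isomorphism `Y ⊗ Z ≅ Z ⊗ X` induced by `ψ : X ≅ φ_γ(Y)`, where `Z ∈ C_γ`. -/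
def crossIso (Y : C) {X Z : C} {γ : G} (hZ : component γ Z) (ψ : X ≅ (act γ).obj Y) :
    Y ⊗ Z ≅ Z ⊗ X :=
  braid Y hZ ≪≫ whiskerLeftIso Z ψ.symm

theorem crossIso_hom (Y : C) {X Z : C} {γ : G} (hZ : component γ Z) (ψ : X ≅ (act γ).obj Y) :
    (crossIso Y hZ ψ).hom = (braid Y hZ).hom ≫ Z ◁ ψ.inv := rfl

theorem crossIso_inv (Y : C) {X Z : C} {γ : G} (hZ : component γ Z) (ψ : X ≅ (act γ).obj Y) :
    (crossIso Y hZ ψ).inv = Z ◁ ψ.hom ≫ (braid Y hZ).inv := rfl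

variable [PivotalCategory C]

/-- The isomorphism `φ_γ(Y) ⊗ Z^* ≅ Z^* ⊗ Y` given by the braiding. -/
def braidDual (Y : C) {Z : C} {γ : G} (hZ' : component γ⁻¹ (dual Z)) :
    (act γ).obj Y ⊗ dual Z ≅ dual Z ⊗ Y :=
  braid ((act γ).obj Y) hZ' ≪≫ whiskerLeftIso (dual Z)
    (actMulIso γ⁻¹ γ 1 (mul_inv_cancel γ) Y ≪≫ (actOneIso G Y).symm)

theorem braidDual_hom (Y : C) {Z : C} {γ : G} (hZ' : component γ⁻¹ (dual Z)) :
    (braidDual Y hZ').hom = (braid ((act γ).obj Y) hZ').hom ≫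
      dual Z ◁ (actMulIso γ⁻¹ γ 1 (mul_inv_cancel γ) Y).hom ≫ dual Z ◁ (actOneIso G Y).inv := by
  simp [braidDual]

/-- Naturality of the braiding in the lower strand at `evt Z : Z ⊗ Z^* ⟶ 𝟙`, both objects having
degree `1`: the strand `Y` moves in front of a cap. The tensor axiom splits the crossing and
`braid_unit_right` removes the trivial one. -/
theorem braid_evt (Y : C) {Z : C} {γ : G} (hZ : component γ Z) (hZ' : component γ⁻¹ (dual Z)) :
    𝟙 (Y ⊗ (Z ⊗ dual Z)) ⊗≫ (braid Y hZ).hom ▷ dual Z ⊗≫ Z ◁ (braidDual Y hZ').hom ⊗≫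
      evt Z ▷ Y = Y ◁ evt Z ⊗≫ 𝟙 (𝟙_ C ⊗ Y) := by
  have h1 : component (1 : G) (Z ⊗ dual Z) := by simpa using tensor_mem hZ hZ'
  have h2 := braid_natural_right Y h1 unit_mem (evt Z)
  rw [braid_tensor_right' Y hZ hZ' (mul_inv_cancel γ) h1, braid_unit_right] at h2
  rw [braidDual_hom]
  calc
    _ = 𝟙 _ ⊗≫ (braid Y hZ).hom ▷ dual Z ⊗≫ Z ◁ (braid ((act γ).obj Y) hZ').hom ⊗≫
        (Z ⊗ dual Z) ◁ (actMulIso γ⁻¹ γ 1 (mul_inv_cancel γ) Y).hom ⊗≫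
        ((Z ⊗ dual Z) ◁ (actOneIso G Y).inv ≫ evt Z ▷ Y) := by monoidal
    _ = ((𝟙 (Y ⊗ (Z ⊗ dual Z)) ⊗≫ (braid Y hZ).hom ▷ dual Z ⊗≫
        Z ◁ (braid ((act γ).obj Y) hZ').hom ⊗≫
        (Z ⊗ dual Z) ◁ (actMulIso γ⁻¹ γ 1 (mul_inv_cancel γ) Y).hom ⊗≫
        𝟙 ((Z ⊗ dual Z) ⊗ (act (1 : G)).obj Y)) ≫ evt Z ▷ (act (1 : G)).obj Y) ≫
        𝟙_ C ◁ (actOneIso G Y).inv := by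
      rw [whisker_exchange]; monoidal
    _ = Y ◁ evt Z ⊗≫ 𝟙_ C ◁ ((actOneIso G Y).hom ≫ (actOneIso G Y).inv) := by
      rw [← h2]; monoidal
    _ = _ := by rw [Iso.hom_inv_id]; monoidal

theorem braid_coev (Y : C) {Z : C} {γ : G} (hZ : component γ Z) (hZ' : component γ⁻¹ (dual Z)) :
    Y ◁ coev Z ⊗≫ (braid Y hZ).hom ▷ dual Z ⊗≫ Z ◁ (braidDual Y hZ').hom =
      𝟙 (Y ⊗ 𝟙_ C) ⊗≫ coev Z ▷ Y ⊗≫ 𝟙 (Z ⊗ (dual Z ⊗ Y)) := by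
  have h1 : component (1 : G) (Z ⊗ dual Z) := by simpa using tensor_mem hZ hZ'
  have h2 := braid_natural_right Y unit_mem h1 (coev Z)
  rw [braid_tensor_right' Y hZ hZ' (mul_inv_cancel γ) h1, braid_unit_right] at h2
  rw [braidDual_hom]
  calc
    _ = (Y ◁ coev Z ≫ (𝟙 (Y ⊗ (Z ⊗ dual Z)) ⊗≫ (braid Y hZ).hom ▷ dual Z ⊗≫
        Z ◁ (braid ((act γ).obj Y) hZ').hom ⊗≫
        (Z ⊗ dual Z) ◁ (actMulIso γ⁻¹ γ 1 (mul_inv_cancel γ) Y).hom ⊗≫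
        𝟙 ((Z ⊗ dual Z) ⊗ (act (1 : G)).obj Y))) ⊗≫
        (Z ⊗ dual Z) ◁ (actOneIso G Y).inv ⊗≫ 𝟙 _ := by monoidal
    _ = 𝟙 _ ⊗≫ (actOneIso G Y).hom ⊗≫ (coev Z ▷ _ ≫ (Z ⊗ dual Z) ◁ (actOneIso G Y).inv) ⊗≫ 𝟙 _ := by
      rw [h2]; monoidal
    _ = 𝟙 _ ⊗≫ ((actOneIso G Y).hom ≫ (actOneIso G Y).inv) ⊗≫ coev Z ▷ Y ⊗≫ 𝟙 _ := by
      rw [← whisker_exchange]; monoidal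
    _ = _ := by rw [Iso.hom_inv_id]; monoidal

theorem rotR_crossIso_inv_aux (Y : C) {X Z : C} {γ : G} (hZ : component γ Z)
    (hZ' : component γ⁻¹ (dual Z)) (ψ : X ≅ (act γ).obj Y) :
    rotR (crossIso Y hZ ψ).inv = ψ.hom ▷ dual Z ≫ (braidDual Y hZ').hom := by
  apply hom_ext_evt
  rw [rotR_evt, crossIso_inv]
  symm
  calc
    _ = 𝟙 _ ⊗≫ (Z ◁ ψ.hom) ▷ dual Z ⊗≫ (𝟙 (Z ⊗ (act γ).obj Y)) ▷ dual Z ⊗≫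
         Z ◁ (braidDual Y hZ').hom ⊗≫ evt Z ▷ Y := by monoidal
    _ = 𝟙 _ ⊗≫ (Z ◁ ψ.hom) ▷ dual Z ⊗≫ (braid Y hZ).inv ▷ dual Z ⊗≫
        (𝟙 (Y ⊗ (Z ⊗ dual Z)) ⊗≫ (braid Y hZ).hom ▷ dual Z ⊗≫ Z ◁ (braidDual Y hZ').hom ⊗≫
          evt Z ▷ Y) := by
      rw [← (braid Y hZ).inv_hom_id]; monoidal
    _ = _ := by rw [braid_evt]; monoidal

/-- Rotating the inverse crossing turns the lower strand into `Z^*`. Moving `ψ` through the braiding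
applies `φ_{γ⁻¹}` to it, and together with the constraints `φ_2`, `φ_0` this assembles the inverse
of `ψ̄`. -/
theorem rotR_crossIso_inv (Y : C) {X Z : C} {γ : G} (hZ : component γ Z)
    (hZ' : component γ⁻¹ (dual Z)) (ψ : X ≅ (act γ).obj Y) :
    rotR (crossIso Y hZ ψ).inv = (crossIso X hZ' (barIso ψ)).hom := by
  rw [rotR_crossIso_inv_aux Y hZ hZ', crossIso_hom, braidDual_hom, braid_natural_left_assoc]
  simp [barIso, actOneIso]

/-- The strand `Y` moves in front of the cup `coev Z` by `braid_coev`, after which `Z^*` is a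
zigzag. This is move 2(c). -/
theorem rotL_crossIso_hom_rotR (Y : C) {X Z : C} {γ : G} (hZ : component γ Z)
    (hZ' : component γ⁻¹ (dual Z)) (ψ : X ≅ (act γ).obj Y) :
    rotL (crossIso Y hZ ψ).hom ≫ rotR (crossIso Y hZ ψ).inv = 𝟙 _ := by
  rw [rotR_crossIso_inv_aux Y hZ hZ', crossIso_hom]
  calc
    _ = 𝟙 _ ⊗≫ (dual Z ⊗ Y) ◁ coev Z ⊗≫ dual Z ◁ (braid Y hZ).hom ▷ dual Z ⊗≫
        (dual Z ⊗ Z) ◁ (ψ.inv ▷ dual Z) ⊗≫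
        (ev Z ▷ (X ⊗ dual Z) ≫ 𝟙_ C ◁ (ψ.hom ▷ dual Z ≫ (braidDual Y hZ').hom)) ⊗≫ 𝟙 _ := by
      dsimp only [rotL]; monoidal
    _ = 𝟙 _ ⊗≫ (dual Z ⊗ Y) ◁ coev Z ⊗≫ dual Z ◁ (braid Y hZ).hom ▷ dual Z ⊗≫
        (dual Z ⊗ Z) ◁ ((ψ.inv ≫ ψ.hom) ▷ dual Z ≫ (braidDual Y hZ').hom) ⊗≫
        ev Z ▷ (dual Z ⊗ Y) ⊗≫ 𝟙 _ := by
      rw [← whisker_exchange]; monoidal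
    _ = 𝟙 _ ⊗≫ dual Z ◁ (Y ◁ coev Z ⊗≫ (braid Y hZ).hom ▷ dual Z ⊗≫ Z ◁ (braidDual Y hZ').hom) ⊗≫
        ev Z ▷ (dual Z ⊗ Y) ⊗≫ 𝟙 _ := by
      rw [ψ.inv_hom_id]; monoidal
    _ = 𝟙 _ ⊗≫ (𝟙 (dual Z) ⊗≫ dual Z ◁ coev Z ⊗≫ ev Z ▷ dual Z ⊗≫ 𝟙 (dual Z)) ▷ Y ⊗≫ 𝟙 _ := by
      rw [braid_coev]; monoidal
    _ = _ := by rw [ev_coev]; monoidal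

theorem rotL_crossIso_hom (Y : C) {X Z : C} {γ : G} (hZ : component γ Z)
    (hZ' : component γ⁻¹ (dual Z)) (ψ : X ≅ (act γ).obj Y) :
    rotL (crossIso Y hZ ψ).hom = (crossIso X hZ' (barIso ψ)).inv := by
  rw [← cancel_mono (crossIso X hZ' (barIso ψ)).hom, Iso.inv_hom_id, ← rotR_crossIso_inv Y hZ hZ',
    rotL_crossIso_hom_rotR Y hZ hZ']

/-- The isomorphism `Y^* ⊗ Z ≅ Z ⊗ φ_γ(Y)^*` given by the braiding. -/
noncomputable def dualBraid (Y : C) {Z : C} {γ : G} (hZ : component γ Z) :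
    dual Y ⊗ Z ≅ Z ⊗ dual ((act γ).obj Y) :=
  braid (dual Y) hZ ≪≫ whiskerLeftIso Z (comparisonIso (act γ) Y)

/-- Naturality of the braiding in the upper strand at `ev Y : Y^* ⊗ Y ⟶ 𝟙`: a cap moves in front of
`Z`. The left comparison `φ_γ(Y^*) ≅ φ_γ(Y)^*` turns the image of the cap into a chosen cap. -/
theorem ev_braid (Y : C) {Z : C} {γ : G} (hZ : component γ Z) :
    𝟙 ((dual Y ⊗ Y) ⊗ Z) ⊗≫ dual Y ◁ (braid Y hZ).hom ⊗≫ (dualBraid Y hZ).hom ▷ (act γ).obj Y ⊗≫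
      Z ◁ ev ((act γ).obj Y) = ev Y ▷ Z ⊗≫ 𝟙 (Z ⊗ 𝟙_ C) := by
  have h2 := braid_natural_left hZ (ev Y)
  rw [braid_tensor_left, braid_unit_left] at h2
  have hc : (comparisonIso (act γ) Y).hom = leftComparison (act γ) Y := rfl
  simp only [dualBraid, Iso.trans_hom, whiskerLeftIso_hom, hc]
  calc
    _ = 𝟙 _ ⊗≫ dual Y ◁ (braid Y hZ).hom ⊗≫ (braid (dual Y) hZ).hom ▷ (act γ).obj Y ⊗≫
        Z ◁ (leftComparison (act γ) Y ▷ (act γ).obj Y ≫ ev ((act γ).obj Y)) := by monoidal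
    _ = ((𝟙 ((dual Y ⊗ Y) ⊗ Z) ⊗≫ dual Y ◁ (braid Y hZ).hom ⊗≫
          (braid (dual Y) hZ).hom ▷ (act γ).obj Y ⊗≫
          Z ◁ Functor.LaxMonoidal.μ (act γ) (dual Y) Y ⊗≫ 𝟙 (Z ⊗ (act γ).obj (dual Y ⊗ Y))) ≫
        Z ◁ (act γ).map (ev Y)) ≫ Z ◁ Functor.OplaxMonoidal.η (act γ) := by
      rw [leftComparison_ev]; monoidal
    _ = ev Y ▷ Z ⊗≫
        Z ◁ (Functor.LaxMonoidal.ε (act γ) ≫ Functor.OplaxMonoidal.η (act γ)) := by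
      rw [← h2]; monoidal
    _ = _ := by rw [Functor.Monoidal.ε_η]; monoidal

/-- The right cap calls for the right comparison, whereas `dualBraid` contains the left one; they
agree because the crossing is pivotal. -/
theorem evt_braid [PivotalCrossing G C] (Y : C) {Z : C} {γ : G} (hZ : component γ Z) :
    Y ◁ (dualBraid Y hZ).hom ⊗≫ (braid Y hZ).hom ▷ dual ((act γ).obj Y) ⊗≫
      Z ◁ evt ((act γ).obj Y) = 𝟙 (Y ⊗ (dual Y ⊗ Z)) ⊗≫ evt Y ▷ Z ⊗≫ 𝟙 (Z ⊗ 𝟙_ C) := by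
  have h2 := braid_natural_left hZ (evt Y)
  rw [braid_tensor_left, braid_unit_left] at h2
  have hc : (comparisonIso (act γ) Y).hom = rightComparison (act γ) Y :=
    PivotalCrossing.left_eq_right γ Y
  simp only [dualBraid, Iso.trans_hom, whiskerLeftIso_hom, hc]
  calc
    _ = 𝟙 _ ⊗≫ Y ◁ (braid (dual Y) hZ).hom ⊗≫ ((Y ⊗ Z) ◁ rightComparison (act γ) Y ≫
        (braid Y hZ).hom ▷ dual ((act γ).obj Y)) ⊗≫ Z ◁ evt ((act γ).obj Y) := by monoidal
    _ = 𝟙 _ ⊗≫ Y ◁ (braid (dual Y) hZ).hom ⊗≫ (braid Y hZ).hom ▷ (act γ).obj (dual Y) ⊗≫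
        Z ◁ ((act γ).obj Y ◁ rightComparison (act γ) Y ≫ evt ((act γ).obj Y)) := by
      rw [whisker_exchange]; monoidal
    _ = 𝟙 _ ⊗≫ ((𝟙 ((Y ⊗ dual Y) ⊗ Z) ⊗≫ Y ◁ (braid (dual Y) hZ).hom ⊗≫
          (braid Y hZ).hom ▷ (act γ).obj (dual Y) ⊗≫
          Z ◁ Functor.LaxMonoidal.μ (act γ) Y (dual Y) ⊗≫ 𝟙 (Z ⊗ (act γ).obj (Y ⊗ dual Y))) ≫
        Z ◁ (act γ).map (evt Y)) ≫ Z ◁ Functor.OplaxMonoidal.η (act γ) := by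
      rw [rightComparison_evt]; monoidal
    _ = 𝟙 _ ⊗≫ evt Y ▷ Z ⊗≫
        Z ◁ (Functor.LaxMonoidal.ε (act γ) ≫ Functor.OplaxMonoidal.η (act γ)) := by
      rw [← h2]; monoidal
    _ = _ := by rw [Functor.Monoidal.ε_η]; monoidal

theorem rotL_crossIso_inv_aux (Y : C) {X Z : C} {γ : G} (hZ : component γ Z)
    (ψ : X ≅ (act γ).obj Y) :
    rotL (crossIso Y hZ ψ).inv = (dualBraid Y hZ).hom ≫ Z ◁ dualMap ψ.hom := by
  apply hom_ext_ev
  rw [rotL_ev, crossIso_inv]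
  symm
  calc
    _ = (dualBraid Y hZ).hom ▷ X ⊗≫ Z ◁ (dualMap ψ.hom ▷ X ≫ ev X) := by monoidal
    _ = 𝟙 _ ⊗≫ ((dualBraid Y hZ).hom ▷ X ≫ (Z ⊗ dual ((act γ).obj Y)) ◁ ψ.hom) ⊗≫
        Z ◁ ev ((act γ).obj Y) := by
      rw [dualMap_ev]; monoidal
    _ = 𝟙 _ ⊗≫ dual Y ◁ (Z ◁ ψ.hom) ⊗≫ (dual Y ◁ (𝟙 (Z ⊗ (act γ).obj Y))) ⊗≫
        (dualBraid Y hZ).hom ▷ (act γ).obj Y ⊗≫ Z ◁ ev ((act γ).obj Y) := by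
      rw [← whisker_exchange]; monoidal
    _ = 𝟙 _ ⊗≫ dual Y ◁ (Z ◁ ψ.hom ≫ (braid Y hZ).inv) ⊗≫
        (𝟙 ((dual Y ⊗ Y) ⊗ Z) ⊗≫ dual Y ◁ (braid Y hZ).hom ⊗≫
        (dualBraid Y hZ).hom ▷ (act γ).obj Y ⊗≫ Z ◁ ev ((act γ).obj Y)) := by
      rw [← (braid Y hZ).inv_hom_id]; monoidal
    _ = _ := by rw [ev_braid]

/-- After bending the `Y` strand, `ψ` slides around the cap and cancels its inverse, and `evt_braid`
removes the remaining pair of crossings. With `rotL_crossIso_inv` this identifies `rotR` of the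
crossing as an inverse. -/
theorem rotL_crossIso_inv_rotR [PivotalCrossing G C] (Y : C) {X Z : C} {γ : G}
    (hZ : component γ Z) (ψ : X ≅ (act γ).obj Y) :
    rotL (crossIso Y hZ ψ).inv ≫ rotR (crossIso Y hZ ψ).hom = 𝟙 _ := by
  apply hom_ext_evt
  calc
    _ = Y ◁ rotL (crossIso Y hZ ψ).inv ⊗≫
        (Y ◁ rotR (crossIso Y hZ ψ).hom ⊗≫ evt Y ▷ Z) := by monoidal
    _ = Y ◁ (dualBraid Y hZ).hom ⊗≫ ((Y ⊗ Z) ◁ dualMap ψ.hom ≫ (braid Y hZ).hom ▷ dual X) ⊗≫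
        Z ◁ (ψ.inv ▷ dual X ≫ evt X) ⊗≫ 𝟙 _ := by
      rw [rotR_evt, rotL_crossIso_inv_aux, crossIso_hom]; monoidal
    _ = Y ◁ (dualBraid Y hZ).hom ⊗≫ (braid Y hZ).hom ▷ dual ((act γ).obj Y) ⊗≫
        Z ◁ ((act γ).obj Y ◁ (dualMap ψ.hom ≫ dualMap ψ.inv) ≫ evt ((act γ).obj Y)) ⊗≫ 𝟙 _ := by
      rw [whisker_exchange, ← dualMap_evt]; monoidal
    _ = (Y ◁ (dualBraid Y hZ).hom ⊗≫ (braid Y hZ).hom ▷ dual ((act γ).obj Y) ⊗≫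
        Z ◁ evt ((act γ).obj Y)) ⊗≫ 𝟙 _ := by
      rw [← dualMap_comp, ψ.inv_hom_id, dualMap_id]; monoidal
    _ = _ := by rw [evt_braid]; monoidal

/-- The isomorphism `ψ^- : X^* ≅ φ_γ(Y^*)`. -/
noncomputable def negIso {γ : G} {X Y : C} (ψ : X ≅ (act γ).obj Y) :
    dual X ≅ (act γ).obj (dual Y) :=
  dualIso ψ.symm ≪≫ (comparisonIso (act γ) Y).symm

theorem rotL_crossIso_inv (Y : C) {X Z : C} {γ : G} (hZ : component γ Z)
    (ψ : X ≅ (act γ).obj Y) :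
    rotL (crossIso Y hZ ψ).inv = (crossIso (dual Y) hZ (negIso ψ)).hom := by
  rw [rotL_crossIso_inv_aux, crossIso_hom]
  simp [negIso, dualBraid]

theorem rotR_crossIso_hom [PivotalCrossing G C] (Y : C) {X Z : C} {γ : G} (hZ : component γ Z)
    (ψ : X ≅ (act γ).obj Y) :
    rotR (crossIso Y hZ ψ).hom = (crossIso (dual Y) hZ (negIso ψ)).inv := by
  rw [← cancel_epi (crossIso (dual Y) hZ (negIso ψ)).hom, Iso.hom_inv_id,
    ← rotL_crossIso_inv, rotL_crossIso_inv_rotR]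

end BraidingLemmas
end GRibbon

namespace GRibbon

open PivotalCategory GGradedCategory GCrossing GBraiding

/-! ### Partial traces and their relation to rotations. -/

section Traces

variable {C : Type u} [Category.{v} C] [MonoidalCategory C] [PivotalCategory C]

/-- The partial trace closing a strand on the left. -/
def traceL {A B Z : C} (c : Z ⊗ A ⟶ Z ⊗ B) : A ⟶ B :=
  𝟙 A ⊗≫ coevt Z ▷ A ⊗≫ dual Z ◁ c ⊗≫ ev Z ▷ B ⊗≫ 𝟙 B

/-- The partial trace closing a strand on the right. -/
def traceR {A B Z : C} (c : A ⊗ Z ⟶ B ⊗ Z) : A ⟶ B :=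
  𝟙 A ⊗≫ A ◁ coev Z ⊗≫ c ▷ dual Z ⊗≫ B ◁ evt Z ⊗≫ 𝟙 B

/-- A cup placed under a rotated morphism closes one of its strands: the picture is a partial trace
on one leg of a cup of the remaining strand. -/
theorem coevt_rotL {P B Z : C} (c : Z ⊗ P ⟶ Z ⊗ B) :
    coevt Z ≫ rotL c = coev P ≫ traceL c ▷ dual P := by
  calc
    _ = 𝟙 _ ⊗≫ (coevt Z ▷ 𝟙_ C ≫ (dual Z ⊗ Z) ◁ coev P) ⊗≫ dual Z ◁ c ▷ dual P ⊗≫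
        ev Z ▷ (B ⊗ dual P) ⊗≫ 𝟙 _ := by dsimp only [rotL]; monoidal
    _ = _ := by rw [← whisker_exchange]; dsimp only [traceL]; monoidal

theorem coev_rotR {P B Z : C} (c : P ⊗ Z ⟶ B ⊗ Z) :
    coev Z ≫ rotR c = coevt P ≫ dual P ◁ traceR c := by
  calc
    _ = 𝟙 _ ⊗≫ (𝟙_ C ◁ coev Z ≫ coevt P ▷ (Z ⊗ dual Z)) ⊗≫ dual P ◁ c ▷ dual Z ⊗≫
        (dual P ⊗ B) ◁ evt Z ⊗≫ 𝟙 _ := by dsimp only [rotR]; monoidal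
    _ = _ := by rw [whisker_exchange]; dsimp only [traceR]; monoidal

theorem exists_eq_coevt {X P : C} (h : 𝟙_ C ⟶ dual X ⊗ P) :
    ∃ f : X ⟶ P, h = coevt X ≫ dual X ◁ f := by
  refine ⟨𝟙 X ⊗≫ X ◁ h ⊗≫ evt X ▷ P ⊗≫ 𝟙 P, ?_⟩
  symm
  calc
    _ = 𝟙 _ ⊗≫ (coevt X ▷ 𝟙_ C ≫ (dual X ⊗ X) ◁ h) ⊗≫ dual X ◁ evt X ▷ P ⊗≫ 𝟙 _ := by monoidal
    _ = h ⊗≫ (𝟙 (dual X) ⊗≫ coevt X ▷ dual X ⊗≫ dual X ◁ evt X ⊗≫ 𝟙 (dual X)) ▷ P := by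
      rw [← whisker_exchange]; monoidal
    _ = h := by rw [evt_coevt]; monoidal

/-- Dualizing rotates the picture by a half turn, so `c` is rotated twice by `rotL` and its closing
strand moves from the right to the left. -/
theorem dualMap_traceR {A Y Z : C} (c : A ⊗ Z ⟶ Y ⊗ Z) :
    dualMap (traceR c) = 𝟙 (dual Y) ⊗≫ coev Z ▷ dual Y ⊗≫ Z ◁ rotL (rotL c) ⊗≫
      evt Z ▷ dual A ⊗≫ 𝟙 (dual A) := by
  apply hom_ext_dual
  rw [dualMap_ev]
  symm
  calc
    _ = 𝟙 _ ⊗≫ coev Z ▷ (dual Y ⊗ A) ⊗≫ Z ◁ rotL (rotL c) ▷ A ⊗≫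
        (evt Z ▷ (dual A ⊗ A) ≫ 𝟙_ C ◁ ev A) ⊗≫ 𝟙 _ := by monoidal
    _ = 𝟙 _ ⊗≫ coev Z ▷ (dual Y ⊗ A) ⊗≫ Z ◁ (rotL (rotL c) ▷ A ⊗≫ dual Z ◁ ev A) ⊗≫
        evt Z ⊗≫ 𝟙 _ := by rw [← whisker_exchange]; monoidal
    _ = 𝟙 _ ⊗≫ (coev Z ▷ (dual Y ⊗ A) ≫ (Z ⊗ dual Z) ◁ rotL c) ⊗≫ Z ◁ ev Z ▷ dual Z ⊗≫
        evt Z ⊗≫ 𝟙 _ := by rw [rotL_ev]; monoidal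
    _ = 𝟙 _ ⊗≫ rotL c ⊗≫ (𝟙 Z ⊗≫ coev Z ▷ Z ⊗≫ Z ◁ ev Z ⊗≫ 𝟙 Z) ▷ dual Z ⊗≫ evt Z := by
      rw [← whisker_exchange]; monoidal
    _ = 𝟙 _ ⊗≫ (dual Y ⊗ A) ◁ coev Z ⊗≫ dual Y ◁ c ▷ dual Z ⊗≫
        (ev Y ▷ (Z ⊗ dual Z) ≫ 𝟙_ C ◁ evt Z) ⊗≫ 𝟙 _ := by
      rw [coev_ev]; dsimp only [rotL]; monoidal
    _ = _ := by rw [← whisker_exchange]; dsimp only [traceR]; monoidal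

end Traces

section ActMem

variable {G : Type w} [Group G] {C : Type u} [Category.{v} C] [MonoidalCategory C] [Preadditive C]
  [GGradedCategory G C] [GCrossing G C]

theorem act_mem_self {X : C} {α : G} (hX : component α X) : component α ((act α).obj X) := by
  simpa using act_mem α hX

end ActMem

/-! ### Curls, the twist and the cancellation of opposite curls. -/

section Curls

variable {G : Type w} [Group G] {C : Type u} [Category.{v} C] [MonoidalCategory C] [Preadditive C]
  [GGradedCategory G C] [GCrossing G C] [GBraiding G C]

/-- Naturality of the braiding in its second variable: a morphism on the lower strand slides through
the crossing. -/
theorem crossIso_natural (Y : C) {X Z Z' : C} {γ : G} (hZ : component γ Z) (hZ' : component γ Z')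
    (ψ : X ≅ (act γ).obj Y) (f : Z ⟶ Z') :
    Y ◁ f ≫ (crossIso Y hZ' ψ).hom = (crossIso Y hZ ψ).hom ≫ f ▷ X := by
  rw [crossIso_hom, crossIso_hom, braid_natural_right_assoc Y hZ hZ', ← whisker_exchange,
    Category.assoc]

theorem crossIso_natural_assoc (Y : C) {X Z Z' W : C} {γ : G} (hZ : component γ Z)
    (hZ' : component γ Z') (ψ : X ≅ (act γ).obj Y) (f : Z ⟶ Z') (h : Z' ⊗ X ⟶ W) :
    Y ◁ f ≫ (crossIso Y hZ' ψ).hom ≫ h = (crossIso Y hZ ψ).hom ≫ f ▷ X ≫ h := by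
  rw [← Category.assoc, crossIso_natural Y hZ hZ', Category.assoc]

theorem crossIso_inv_natural (Y : C) {X Z Z' : C} {γ : G} (hZ : component γ Z)
    (hZ' : component γ Z') (ψ : X ≅ (act γ).obj Y) (f : Z ⟶ Z') :
    f ▷ X ≫ (crossIso Y hZ' ψ).inv = (crossIso Y hZ ψ).inv ≫ Y ◁ f := by
  rw [Iso.comp_inv_eq, Category.assoc, crossIso_natural Y hZ hZ', Iso.inv_hom_id_assoc]

variable [PivotalCategory C]

theorem twist_eq_traceL {X X' : C} {α : G} (hX : component α X) (ψ : X' ≅ (act α).obj X) :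
    traceL (crossIso X hX ψ).hom = twist hX ≫ ψ.inv := by
  rw [crossIso_hom]
  symm
  calc
    _ = 𝟙 _ ⊗≫ coevt X ▷ X ⊗≫ dual X ◁ (braid X hX).hom ⊗≫
        (ev X ▷ (act α).obj X ≫ 𝟙_ C ◁ ψ.inv) ⊗≫ 𝟙 _ := by dsimp only [twist]; monoidal
    _ = _ := by rw [← whisker_exchange]; dsimp only [traceL]; monoidal

/-- Place a cup under the cancelling pair of rotated crossings. The cup turns the first crossing
into a left trace, which slides along the lower strand through the second crossing; the second
crossing then becomes a right trace on the same strand. -/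
theorem traceR_cross_traceL [PivotalCrossing G C] {X X' : C} {α : G} (hX : component α X)
    (hX' : component α X') (ψ : X' ≅ (act α).obj X) :
    traceR (crossIso X hX' ψ).hom ≫ traceL (crossIso X hX ψ).inv = 𝟙 X := by
  apply hom_ext_coevt
  symm
  calc
    _ = coevt X ≫ rotL (crossIso X hX ψ).inv ≫ rotR (crossIso X hX ψ).hom := by
      rw [rotL_crossIso_inv_rotR X hX]; simp
    _ = coev X' ≫ rotR (crossIso X hX' ψ).hom ≫ dual X ◁ traceL (crossIso X hX ψ).inv := by
      rw [← Category.assoc, coevt_rotL, rotR_crossIso_hom X hX, rotR_crossIso_hom X hX',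
        Category.assoc, crossIso_inv_natural]
    _ = _ := by
      rw [← Category.assoc, coev_rotR]; simp

theorem traceL_cross_inv {X X' : C} {α : G} (hX : component α X) (ψ : X' ≅ (act α).obj X) :
    traceL (crossIso X hX ψ).inv = ψ.hom ≫ traceL (crossIso X hX (Iso.refl _)).inv := by
  rw [crossIso_inv, crossIso_inv]
  symm
  calc
    _ = 𝟙 _ ⊗≫ (𝟙_ C ◁ ψ.hom ≫ coevt X ▷ (act α).obj X) ⊗≫ dual X ◁ (braid X hX).inv ⊗≫
        ev X ▷ X ⊗≫ 𝟙 _ := by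
      simp only [traceL, Iso.refl_hom]; monoidal
    _ = _ := by rw [whisker_exchange]; dsimp only [traceL]; monoidal

variable [PivotalGGradedCategory G C]

open PivotalGGradedCategory

/-- The same sliding argument, except that the trace first goes around the cup as its dual, since
now the lower strand of the second crossing is the dual one. -/
theorem traceL_cross_traceR {X X' : C} {α : G} (hX : component α X) (hX' : component α X')
    (ψ : X' ≅ (act α).obj X) :
    traceL (crossIso X hX ψ).hom ≫ traceR (crossIso X hX' ψ).inv = 𝟙 X := by
  apply hom_ext_coevt
  symm
  calc
    _ = coevt X ≫ rotL (crossIso X hX ψ).hom ≫ rotR (crossIso X hX ψ).inv := by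
      rw [rotL_crossIso_hom_rotR X hX (dual_mem hX)]; simp
    _ = coev X' ≫ rotR (crossIso X hX' ψ).inv ≫
        dualMap (traceL (crossIso X hX ψ).hom) ▷ X := by
      rw [← Category.assoc, coevt_rotL, ← coev_dualMap, rotR_crossIso_inv X hX (dual_mem hX),
        rotR_crossIso_inv X hX' (dual_mem hX'), Category.assoc, crossIso_natural]
    _ = coevt X' ≫ dualMap (traceL (crossIso X hX ψ).hom) ▷ X' ≫
        dual X ◁ traceR (crossIso X hX' ψ).inv := by
      rw [← Category.assoc, coev_rotR, Category.assoc, whisker_exchange]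
    _ = _ := by
      rw [← Category.assoc, coevt_dualMap]; simp

/-- The trace is a split monomorphism by `traceL_cross_traceR`. Letting it slide along the upper
strand instead, which applies `φ_{α⁻¹}` to it, shows that its image under this equivalence is a
split epimorphism; equivalences reflect isomorphisms. -/
theorem isIso_traceL_cross {X X' : C} {α : G} (hX : component α X) (hX' : component α X')
    (ψ : X' ≅ (act α).obj X) : IsIso (traceL (crossIso X hX ψ).hom) := by
  have e : (act α⁻¹).IsEquivalence := act_isEquivalence (C := C) α⁻¹
  set f := traceL (crossIso X hX ψ).hom
  -- Unbending the braided cup yields `r : X ⟶ φ_{α⁻¹}(X)`, from which the section of the image of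
  -- the trace is made.
  obtain ⟨r, hr⟩ := exists_eq_coevt (coev X ≫ (braid X (dual_mem hX)).hom)
  have h : r ≫ (act α⁻¹).map f ≫ (barIso ψ).inv = 𝟙 X := by
    apply hom_ext_coevt
    symm
    calc
      _ = coevt X ≫ rotL (crossIso X hX ψ).hom ≫ rotR (crossIso X hX ψ).inv := by
        rw [rotL_crossIso_hom_rotR X hX (dual_mem hX)]; simp
      _ = (coev X ≫ (braid X (dual_mem hX)).hom) ≫
          dual X ◁ ((act α⁻¹).map f ≫ (barIso ψ).inv) := by
        rw [← Category.assoc, coevt_rotL, rotR_crossIso_inv X hX (dual_mem hX), crossIso_hom X',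
          Category.assoc, braid_natural_left_assoc]
        simp [f]
      _ = _ := by rw [hr]; simp
  have hm : IsSplitMono f := ⟨⟨⟨_, traceL_cross_traceR hX hX' ψ⟩⟩⟩
  have he : IsSplitEpi ((act α⁻¹).map f) := by
    refine ⟨⟨⟨(barIso ψ).inv ≫ r, ?_⟩⟩⟩
    rw [← cancel_mono (barIso ψ).inv, Category.assoc, Category.assoc, h]
    simp
  have : IsIso ((act α⁻¹).map f) := isIso_of_mono_of_isSplitEpi _
  exact isIso_of_reflects_iso f (act α⁻¹)

/-- By the rotation formulas, the twice rotated crossing is a positive crossing with lower strand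
`X'^*`, so its left closure is a twist. The closing strand carries `X'` rather than `X'^{**}`; the
isomorphism from `PivotalDual.double` corrects this. -/
theorem dual_traceR_cross {X X' : C} {α : G} (hX' : component α X') (ψ : X' ≅ (act α).obj X) :
    dualMap (traceR (crossIso X hX' ψ).hom) =
      twist (PivotalGGradedCategory.dual_mem hX') ≫ (negIso (barIso ψ)).inv := by
  have hW := PivotalGGradedCategory.dual_mem (G := G) hX'
  obtain ⟨j, hcapL, -, -, hcupR⟩ := PivotalDual.double X'
  rw [dualMap_traceR, rotL_crossIso_hom X hX' hW, rotL_crossIso_inv, ← twist_eq_traceL, traceL]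
  generalize (crossIso (dual X') hW (negIso (barIso ψ))).hom = c
  symm
  calc
    _ = 𝟙 _ ⊗≫ coev X' ▷ dual X' ⊗≫ (j.hom ▷ (dual X' ⊗ dual X') ≫ dual (dual X') ◁ c) ⊗≫
        ev (dual X') ▷ dual X ⊗≫ 𝟙 _ := by
      rw [hcupR]
      calc
        _ = 𝟙 _ ⊗≫ coevt (dual X') ▷ dual X' ⊗≫ ((𝟙 (dual (dual X'))) ▷ (dual X' ⊗ dual X') ≫
            dual (dual X') ◁ c) ⊗≫ ev (dual X') ▷ dual X ⊗≫ 𝟙 _ := by monoidal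
        _ = _ := by rw [← j.inv_hom_id]; monoidal
    _ = 𝟙 _ ⊗≫ coev X' ▷ dual X' ⊗≫ X' ◁ c ⊗≫
        (j.hom ▷ dual X' ≫ ev (dual X')) ▷ dual X ⊗≫ 𝟙 _ := by
      rw [← whisker_exchange]; monoidal
    _ = _ := by rw [← hcapL]

variable [GRibbonCategory G C]

/-- Dualization is injective, and after dualization this is exactly the self-duality of the twist
compared with `dual_traceR_cross`. This is where the ribbon axiom enters. -/
theorem twist_eq_traceR {X : C} {α : G} (hX : component α X) :
    twist hX = traceR (crossIso X (act_mem_self hX) (Iso.refl _)).hom := by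
  apply dualMap_injective
  rw [dual_traceR_cross, GRibbonCategory.twist_selfDual hX (dual_mem (act_mem_self hX))]
  simp [negIso, barIso, dualMap_comp]

theorem traceL_traceL_inv {X X' : C} {α : G} (hX : component α X) (ψ : X' ≅ (act α).obj X) :
    traceL (crossIso X hX ψ).hom ≫ traceL (crossIso X hX ψ).inv = 𝟙 X := by
  rw [twist_eq_traceL, traceL_cross_inv, Category.assoc, Iso.inv_hom_id_assoc, twist_eq_traceR,
    traceR_cross_traceL hX]

/-- For `ψ` the identity, a one-sided inverse of the isomorphism of `isIso_traceL_cross` is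
two-sided. A general `ψ` factors out of both traces. -/
theorem traceL_inv_traceL {X X' : C} {α : G} (hX : component α X) (ψ : X' ≅ (act α).obj X) :
    traceL (crossIso X hX ψ).inv ≫ traceL (crossIso X hX ψ).hom = 𝟙 X' := by
  have := isIso_traceL_cross hX (act_mem_self hX) (Iso.refl _)
  have h : traceL (crossIso X hX (Iso.refl _)).inv ≫ traceL (crossIso X hX (Iso.refl _)).hom =
      𝟙 _ := by
    rw [← cancel_epi (traceL (crossIso X hX (Iso.refl _)).hom), ← Category.assoc,
      traceL_traceL_inv]
    simp
  rw [twist_eq_traceL hX (Iso.refl _)] at h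
  rw [traceL_cross_inv, twist_eq_traceL, Category.assoc]
  calc
    _ = ψ.hom ≫ (traceL (crossIso X hX (Iso.refl _)).inv ≫ twist hX ≫ (Iso.refl _).inv) ≫
        ψ.inv := by simp
    _ = _ := by rw [h]; simp

/-- Both are inverse to the left trace of the inverse crossing. -/
theorem traceR_eq_traceL {X X' : C} {α : G} (hX : component α X) (hX' : component α X')
    (ψ : X' ≅ (act α).obj X) :
    traceR (crossIso X hX' ψ).hom = traceL (crossIso X hX ψ).hom := by
  calc
    _ = traceR (crossIso X hX' ψ).hom ≫
        traceL (crossIso X hX ψ).inv ≫ traceL (crossIso X hX ψ).hom := by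
      rw [traceL_inv_traceL]; simp
    _ = _ := by rw [← Category.assoc, traceR_cross_traceL]; simp

theorem traceR_inv_eq_traceL_inv {X X' : C} {α : G} (hX : component α X) (hX' : component α X')
    (ψ : X' ≅ (act α).obj X) :
    traceR (crossIso X hX' ψ).inv = traceL (crossIso X hX ψ).inv := by
  calc
    _ = traceL (crossIso X hX ψ).inv ≫ traceL (crossIso X hX ψ).hom ≫
        traceR (crossIso X hX' ψ).inv := by
      rw [← Category.assoc, traceL_inv_traceL]; simp
    _ = _ := by rw [traceL_cross_traceR]; simp

end Curls

/-! ### Crossings with tensor products and the Yang-Baxter relation. -/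

section Sliding

variable {G : Type w} [Group G] {C : Type u} [Category.{v} C] [MonoidalCategory C] [Preadditive C]
  [GGradedCategory G C] [GCrossing G C] [GBraiding G C]

/-- The relation between crossings behind a tensor product. -/
theorem cross_cross {X X' X'' Y Z : C} {β γ δ : G} (hY : component β Y) (hZ : component γ Z)
    (h : β * γ = δ) (hYZ : component δ (Y ⊗ Z)) (ψ : X' ≅ (act β).obj X)
    (ψ' : X'' ≅ (act γ).obj X') :
    𝟙 (X ⊗ (Y ⊗ Z)) ⊗≫ (crossIso X hY ψ).hom ▷ Z ⊗≫ Y ◁ (crossIso X' hZ ψ').hom ⊗≫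
        𝟙 ((Y ⊗ Z) ⊗ X'') =
      (crossIso X hYZ (ψ' ≪≫ (act γ).mapIso ψ ≪≫ actMulIso γ β δ h X)).hom := by
  rw [crossIso_hom, crossIso_hom, crossIso_hom, braid_tensor_right' X hY hZ h]
  calc
    _ = 𝟙 _ ⊗≫ (braid X hY).hom ▷ Z ⊗≫ Y ◁ (ψ.inv ▷ Z ≫ (braid X' hZ).hom) ⊗≫
        (Y ⊗ Z) ◁ ψ'.inv := by monoidal
    _ = 𝟙 _ ⊗≫ (braid X hY).hom ▷ Z ⊗≫ Y ◁ (braid ((act β).obj X) hZ).hom ⊗≫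
        (Y ⊗ Z) ◁ ((actMulIso γ β δ h X).hom ≫ (actMulIso γ β δ h X).inv) ⊗≫
        (Y ⊗ Z) ◁ (act γ).map ψ.inv ⊗≫ (Y ⊗ Z) ◁ ψ'.inv := by
      rw [braid_natural_left, Iso.hom_inv_id]; monoidal
    _ = _ := by
      simp only [Iso.trans_inv, Functor.mapIso_inv]; monoidal

/-- On each side `cross_cross` merges the two crossings of the upper strand into one crossing in
front of a tensor product. The hypothesis `w` says that the merged colors agree, and naturality
slides the third crossing behind the strand. -/
theorem yang_baxter {X X' X'' Y Y' Z Xt : C} {β γ β' : G} (hY : component β Y)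
    (hZ : component γ Z) (hY' : component β' Y') (a : X' ≅ (act β).obj X)
    (b : X'' ≅ (act γ).obj X') (c : Y' ≅ (act γ).obj Y) (a' : Xt ≅ (act γ).obj X)
    (b' : X'' ≅ (act β').obj Xt) (h : γ * β' = β * γ)
    (w : b'.hom ≫ (act β').map a'.hom ≫ (actMulIso β' γ (β * γ) h X).hom =
      b.hom ≫ (act γ).map a.hom ≫ (actMulIso γ β (β * γ) rfl X).hom) :
    𝟙 (X ⊗ (Y ⊗ Z)) ⊗≫ (crossIso X hY a).hom ▷ Z ⊗≫ Y ◁ (crossIso X' hZ b).hom ⊗≫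
        (crossIso Y hZ c).hom ▷ X'' ⊗≫ 𝟙 (Z ⊗ (Y' ⊗ X'')) =
      X ◁ (crossIso Y hZ c).hom ⊗≫ (crossIso X hZ a').hom ▷ Y' ⊗≫
        Z ◁ (crossIso Xt hY' b').hom ⊗≫ 𝟙 (Z ⊗ (Y' ⊗ X'')) := by
  have h1 := cross_cross hY hZ rfl (tensor_mem hY hZ) a b
  have h2 := cross_cross hZ hY' h (h ▸ tensor_mem hZ hY') a' b'
  have h3 : b' ≪≫ (act β').mapIso a' ≪≫ actMulIso β' γ (β * γ) h X =
      b ≪≫ (act γ).mapIso a ≪≫ actMulIso γ β (β * γ) rfl X := by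
    ext; simpa using w
  calc
    _ = (𝟙 (X ⊗ (Y ⊗ Z)) ⊗≫ (crossIso X hY a).hom ▷ Z ⊗≫ Y ◁ (crossIso X' hZ b).hom ⊗≫
        𝟙 ((Y ⊗ Z) ⊗ X'')) ≫ (crossIso Y hZ c).hom ▷ X'' ≫
        (α_ Z Y' X'').hom := by monoidal
    _ = X ◁ (crossIso Y hZ c).hom ≫ (𝟙 (X ⊗ (Z ⊗ Y')) ⊗≫ (crossIso X hZ a').hom ▷ Y' ⊗≫
        Z ◁ (crossIso Xt hY' b').hom ⊗≫ 𝟙 ((Z ⊗ Y') ⊗ X'')) ≫ (α_ Z Y' X'').hom := by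
      rw [h1, h2, h3, crossIso_natural_assoc]
    _ = _ := by monoidal

/-- The relation between crossings in front of a tensor product. -/
theorem cross_cross_under {X X' Y Y' Z : C} {γ : G} (hZ : component γ Z)
    (ψ : X ≅ (act γ).obj Y) (ψ' : X' ≅ (act γ).obj Y') :
    (crossIso (Y ⊗ Y') hZ ((ψ ⊗ᵢ ψ') ≪≫ Functor.Monoidal.μIso (act γ) Y Y')).hom =
      𝟙 ((Y ⊗ Y') ⊗ Z) ⊗≫ Y ◁ (crossIso Y' hZ ψ').hom ⊗≫ (crossIso Y hZ ψ).hom ▷ X' ⊗≫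
        𝟙 (Z ⊗ (X ⊗ X')) := by
  rw [crossIso_hom, crossIso_hom, crossIso_hom, braid_tensor_left]
  symm
  calc
    _ = 𝟙 _ ⊗≫ Y ◁ (braid Y' hZ).hom ⊗≫ ((Y ⊗ Z) ◁ ψ'.inv ≫ (braid Y hZ).hom ▷ X') ⊗≫
        Z ◁ (ψ.inv ▷ X') := by monoidal
    _ = 𝟙 _ ⊗≫ Y ◁ (braid Y' hZ).hom ⊗≫ (braid Y hZ).hom ▷ (act γ).obj Y' ⊗≫
        Z ◁ (((act γ).obj Y ⊗ (act γ).obj Y') ◁ 𝟙 (𝟙_ C)) ⊗≫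
        Z ◁ ((act γ).obj Y ◁ ψ'.inv ≫ ψ.inv ▷ X') := by
      rw [whisker_exchange]; monoidal
    _ = 𝟙 _ ⊗≫ Y ◁ (braid Y' hZ).hom ⊗≫ (braid Y hZ).hom ▷ (act γ).obj Y' ⊗≫
        Z ◁ (Functor.LaxMonoidal.μ (act γ) Y Y' ≫ Functor.OplaxMonoidal.δ (act γ) Y Y') ⊗≫
        Z ◁ (ψ.inv ⊗ₘ ψ'.inv) := by
      rw [Functor.Monoidal.μ_δ, tensorHom_def']; monoidal
    _ = _ := by
      simp only [Iso.trans_inv, Functor.Monoidal.μIso_inv, tensorIso_inv]; monoidal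

theorem cross_cross_under_inv {X X' Y Y' Z : C} {γ : G} (hZ : component γ Z)
    (ψ : X ≅ (act γ).obj Y) (ψ' : X' ≅ (act γ).obj Y') :
    (crossIso (Y ⊗ Y') hZ ((ψ ⊗ᵢ ψ') ≪≫ Functor.Monoidal.μIso (act γ) Y Y')).inv =
      𝟙 (Z ⊗ (X ⊗ X')) ⊗≫ (crossIso Y hZ ψ).inv ▷ X' ⊗≫ Y ◁ (crossIso Y' hZ ψ').inv ⊗≫
        𝟙 ((Y ⊗ Y') ⊗ Z) := by
  apply Iso.inv_ext
  rw [cross_cross_under]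
  calc
    _ = 𝟙 _ ⊗≫ Y ◁ (crossIso Y' hZ ψ').hom ⊗≫
        ((crossIso Y hZ ψ).hom ≫ (crossIso Y hZ ψ).inv) ▷ X' ⊗≫ Y ◁ (crossIso Y' hZ ψ').inv ⊗≫
        𝟙 _ := by monoidal
    _ = 𝟙 _ ⊗≫ Y ◁ ((crossIso Y' hZ ψ').hom ≫ (crossIso Y' hZ ψ').inv) ⊗≫ 𝟙 _ := by
      rw [Iso.hom_inv_id]; monoidal
    _ = _ := by rw [Iso.hom_inv_id]; monoidal

/-- A morphism slides below a crossing strand. -/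
theorem crossIso_slide {X X' Y Y' Z : C} {γ : G} (hZ : component γ Z)
    (ψ : X ≅ (act γ).obj Y) (ψ' : X' ≅ (act γ).obj Y') (f : X ⟶ X') (g : Y ⟶ Y')
    (w : f ≫ ψ'.hom = ψ.hom ≫ (act γ).map g) :
    Z ◁ f ≫ (crossIso Y' hZ ψ').inv = (crossIso Y hZ ψ).inv ≫ g ▷ Z := by
  rw [crossIso_inv, crossIso_inv, ← Category.assoc, ← whiskerLeft_comp, w, Category.assoc]
  rw [Iso.comp_inv_eq, Category.assoc, Category.assoc, braid_natural_left]
  simp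

end Sliding
end GRibbon

namespace GRibbon

open PivotalCategory GGradedCategory GCrossing GBraiding

/-! ### Coherence for tensor products over lists. -/

section TensorList

variable {C : Type u} [Category.{v} C] [MonoidalCategory C] {ι : Type*} (f : ι → C)

theorem tensorListCons_eqToHom (a : ι) {l l' : List ι} (h : l = l') :
    f a ◁ eqToHom (congrArg (tensorList f) h) ≫ (tensorListCons f a l').inv =
      (tensorListCons f a l).inv ≫ eqToHom (by rw [h]) := by
  subst h; simp

theorem tensorListAppend_cons (a : ι) (l l' : List ι) :
    (tensorListAppend f (a :: l) l').hom = (tensorListCons f a l).hom ▷ tensorList f l' ≫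
      (α_ _ _ _).hom ≫ f a ◁ (tensorListAppend f l l').hom ≫
      (tensorListCons f a (l ++ l')).inv := rfl

/-- The empty tensor product. -/
def tensorListNil : tensorList f [] ≅ 𝟙_ C := Iso.refl _

theorem nil_tensorListAppend (l : List ι) : (tensorListAppend f [] l).hom =
    (tensorListNil f).hom ▷ tensorList f l ≫ (λ_ (tensorList f l)).hom := by
  have h : (tensorListNil f).hom ▷ tensorList f l = 𝟙 _ := id_whiskerRight _ _
  rw [h]
  exact (Category.id_comp (λ_ (tensorList f l)).hom).symm

theorem tensorListCons_nil (a : ι) : (tensorListCons f a []).hom =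
    (ρ_ (f a)).inv ≫ f a ◁ (tensorListNil f).inv := by
  have h : f a ◁ (tensorListNil f).inv = 𝟙 _ := whiskerLeft_id _ _
  rw [h]
  exact (Category.comp_id (ρ_ (f a)).inv).symm

theorem tensorListAppend_nil (l : List ι) :
    (tensorListAppend f l []).hom = tensorList f l ◁ (tensorListNil f).hom ≫
      (ρ_ (tensorList f l)).hom ≫ eqToHom (by rw [List.append_nil]) := by
  induction l with
  | nil =>
    rw [nil_tensorListAppend]
    have h : eqToHom (by rw [List.append_nil] : tensorList f [] = tensorList f ([] ++ [])) =
      𝟙 (tensorList f []) := rfl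
    rw [h, Category.comp_id, ← cancel_mono (tensorListNil f).hom]
    calc
      _ = ((tensorListNil f).hom ⊗ₘ (tensorListNil f).hom) ≫ (λ_ _).hom := by
        rw [MonoidalCategory.tensorHom_def]; simp
      _ = _ := by rw [tensorHom_def', unitors_equal]; simp
  | cons a l ih =>
    have h := tensorListCons_eqToHom f a (List.append_nil l).symm
    rw [tensorListAppend_cons, ih]
    calc
      _ = (tensorListCons f a l).hom ▷ tensorList f [] ⊗≫
          f a ◁ tensorList f l ◁ (tensorListNil f).hom ⊗≫
          f a ◁ eqToHom (by rw [List.append_nil]) ≫ (tensorListCons f a (l ++ [])).inv := by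
        monoidal
      _ = ((tensorListCons f a l).hom ▷ tensorList f [] ≫
          (f a ⊗ tensorList f l) ◁ (tensorListNil f).hom) ⊗≫
          (tensorListCons f a l).inv ⊗≫ eqToHom (by rw [List.append_nil]) := by
        rw [h]; monoidal
      _ = tensorList f (a :: l) ◁ (tensorListNil f).hom ⊗≫
          ((tensorListCons f a l).hom ≫ (tensorListCons f a l).inv) ⊗≫
          eqToHom (by rw [List.append_nil]) := by
        rw [← whisker_exchange]; monoidal
      _ = _ := by rw [Iso.hom_inv_id]; monoidal

/-- Peeling off the first factor of `l` reduces the claim to the pentagon and the induction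
hypothesis. Associativity of lists is not definitional, so the resulting transport must be carried
past the first factor by `tensorListCons_eqToHom`. -/
theorem tensorListAppend_assoc (l m n : List ι) :
    (tensorListAppend f l m).hom ▷ tensorList f n ≫ (tensorListAppend f (l ++ m) n).hom =
      (α_ _ _ _).hom ≫ tensorList f l ◁ (tensorListAppend f m n).hom ≫
        (tensorListAppend f l (m ++ n)).hom ≫ eqToHom (by rw [List.append_assoc]) := by
  induction l with
  | nil =>
    have h : (tensorListNil f).hom ▷ tensorList f m ▷ tensorList f n ≫
        (λ_ (tensorList f m)).hom ▷ tensorList f n ≫ (tensorListAppend f m n).hom =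
        (α_ _ _ _).hom ≫ tensorList f [] ◁ (tensorListAppend f m n).hom ≫
        (tensorListNil f).hom ▷ tensorList f (m ++ n) ≫ (λ_ (tensorList f (m ++ n))).hom := by
      rw [whisker_exchange_assoc]; simp
    rw [nil_tensorListAppend, nil_tensorListAppend, comp_whiskerRight, Category.assoc]
    refine Eq.trans h ?_
    congr 2
    exact (Category.comp_id _).symm
  | cons a l ih =>
    have h2 : (tensorListAppend f ((a :: l) ++ m) n).hom =
      (tensorListCons f a (l ++ m)).hom ▷ tensorList f n ≫
      (α_ _ _ _).hom ≫ f a ◁ (tensorListAppend f (l ++ m) n).hom ≫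
      (tensorListCons f a (l ++ m ++ n)).inv := rfl
    have h3 : (tensorListAppend f (a :: l) (m ++ n)).hom = (tensorListCons f a l).hom ▷ _ ≫
      (α_ _ _ _).hom ≫ f a ◁ (tensorListAppend f l (m ++ n)).hom ≫
      (tensorListCons f a (l ++ (m ++ n))).inv := rfl
    rw [h2, h3, tensorListAppend_cons]
    have h4 := tensorListCons_eqToHom f a (List.append_assoc l m n).symm
    calc
      _ = (tensorListCons f a l).hom ▷ tensorList f m ▷ tensorList f n ⊗≫
          f a ◁ (tensorListAppend f l m).hom ▷ tensorList f n ⊗≫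
          ((tensorListCons f a (l ++ m)).inv ≫ (tensorListCons f a (l ++ m)).hom) ▷
            tensorList f n ⊗≫ f a ◁ (tensorListAppend f (l ++ m) n).hom ≫
          (tensorListCons f a (l ++ m ++ n)).inv := by monoidal
      _ = (tensorListCons f a l).hom ▷ tensorList f m ▷ tensorList f n ⊗≫
          f a ◁ ((tensorListAppend f l m).hom ▷ tensorList f n ≫
            (tensorListAppend f (l ++ m) n).hom) ≫
          (tensorListCons f a (l ++ m ++ n)).inv := by
        rw [Iso.inv_hom_id]; monoidal
      _ = 𝟙 _ ⊗≫ ((tensorListCons f a l).hom ▷ (tensorList f m ⊗ tensorList f n) ≫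
          (f a ⊗ tensorList f l) ◁ (tensorListAppend f m n).hom) ⊗≫
          f a ◁ (tensorListAppend f l (m ++ n)).hom ⊗≫
          f a ◁ eqToHom (by rw [List.append_assoc]) ≫
          (tensorListCons f a (l ++ m ++ n)).inv := by
        rw [ih]; monoidal
      _ = 𝟙 _ ⊗≫ tensorList f (a :: l) ◁ (tensorListAppend f m n).hom ⊗≫
          (tensorListCons f a l).hom ▷ tensorList f (m ++ n) ⊗≫
          f a ◁ (tensorListAppend f l (m ++ n)).hom ⊗≫
          (tensorListCons f a (l ++ (m ++ n))).inv ⊗≫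
          eqToHom (by rw [List.append_assoc]) := by
        rw [h4, ← whisker_exchange]; monoidal
      _ = _ := by monoidal

end TensorList

/-! ### Evaluation of diagrams. -/

section Eval

variable {G : Type w} [Group G] {C : Type u} [Category.{v} C] [MonoidalCategory C] [Preadditive C]
  [GGradedCategory G C] [GCrossing G C] [PivotalCategory C] [GBraiding G C]

/-- The morphism of `C` obtained by evaluating a colored diagram. -/
def Diagram.eval : ∀ {A B : List (SignedColor G C)}, Diagram A B → (listValue A ⟶ listValue B)
  | _, _, .id A => 𝟙 (listValue A)
  | _, _, .comp D E => eval D ≫ eval E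
  | _, _, .tensor (A := A) (B := B) (A' := A') (B' := B') D E =>
      (tensorListAppend SignedColor.value A A').inv ≫ (eval D ⊗ₘ eval E) ≫
        (tensorListAppend SignedColor.value B B').hom
  | _, _, .capRight X => ev X.obj
  | _, _, .cupRight X => coev X.obj
  | _, _, .capLeft X => evt X.obj
  | _, _, .cupLeft X => coevt X.obj
  | _, _, .crossPos X Y _ ψ => (crossIso X.obj Y.mem ψ).hom
  | _, _, .crossNeg X _ Y' ψ => (crossIso Y'.obj X.mem ψ).inv
  | _, _, .coupon _ _ _ f => f

end Eval
end GRibbon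

namespace GRibbon

open PivotalCategory GGradedCategory GCrossing GBraiding

/-! ### Cutting and regrouping the value of a list of signed colors. -/

section ListValue

variable {G : Type w} [Group G] {C : Type u} [Category.{v} C] [MonoidalCategory C] [Preadditive C]
  [GGradedCategory G C] [PivotalCategory C]

/-- The canonical isomorphism between the value of a concatenation and the product of the values. -/
def appendIso (A B : List (SignedColor G C)) : listValue A ⊗ listValue B ≅ listValue (A ++ B) :=
  tensorListAppend SignedColor.value A B

variable (G C) in
/-- The value of the empty list. -/
def nilIso : listValue ([] : List (SignedColor G C)) ≅ 𝟙_ C := tensorListNil SignedColor.value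

/-- Splitting off the first factor. -/
def consIso (a : SignedColor G C) (A : List (SignedColor G C)) :
    listValue (a :: A) ≅ a.value ⊗ listValue A := tensorListCons SignedColor.value a A

/-- The value of a list with one entry. -/
def singleIso (a : SignedColor G C) : listValue [a] ≅ a.value := Iso.refl _

theorem consIso_nil (a : SignedColor G C) : (consIso a []).hom =
    (singleIso a).hom ≫ (ρ_ a.value).inv ≫ a.value ◁ (nilIso G C).inv :=
  (tensorListCons_nil SignedColor.value a).trans (Category.id_comp _).symm

theorem consIso_nil_inv (a : SignedColor G C) : (consIso a []).inv =
    a.value ◁ (nilIso G C).hom ≫ (ρ_ a.value).hom ≫ (singleIso a).inv := by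
  rw [← cancel_epi (consIso a []).hom, Iso.hom_inv_id, consIso_nil]; simp

theorem appendIso_cons (a : SignedColor G C) (A B : List (SignedColor G C)) :
    (appendIso (a :: A) B).hom = (consIso a A).hom ▷ listValue B ≫
      (α_ _ _ _).hom ≫ a.value ◁ (appendIso A B).hom ≫ (consIso a (A ++ B)).inv := rfl

theorem appendIso_nil_left (A : List (SignedColor G C)) :
    (appendIso [] A).hom = (nilIso G C).hom ▷ listValue A ≫ (λ_ (listValue A)).hom :=
  nil_tensorListAppend SignedColor.value A

theorem appendIso_nil_left_inv (A : List (SignedColor G C)) :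
    (appendIso [] A).inv = (λ_ (listValue A)).inv ≫ (nilIso G C).inv ▷ listValue A := by
  apply Iso.inv_ext
  rw [appendIso_nil_left]
  simp

theorem appendIso_single (a : SignedColor G C) (A : List (SignedColor G C)) :
    (appendIso [a] A).hom = (singleIso a).hom ▷ listValue A ≫ (consIso a A).inv := by
  have h : (appendIso [a] A).hom = (consIso a []).hom ▷ listValue A ≫
    (α_ _ _ _).hom ≫ a.value ◁ (appendIso [] A).hom ≫ (consIso a A).inv := rfl
  rw [h, appendIso_nil_left, consIso_nil]
  simp only [comp_whiskerRight, whiskerLeft_comp, Category.assoc]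
  congr 1
  calc
    _ = (ρ_ a.value).inv ▷ listValue A ≫ (α_ _ _ _).hom ≫
        a.value ◁ ((nilIso G C).inv ≫ (nilIso G C).hom) ▷ listValue A ≫ a.value ◁ (λ_ _).hom ≫
        (consIso a A).inv := by simp
    _ = _ := by rw [Iso.inv_hom_id]; monoidal

theorem appendIso_nil_right (A : List (SignedColor G C)) :
    (appendIso A []).hom = listValue A ◁ (nilIso G C).hom ≫ (ρ_ (listValue A)).hom ≫
      eqToHom (by rw [List.append_nil]) :=
  tensorListAppend_nil SignedColor.value A

theorem appendIso_nil_right_inv (A : List (SignedColor G C)) :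
    (appendIso A []).inv = eqToHom (by rw [List.append_nil]) ≫ (ρ_ (listValue A)).inv ≫
      listValue A ◁ (nilIso G C).inv := by
  apply Iso.inv_ext
  rw [appendIso_nil_right]
  simp

theorem appendIso_assoc (A B K : List (SignedColor G C)) :
    (appendIso A B).hom ▷ listValue K ≫ (appendIso (A ++ B) K).hom =
      (α_ _ _ _).hom ≫ listValue A ◁ (appendIso B K).hom ≫
        (appendIso A (B ++ K)).hom ≫ eqToHom (by rw [List.append_assoc]) :=
  tensorListAppend_assoc SignedColor.value A B K

/-- The associativity relation in the form needed when juxtapositions cut at different places are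
stacked: joining and then splitting elsewhere is a mere regrouping. -/
theorem appendIso_assoc' (A B K : List (SignedColor G C)) :
    (appendIso A (B ++ K)).hom ≫ eqToHom (by rw [List.append_assoc]) ≫
      (appendIso (A ++ B) K).inv = listValue A ◁ (appendIso B K).inv ≫ (α_ _ _ _).inv ≫
      (appendIso A B).hom ▷ listValue K := by
  rw [← cancel_mono (appendIso (A ++ B) K).hom]
  simp [appendIso_assoc, -eqToHom_trans_assoc]

theorem appendIso_assoc'' (A B K : List (SignedColor G C)) :
    (appendIso (A ++ B) K).hom ≫ eqToHom (by rw [List.append_assoc]) ≫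
      (appendIso A (B ++ K)).inv = (appendIso A B).inv ▷ listValue K ≫ (α_ _ _ _).hom ≫
      listValue A ◁ (appendIso B K).hom := by
  have h := appendIso_assoc A B K
  rw [← cancel_epi ((appendIso A B).hom ▷ listValue K), reassoc_of% h]
  simp

/-- The value of a list cut into three pieces. -/
def insertIso (L A R : List (SignedColor G C)) :
    listValue L ⊗ (listValue A ⊗ listValue R) ≅ listValue (L ++ (A ++ R)) :=
  whiskerLeftIso (listValue L) (appendIso A R) ≪≫ appendIso L (A ++ R)

theorem insertIso_nil (L R : List (SignedColor G C)) : (insertIso L [] R).hom =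
    listValue L ◁ ((nilIso G C).hom ▷ listValue R ≫ (λ_ (listValue R)).hom) ≫
      (appendIso L R).hom := by
  rw [← appendIso_nil_left]; rfl

theorem insertIso_nil_inv (L R : List (SignedColor G C)) : (insertIso L [] R).inv =
    (appendIso L R).inv ≫
    listValue L ◁ ((λ_ (listValue R)).inv ≫ (nilIso G C).inv ▷ listValue R) := by
  apply Iso.inv_ext
  rw [insertIso_nil]
  simp

/-- Two applications of the change of cutting point. It isolates the middle block `A ++ A'`, where
the inner caps are applied, from the outer strands `L` and `R`. -/
theorem appendIso_insertIso (L A A' R : List (SignedColor G C)) :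
    (appendIso (L ++ A) (A' ++ R)).hom ≫ eqToHom (by simp) ≫ (insertIso L (A ++ A') R).inv =
      ((appendIso L A).inv ⊗ₘ (appendIso A' R).inv) ⊗≫
        listValue L ◁ (appendIso A A').hom ▷ listValue R ⊗≫
        𝟙 (listValue L ⊗ (listValue (A ++ A') ⊗ listValue R)) := by
  have h1 := appendIso_assoc'' L A (A' ++ R)
  have h2 := appendIso_assoc' A A' R
  have h3 : ∀ {P Q : List (SignedColor G C)} (h : P = Q), eqToHom (by rw [h]) ≫
      (appendIso L Q).inv = (appendIso L P).inv ≫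
        listValue L ◁ eqToHom (by rw [h]) := by
    rintro P Q rfl; simp
  calc
    _ = ((appendIso (L ++ A) (A' ++ R)).hom ≫ eqToHom (by rw [List.append_assoc]) ≫
        (appendIso L (A ++ (A' ++ R))).inv) ≫ listValue L ◁
        (eqToHom (by rw [List.append_assoc]) ≫ (appendIso (A ++ A') R).inv) := by
      rw [whiskerLeft_comp, Category.assoc, Category.assoc,
        ← reassoc_of% h3 (List.append_assoc A A' R).symm]
      simp [insertIso]
    _ = (appendIso L A).inv ▷ listValue (A' ++ R) ≫ (α_ _ _ _).hom ≫
        listValue L ◁ ((appendIso A (A' ++ R)).hom ≫ eqToHom (by rw [List.append_assoc]) ≫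
        (appendIso (A ++ A') R).inv) := by
      rw [h1]; simp
    _ = _ := by
      rw [h2, MonoidalCategory.tensorHom_def]; monoidal

theorem insertIso_appendIso (L A A' R : List (SignedColor G C)) :
    (insertIso L (A ++ A') R).hom ≫ eqToHom (by simp) ≫ (appendIso (L ++ A) (A' ++ R)).inv =
      𝟙 (listValue L ⊗ (listValue (A ++ A') ⊗ listValue R)) ⊗≫
        listValue L ◁ (appendIso A A').inv ▷ listValue R ⊗≫
        ((appendIso L A).hom ⊗ₘ (appendIso A' R).hom) := by
  have h := appendIso_insertIso L A A' R
  have h' : (insertIso L (A ++ A') R).hom ≫ eqToHom (by simp) ≫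
      (appendIso (L ++ A) (A' ++ R)).inv = (appendIso (L ++ A) (A' ++ R) ≪≫
      eqToIso (congrArg listValue (by simp)) ≪≫ (insertIso L (A ++ A') R).symm).inv := by
    simp
  rw [h']
  refine Iso.inv_ext ?_
  rw [Iso.trans_hom, Iso.trans_hom, eqToIso.hom, Iso.symm_hom, h]
  calc
    _ = ((appendIso L A).inv ⊗ₘ (appendIso A' R).inv) ⊗≫
        listValue L ◁ ((appendIso A A').hom ≫ (appendIso A A').inv) ▷ listValue R ⊗≫
        ((appendIso L A).hom ⊗ₘ (appendIso A' R).hom) := by monoidal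
    _ = ((appendIso L A).inv ≫ (appendIso L A).hom) ⊗ₘ
        ((appendIso A' R).inv ≫ (appendIso A' R).hom) := by
      rw [Iso.hom_inv_id]; monoidal
    _ = _ := by simp

end ListValue

end GRibbon

namespace GRibbon

open PivotalCategory GGradedCategory GCrossing GBraiding Diagram

/-! ### Transport of pivotal duals. -/

section Congr

variable {C : Type u} [Category.{v} C] [MonoidalCategory C] [PivotalCategory C]

/-- Transport of a duality along isomorphisms. -/
def PivotalDual.transport {V W V' W' : C} {capL : W ⊗ V ⟶ 𝟙_ C} {cupL : 𝟙_ C ⟶ V ⊗ W}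
    {capR : V ⊗ W ⟶ 𝟙_ C} {cupR : 𝟙_ C ⟶ W ⊗ V} (d : PivotalDual V W capL cupL capR cupR)
    (e : V ≅ V') (f : W ≅ W') {capL' : W' ⊗ V' ⟶ 𝟙_ C} {cupL' : 𝟙_ C ⟶ V' ⊗ W'}
    {capR' : V' ⊗ W' ⟶ 𝟙_ C} {cupR' : 𝟙_ C ⟶ W' ⊗ V'}
    (h₁ : capL' = (f.inv ⊗ₘ e.inv) ≫ capL) (h₂ : cupL' = cupL ≫ (e.hom ⊗ₘ f.hom))
    (h₃ : capR' = (e.inv ⊗ₘ f.inv) ≫ capR) (h₄ : cupR' = cupR ≫ (f.hom ⊗ₘ e.hom)) :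
    PivotalDual V' W' capL' cupL' capR' cupR' where
  iso := f.symm ≪≫ d.iso ≪≫ dualIso e.symm
  capL_eq := by
    obtain ⟨j, rfl, rfl, rfl, rfl⟩ := d
    rw [h₁]
    simp [dualIso, dualMap_ev, MonoidalCategory.tensorHom_def, whisker_exchange_assoc]
  cupL_eq := by
    obtain ⟨j, rfl, rfl, rfl, rfl⟩ := d
    rw [h₂]
    have := coev_dualMap e.hom
    simp [dualIso, MonoidalCategory.tensorHom_def]
    rw [reassoc_of% this, whisker_exchange_assoc]
  capR_eq := by
    obtain ⟨j, rfl, rfl, rfl, rfl⟩ := d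
    rw [h₃]
    simp [dualIso, dualMap_evt, MonoidalCategory.tensorHom_def', whisker_exchange_assoc]
  cupR_eq := by
    obtain ⟨j, rfl, rfl, rfl, rfl⟩ := d
    rw [h₄]
    have := coevt_dualMap e.hom
    simp [dualIso, MonoidalCategory.tensorHom_def']
    rw [reassoc_of% this, whisker_exchange_assoc]

end Congr

/-! ### Nested caps and cups, and rotation of diagrams by a full turn. -/

section EvalLemmas

set_option linter.unusedSectionVars false

variable {G : Type w} [Group G] {C : Type u} [Category.{v} C] [MonoidalCategory C] [Preadditive C]
  [GGradedCategory G C] [GCrossing G C] [PivotalCategory C] [GBraiding G C]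

theorem eval_id (A : List (SignedColor G C)) : (Diagram.id A).eval = 𝟙 (listValue A) := rfl

theorem eval_comp {A B K : List (SignedColor G C)} (D : Diagram A B) (E : Diagram B K) :
    (D.comp E).eval = D.eval ≫ E.eval := rfl

theorem eval_tensor {A B A' B' : List (SignedColor G C)} (D : Diagram A B) (E : Diagram A' B') :
    (D.tensor E).eval = (appendIso A A').inv ≫ (D.eval ⊗ₘ E.eval) ≫ (appendIso B B').hom := rfl

theorem eval_cast {A A' B B' : List (SignedColor G C)} (hA : A = A') (hB : B = B')
    (D : Diagram A B) : (D.cast hA hB).eval =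
      eqToHom (by rw [hA]) ≫ D.eval ≫ eqToHom (by rw [hB]) := by
  subst hA hB
  simp [Diagram.cast]

theorem eval_insert (L R : List (SignedColor G C)) {A B : List (SignedColor G C)}
    (D : Diagram A B) : (D.insert L R).eval =
      (insertIso L A R).inv ≫ listValue L ◁ D.eval ▷ listValue R ≫ (insertIso L B R).hom := by
  rw [Diagram.insert, eval_tensor, eval_tensor, eval_id, eval_id]
  simp [insertIso]

theorem eval_insert_cap (L R A : List (SignedColor G C)) (D : Diagram A []) :
    (D.insert L R).eval = (insertIso L A R).inv ≫
      (listValue L ◁ (D.eval ≫ (nilIso G C).hom) ▷ listValue R ⊗≫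
        𝟙 (listValue L ⊗ listValue R)) ≫ (appendIso L R).hom := by
  rw [eval_insert, insertIso_nil]
  congr 1
  simp [monoidalComp]

theorem eval_insert_cup (L R A : List (SignedColor G C)) (D : Diagram [] A) :
    (D.insert L R).eval = (appendIso L R).inv ≫
      (𝟙 (listValue L ⊗ listValue R) ⊗≫ listValue L ◁ ((nilIso G C).inv ≫ D.eval) ▷ listValue R) ≫
        (insertIso L A R).hom := by
  rw [eval_insert, insertIso_nil_inv]
  simp [monoidalComp]

/-- The duality of a signed color and its reverse given by the caps and the cups. -/
def pivotalDualSingle (a : SignedColor G C) : PivotalDual (listValue [a]) (listValue [a.reverse])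
    ((appendIso [a.reverse] [a]).hom ≫ (cap a).eval ≫ (nilIso G C).hom)
    ((nilIso G C).inv ≫ (cup a).eval ≫ (appendIso [a] [a.reverse]).inv)
    ((appendIso [a] [a.reverse]).hom ≫ (cap' a).eval ≫ (nilIso G C).hom)
    ((nilIso G C).inv ≫ (cup' a).eval ≫ (appendIso [a.reverse] [a]).inv) := by
  have h : ∀ a b : SignedColor G C, (appendIso [a] [b]).hom = 𝟙 (a.value ⊗ b.value) := by
    intro a b
    rw [appendIso_single]
    exact (Category.comp_id _).trans (id_whiskerRight _ _)
  have h' : ∀ a b : SignedColor G C, (appendIso [a] [b]).inv = 𝟙 (a.value ⊗ b.value) := by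
    intro a b
    apply Iso.inv_ext
    rw [h]
    exact Category.comp_id _
  have e1 : ∀ {a b : SignedColor G C} (f : a.value ⊗ b.value ⟶ 𝟙_ C),
      (appendIso [a] [b]).hom ≫ f ≫ (nilIso G C).hom = f := by
    intro a b f
    rw [h]
    exact (Category.id_comp _).trans (Category.comp_id _)
  have e2 : ∀ {a b : SignedColor G C} (f : 𝟙_ C ⟶ a.value ⊗ b.value),
      (nilIso G C).inv ≫ f ≫ (appendIso [a] [b]).inv = f := by
    intro a b f
    rw [h']
    exact (Category.id_comp _).trans (Category.comp_id _)
  have e3 : ∀ {V W : C} (f : 𝟙_ C ⟶ V ⊗ W), f = f ≫ ((Iso.refl V).hom ⊗ₘ (Iso.refl W).hom) := by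
    simp
  have e4 : ∀ {V W : C} (f : V ⊗ W ⟶ 𝟙_ C), f = ((Iso.refl V).inv ⊗ₘ (Iso.refl W).inv) ≫ f := by
    simp
  obtain ⟨X, _ | _⟩ := a
  -- A strand directed upwards has value `X^*` and its reverse has value `X`, so the duality needed
  -- is that of `X` as a dual of `X^*`.
  · exact (PivotalDual.double X.obj).transport (Iso.refl _) (Iso.refl _)
      ((e1 (a := X.down) (b := X.up) _).trans (e4 _))
      ((e2 (a := X.up) (b := X.down) (coevt X.obj)).trans (e3 _))
      ((e1 (a := X.up) (b := X.down) _).trans (e4 _))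
      ((e2 (a := X.down) (b := X.up) (coev X.obj)).trans (e3 _))
  · exact (PivotalDual.self X.obj).transport (Iso.refl _) (Iso.refl _)
      ((e1 (a := X.up) (b := X.down) _).trans (e4 _))
      ((e2 (a := X.down) (b := X.up) (coev X.obj)).trans (e3 _))
      ((e1 (a := X.down) (b := X.up) _).trans (e4 _))
      ((e2 (a := X.up) (b := X.down) (coevt X.obj)).trans (e3 _))

/-- One step of the recursions for `caps` and `caps'`: an inner cap followed by an outer one is, up
to regrouping, the cap of `PivotalDual.tensor`. The letters differ because `caps` puts the single
strand inside and `caps'` puts it outside. -/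
theorem nested_cap (L A A' R : List (SignedColor G C)) (c : listValue (A ++ A') ⟶ listValue [])
    (c' : listValue (L ++ R) ⟶ listValue []) :
    (appendIso (L ++ A) (A' ++ R)).hom ≫ (eqToHom (congrArg listValue (by simp)) ≫
      (((insertIso L (A ++ A') R).inv ≫ (listValue L ◁ (c ≫ (nilIso G C).hom) ▷ listValue R ⊗≫
        𝟙 (listValue L ⊗ listValue R)) ≫ (appendIso L R).hom) ≫ c') ≫ 𝟙 (listValue [])) ≫
        (nilIso G C).hom =
      ((appendIso L A).inv ⊗ₘ (appendIso A' R).inv) ≫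
        (𝟙 ((listValue L ⊗ listValue A) ⊗ (listValue A' ⊗ listValue R)) ⊗≫
          listValue L ◁ ((appendIso A A').hom ≫ c ≫ (nilIso G C).hom) ▷ listValue R ⊗≫
          (appendIso L R).hom ≫ c' ≫ (nilIso G C).hom) := by
  have h := appendIso_insertIso L A A' R
  simp only [Category.assoc, Category.id_comp]
  rw [reassoc_of% h]
  monoidal

theorem nested_cup (L A A' R : List (SignedColor G C)) (c : listValue [] ⟶ listValue (A ++ A'))
    (c' : listValue [] ⟶ listValue (L ++ R)) :
    (nilIso G C).inv ≫ (𝟙 (listValue []) ≫ (c' ≫ (appendIso L R).inv ≫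
      (𝟙 (listValue L ⊗ listValue R) ⊗≫ listValue L ◁ ((nilIso G C).inv ≫ c) ▷ listValue R) ≫
      (insertIso L (A ++ A') R).hom) ≫ eqToHom (congrArg listValue (by simp))) ≫
      (appendIso (L ++ A) (A' ++ R)).inv =
      (((nilIso G C).inv ≫ c' ≫ (appendIso L R).inv) ⊗≫
          listValue L ◁ ((nilIso G C).inv ≫ c ≫ (appendIso A A').inv) ▷ listValue R ⊗≫
          𝟙 ((listValue L ⊗ listValue A) ⊗ (listValue A' ⊗ listValue R))) ≫
        ((appendIso L A).hom ⊗ₘ (appendIso A' R).hom) := by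
  have h := insertIso_appendIso L A A' R
  simp only [Category.assoc, Category.id_comp]
  rw [h]
  monoidal

/-- The duality of a sequence and its reverse given by the nested caps and the nested cups. -/
def pivotalDualList : ∀ A : List (SignedColor G C), PivotalDual (listValue A)
    (listValue (reverseList A))
    ((appendIso (reverseList A) A).hom ≫ (caps A).eval ≫ (nilIso G C).hom)
    ((nilIso G C).inv ≫ (cups A).eval ≫ (appendIso A (reverseList A)).inv)
    ((appendIso A (reverseList A)).hom ≫ (caps' A).eval ≫ (nilIso G C).hom)
    ((nilIso G C).inv ≫ (cups' A).eval ≫ (appendIso (reverseList A) A).inv)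
  | [] => by
    have h1 : (appendIso ([] : List (SignedColor G C)) []).hom ≫ 𝟙 (listValue []) ≫
        (nilIso G C).hom = ((nilIso G C).hom ⊗ₘ (nilIso G C).hom) ≫ (λ_ (𝟙_ C)).hom := by
      have h : ((nilIso G C).hom ▷ listValue [] ≫ (λ_ (listValue [])).hom) ≫ (nilIso G C).hom =
        ((nilIso G C).hom ⊗ₘ (nilIso G C).hom) ≫ (λ_ (𝟙_ C)).hom := by
        rw [MonoidalCategory.tensorHom_def]; simp
      rw [← appendIso_nil_left] at h
      exact Eq.trans (congrArg (_ ≫ ·) (Category.id_comp _)) h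
    have h2 : (nilIso G C).inv ≫ 𝟙 (listValue []) ≫
        (appendIso ([] : List (SignedColor G C)) []).inv =
        (λ_ (𝟙_ C)).inv ≫ ((nilIso G C).inv ⊗ₘ (nilIso G C).inv) := by
      have h : (nilIso G C).inv ≫ (λ_ (listValue [])).inv ≫ (nilIso G C).inv ▷ listValue [] =
        (λ_ (𝟙_ C)).inv ≫ ((nilIso G C).inv ⊗ₘ (nilIso G C).inv) := by
        rw [MonoidalCategory.tensorHom_def']; simp
      rw [← appendIso_nil_left_inv] at h
      exact Eq.trans (congrArg (_ ≫ ·) (Category.id_comp _)) h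
    exact PivotalDual.unit.transport (nilIso G C).symm (nilIso G C).symm h1 h2 h1 h2
  | a :: A => by
    -- The dual of a product is the product of the duals in the opposite order, which matches
    -- `reverseList`.
    refine ((pivotalDualSingle a).tensor (pivotalDualList A)).transport (appendIso [a] A)
      (appendIso (reverseList A) [a.reverse]) ?_ ?_ ?_ ?_
    · have h := (eval_cast (A' := reverseList (a :: A) ++ a :: A) (by simp [reverseList]) rfl
        ((insert (reverseList A) A (cap a)).comp
        (caps A))).trans (congrArg (fun t => eqToHom _ ≫ (t ≫ (caps A).eval) ≫ 𝟙 _)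
          (eval_insert_cap _ _ _ _))
      exact (congrArg (fun t => _ ≫ t ≫ _) h).trans (nested_cap (reverseList A) [a.reverse] [a] A
        (cap a).eval (caps A).eval)
    · have h := (eval_cast (B' := a :: A ++ reverseList (a :: A)) rfl (by simp [reverseList])
        ((cup a).comp (insert [a] [a.reverse]
        (cups A)))).trans (congrArg (fun t => 𝟙 _ ≫ ((cup a).eval ≫ t) ≫ eqToHom _)
          (eval_insert_cup _ _ _ _))
      exact (congrArg (fun t => _ ≫ t ≫ _) h).trans (nested_cup [a] A (reverseList A) [a.reverse]
        (cups A).eval (cup a).eval)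
    · have h := (eval_cast (A' := a :: A ++ reverseList (a :: A)) (by simp [reverseList]) rfl
        ((insert [a] [a.reverse] (caps' A)).comp
        (cap' a))).trans (congrArg (fun t => eqToHom _ ≫ (t ≫ (cap' a).eval) ≫ 𝟙 _)
          (eval_insert_cap _ _ _ _))
      exact (congrArg (fun t => _ ≫ t ≫ _) h).trans (nested_cap [a] A (reverseList A) [a.reverse]
        (caps' A).eval (cap' a).eval)
    · have h := (eval_cast (B' := reverseList (a :: A) ++ a :: A) rfl (by simp [reverseList])
        ((cups' A).comp (insert (reverseList A) A
        (cup' a)))).trans (congrArg (fun t => 𝟙 _ ≫ ((cups' A).eval ≫ t) ≫ eqToHom _)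
          (eval_insert_cup _ _ _ _))
      exact (congrArg (fun t => _ ≫ t ≫ _) h).trans (nested_cup (reverseList A) [a.reverse] [a] A
        (cup' a).eval (cups' A).eval)

/-- All transports cancel by regrouping, leaving the left mate of `D.eval` for the nested duality,
in the shape of `PivotalDual.rotate_eq`; `eval_rotate'` gives the right mate. -/
theorem eval_rotate {A B : List (SignedColor G C)} (D : Diagram A B) : (rotate D).eval =
    𝟙 (listValue (reverseList B)) ⊗≫ listValue (reverseList B) ◁ ((nilIso G C).inv ≫
      (cups A).eval ≫ (appendIso A (reverseList A)).inv) ⊗≫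
      listValue (reverseList B) ◁ D.eval ▷ listValue (reverseList A) ⊗≫
      ((appendIso (reverseList B) B).hom ≫ (caps B).eval ≫ (nilIso G C).hom) ▷
        listValue (reverseList A) ⊗≫ 𝟙 (listValue (reverseList A)) := by
  have h := appendIso_assoc' (reverseList B) B (reverseList A)
  refine (eval_cast _ _ _).trans ?_
  rw [eval_comp, eval_comp, eval_cast, eval_tensor, eval_tensor, eval_tensor, eval_tensor,
    eval_id, eval_id, appendIso_nil_right_inv]
  have h2 : (appendIso [] (reverseList A)).hom ≫ eqToHom (congrArg listValue rfl) =
    (nilIso G C).hom ▷ listValue (reverseList A) ≫ (λ_ (listValue (reverseList A))).hom :=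
    (Category.comp_id _).trans (appendIso_nil_left _)
  simp only [Category.assoc, Iso.hom_inv_id_assoc, eqToHom_trans, eqToHom_trans_assoc,
    Category.id_comp, id_tensorHom, tensorHom_id, whiskerLeft_comp]
  rw [reassoc_of% h, h2, eqToHom_refl]
  have h3 : listValue (reverseList B) ◁ (appendIso B (reverseList A)).hom ≫
    listValue (reverseList B) ◁ (appendIso B (reverseList A)).inv = 𝟙 _ := by
    rw [← whiskerLeft_comp, Iso.hom_inv_id, whiskerLeft_id]
  rw [reassoc_of% h3]
  monoidal

theorem eval_rotate' {A B : List (SignedColor G C)} (D : Diagram A B) : (rotate' D).eval =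
    𝟙 (listValue (reverseList B)) ⊗≫ ((nilIso G C).inv ≫
      (cups' A).eval ≫ (appendIso (reverseList A) A).inv) ▷ listValue (reverseList B) ⊗≫
      listValue (reverseList A) ◁ D.eval ▷ listValue (reverseList B) ⊗≫
      listValue (reverseList A) ◁ ((appendIso B (reverseList B)).hom ≫ (caps' B).eval ≫
        (nilIso G C).hom) ⊗≫ 𝟙 (listValue (reverseList A)) := by
  have h := appendIso_assoc'' (reverseList A) A (reverseList B)
  refine (eval_cast _ _ _).trans ?_
  rw [eval_comp, eval_comp, eval_cast, eval_tensor, eval_tensor, eval_tensor, eval_tensor,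
    eval_id, eval_id, appendIso_nil_right]
  have h2 : eqToHom (congrArg listValue rfl) ≫ (appendIso [] (reverseList B)).inv =
    (λ_ (listValue (reverseList B))).inv ≫ (nilIso G C).inv ▷ listValue (reverseList B) :=
    (Category.id_comp _).trans (appendIso_nil_left_inv _)
  simp only [Category.assoc, Iso.hom_inv_id_assoc, eqToHom_trans, eqToHom_trans_assoc,
    Category.comp_id, id_tensorHom, tensorHom_id, whiskerLeft_comp]
  rw [reassoc_of% h, reassoc_of% h2]
  simp only [eqToHom_refl, Category.id_comp, Category.comp_id, Iso.hom_inv_id_assoc]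
  have h3 : listValue (reverseList A) ◁ (appendIso A (reverseList B)).hom ≫
    listValue (reverseList A) ◁ (appendIso A (reverseList B)).inv = 𝟙 _ := by
    rw [← whiskerLeft_comp, Iso.hom_inv_id, whiskerLeft_id]
  rw [reassoc_of% h3]
  monoidal

theorem eval_rotate_eq {A B : List (SignedColor G C)} (D : Diagram A B) :
    (rotate D).eval = (rotate' D).eval := by
  rw [eval_rotate, eval_rotate']
  exact (pivotalDualList A).rotate_eq (pivotalDualList B) D.eval

end EvalLemmas
end GRibbon

namespace GRibbon

open PivotalCategory GGradedCategory GCrossing GBraiding Diagram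

/-! ### Invariance under plane isotopy. -/

section Isotopy

variable {G : Type w} [Group G] {C : Type u} [Category.{v} C] [MonoidalCategory C] [Preadditive C]
  [GGradedCategory G C] [GCrossing G C] [PivotalCategory C] [GBraiding G C]

set_option linter.unusedSectionVars false

theorem value_down (X : Color G C) : (⟨X, true⟩ : SignedColor G C).value = X.obj := rfl

theorem value_up (X : Color G C) : (⟨X, false⟩ : SignedColor G C).value = dual X.obj := rfl

theorem eval_tensor_assoc {A B A' B' A'' B'' : List (SignedColor G C)} (D : Diagram A B)
    (D' : Diagram A' B') (D'' : Diagram A'' B'') :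
    (((D.tensor D').tensor D'').cast (List.append_assoc A A' A'')
      (List.append_assoc B B' B'')).eval = (D.tensor (D'.tensor D'')).eval := by
  have h1 : eqToHom (congrArg listValue (List.append_assoc A A' A'').symm) ≫
      (appendIso (A ++ A') A'').inv = (appendIso A (A' ++ A'')).inv ≫
      listValue A ◁ (appendIso A' A'').inv ≫ (α_ _ _ _).inv ≫
      (appendIso A A').hom ▷ listValue A'' := by
    rw [← appendIso_assoc', Iso.inv_hom_id_assoc]
  have h2 : (appendIso (B ++ B') B'').hom ≫
      eqToHom (congrArg listValue (List.append_assoc B B' B'')) =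
      (appendIso B B').inv ▷ listValue B'' ≫ (α_ _ _ _).hom ≫
      listValue B ◁ (appendIso B' B'').hom ≫ (appendIso B (B' ++ B'')).hom := by
    have h := appendIso_assoc'' B B' B''
    rw [← Category.assoc, ← Category.assoc, Category.assoc _ _ (_ ◁ _), ← h]
    simp
  rw [eval_cast, eval_tensor, eval_tensor, eval_tensor, eval_tensor]
  simp only [Category.assoc]
  rw [h2, reassoc_of% h1]
  have e1 : ((appendIso A A').inv ≫ (D.eval ⊗ₘ D'.eval) ≫ (appendIso B B').hom) ⊗ₘ D''.eval =
      (appendIso A A').inv ▷ _ ≫ ((D.eval ⊗ₘ D'.eval) ⊗ₘ D''.eval) ≫ (appendIso B B').hom ▷ _ := by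
    rw [← tensorHom_id, ← tensorHom_id, tensorHom_comp_tensorHom, tensorHom_comp_tensorHom,
      Category.id_comp, Category.comp_id]
  have e2 : D.eval ⊗ₘ ((appendIso A' A'').inv ≫ (D'.eval ⊗ₘ D''.eval) ≫ (appendIso B' B'').hom) =
      _ ◁ (appendIso A' A'').inv ≫ (D.eval ⊗ₘ (D'.eval ⊗ₘ D''.eval)) ≫
        _ ◁ (appendIso B' B'').hom := by
    rw [← id_tensorHom, ← id_tensorHom, tensorHom_comp_tensorHom, tensorHom_comp_tensorHom,
      Category.id_comp, Category.comp_id]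
  rw [e1, e2]
  simp

theorem eval_tensor_nil {A B : List (SignedColor G C)} (D : Diagram A B) :
    ((D.tensor (Diagram.id [])).cast (List.append_nil A) (List.append_nil B)).eval = D.eval := by
  rw [eval_cast, eval_tensor, appendIso_nil_right, appendIso_nil_right_inv, eval_id,
    tensorHom_id]
  simp only [Category.assoc, eqToHom_trans, eqToHom_trans_assoc, eqToHom_refl, Category.comp_id,
    Category.id_comp]
  rw [← whisker_exchange_assoc]
  simp

theorem eval_nil_tensor {A B : List (SignedColor G C)} (D : Diagram A B) :
    ((Diagram.id []).tensor D).eval = D.eval := by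
  refine (eval_tensor _ _).trans ?_
  have h : (λ_ (listValue A)).inv ≫ (nilIso G C).inv ▷ listValue A ≫
      (𝟙 (listValue []) ⊗ₘ D.eval) ≫ (nilIso G C).hom ▷ listValue B ≫ (λ_ (listValue B)).hom =
      D.eval := by
    rw [id_tensorHom, whisker_exchange_assoc]
    simp
  refine Eq.trans ?_ h
  rw [appendIso_nil_left, appendIso_nil_left_inv, Category.assoc]
  rfl

/-- On explicit lists the evaluation unfolds to a composite in `C`, and coherence reduces it to a
duality identity of `X`. The other three zigzags are treated in the same way. -/
theorem eval_zigzag_down_right (X : Color G C) :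
    (((cupRight X).tensor (Diagram.id [X.down])).comp
      ((Diagram.id [X.down]).tensor (capRight X))).eval = 𝟙 (listValue [X.down]) := by
  refine Eq.trans ?_ (coev_ev X.obj)
  dsimp only [Diagram.eval, listValue, tensorListAppend, tensorListCons, tensorList, value_down,
    value_up, Color.down, Color.up, List.cons_append, List.nil_append]
  simp only [Iso.trans_hom, Iso.trans_inv, Iso.refl_hom, Iso.refl_inv, Iso.symm_hom, Iso.symm_inv,
    whiskerRightIso_hom, whiskerRightIso_inv, whiskerLeftIso_hom, whiskerLeftIso_inv]
  monoidal

theorem eval_zigzag_up_right (X : Color G C) :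
    (((Diagram.id [X.up]).tensor (cupRight X)).comp
      ((capRight X).tensor (Diagram.id [X.up]))).eval = 𝟙 (listValue [X.up]) := by
  refine Eq.trans ?_ (ev_coev X.obj)
  dsimp only [Diagram.eval, listValue, tensorListAppend, tensorListCons, tensorList, value_down,
    value_up, Color.down, Color.up, List.cons_append, List.nil_append]
  simp only [Iso.trans_hom, Iso.trans_inv, Iso.refl_hom, Iso.refl_inv, Iso.symm_hom, Iso.symm_inv,
    whiskerRightIso_hom, whiskerRightIso_inv, whiskerLeftIso_hom, whiskerLeftIso_inv]
  monoidal

theorem eval_zigzag_down_left (X : Color G C) :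
    (((Diagram.id [X.down]).tensor (cupLeft X)).comp
      ((capLeft X).tensor (Diagram.id [X.down]))).eval = 𝟙 (listValue [X.down]) := by
  refine Eq.trans ?_ (coevt_evt X.obj)
  dsimp only [Diagram.eval, listValue, tensorListAppend, tensorListCons, tensorList, value_down,
    value_up, Color.down, Color.up, List.cons_append, List.nil_append]
  simp only [Iso.trans_hom, Iso.trans_inv, Iso.refl_hom, Iso.refl_inv, Iso.symm_hom, Iso.symm_inv,
    whiskerRightIso_hom, whiskerRightIso_inv, whiskerLeftIso_hom, whiskerLeftIso_inv]
  monoidal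

theorem eval_zigzag_up_left (X : Color G C) :
    (((cupLeft X).tensor (Diagram.id [X.up])).comp
      ((Diagram.id [X.up]).tensor (capLeft X))).eval = 𝟙 (listValue [X.up]) := by
  refine Eq.trans ?_ (evt_coevt X.obj)
  dsimp only [Diagram.eval, listValue, tensorListAppend, tensorListCons, tensorList, value_down,
    value_up, Color.down, Color.up, List.cons_append, List.nil_append]
  simp only [Iso.trans_hom, Iso.trans_inv, Iso.refl_hom, Iso.refl_inv, Iso.symm_hom, Iso.symm_inv,
    whiskerRightIso_hom, whiskerRightIso_inv, whiskerLeftIso_hom, whiskerLeftIso_inv]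
  monoidal

theorem Diagram.PlaneIsotopic.eval_eq {A B : List (SignedColor G C)} {D E : Diagram A B}
    (h : PlaneIsotopic D E) : D.eval = E.eval := by
  induction h with
  | refl D => rfl
  | symm _ ih => exact ih.symm
  | trans _ _ ih ih' => exact ih.trans ih'
  | comp _ _ ih ih' => rw [eval_comp, eval_comp, ih, ih']
  | tensor _ _ ih ih' => rw [eval_tensor, eval_tensor, ih, ih']
  | id_comp D => exact Category.id_comp _
  | comp_id D => exact Category.comp_id _
  | assoc D E N => exact Category.assoc _ _ _
  | id_tensor_id A B => rw [eval_tensor, eval_id, eval_id, eval_id]; simp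
  | interchange D E D' E' =>
    rw [eval_comp, eval_tensor, eval_tensor, eval_tensor, eval_comp, eval_comp]; simp
  | nil_tensor D => exact eval_nil_tensor D
  | tensor_nil D => exact eval_tensor_nil D
  | tensor_assoc D D' D'' => exact eval_tensor_assoc D D' D''
  | zigzag_down_right X => exact eval_zigzag_down_right X
  | zigzag_up_right X => exact eval_zigzag_up_right X
  | zigzag_down_left X => exact eval_zigzag_down_left X
  | zigzag_up_left X => exact eval_zigzag_up_left X
  | full_turn D => exact eval_rotate_eq D

end Isotopy

/-! ### Values of systems of color isomorphisms. -/

section Coloring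

variable {G : Type w} [Group G] {C : Type u} [Category.{v} C] [MonoidalCategory C] [Preadditive C]
  [GGradedCategory G C] [PivotalCategory C]

/-- The morphism between the values of signed colors given by an isomorphism of colors. -/
def ColorIso.signedValue {X X' : Color G C} (s : Bool) (f : X.obj ≅ X'.obj) :
    (⟨X, s⟩ : SignedColor G C).value ⟶ (⟨X', s⟩ : SignedColor G C).value := ColorIso.signed f s

theorem ColorIso.value_cons {X X' : Color G C} (s : Bool) (f : X.obj ≅ X'.obj)
    {A A' : List (SignedColor G C)} (r : ColorIso A A') : (ColorIso.cons s f r).value =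
      (consIso (⟨X, s⟩ : SignedColor G C) A).hom ≫ (ColorIso.signedValue s f ⊗ₘ r.value) ≫
        (consIso (⟨X', s⟩ : SignedColor G C) A').inv := rfl

theorem ColorIso.value_refl (A : List (SignedColor G C)) :
    (ColorIso.refl A).value = 𝟙 (listValue A) := by
  induction A with
  | nil => rfl
  | cons a A ih =>
    obtain ⟨X, s⟩ := a
    have h : ColorIso.signedValue s (Iso.refl X.obj) = 𝟙 _ := by
      cases s
      · exact dualMap_id X.obj
      · rfl
    refine (ColorIso.value_cons s (Iso.refl X.obj) (ColorIso.refl A)).trans ?_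
    rw [h, ih, id_tensorHom_id, Category.id_comp, Iso.hom_inv_id]

/-- Induction on `p`, peeling off the first factor; naturality of the associator and of the unitor
does the rest. -/
theorem ColorIso.value_append {A A' B B' : List (SignedColor G C)} (q : ColorIso B B')
    (p : ColorIso A A') : (appendIso A B).hom ≫ (ColorIso.append q p).value =
      (p.value ⊗ₘ q.value) ≫ (appendIso A' B').hom := by
  induction p with
  | nil =>
    have h : (nilIso G C).hom ▷ listValue B ≫ (λ_ (listValue B)).hom ≫ q.value =
        (𝟙 (listValue []) ⊗ₘ q.value) ≫ (nilIso G C).hom ▷ listValue B' ≫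
          (λ_ (listValue B')).hom := by
      rw [id_tensorHom, whisker_exchange_assoc]; simp
    rw [appendIso_nil_left, appendIso_nil_left]
    exact (Category.assoc _ _ _).trans h
  | @cons X X' s f A A' r ih =>
    refine (congrArg (_ ≫ ·) (ColorIso.value_cons s f (ColorIso.append q r))).trans ?_
    rw [ColorIso.value_cons, appendIso_cons, appendIso_cons]
    have e1 : ColorIso.signedValue s f ⊗ₘ ((appendIso A B).hom ≫ (ColorIso.append q r).value) =
        _ ◁ (appendIso A B).hom ≫ (ColorIso.signedValue s f ⊗ₘ (ColorIso.append q r).value) := by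
      rw [← id_tensorHom, tensorHom_comp_tensorHom, Category.id_comp]
    have e2 : ColorIso.signedValue s f ⊗ₘ ((r.value ⊗ₘ q.value) ≫ (appendIso A' B').hom) =
        (ColorIso.signedValue s f ⊗ₘ (r.value ⊗ₘ q.value)) ≫ _ ◁ (appendIso A' B').hom := by
      rw [← id_tensorHom, tensorHom_comp_tensorHom, Category.comp_id]
    have e3 : ((consIso (⟨X, s⟩ : SignedColor G C) A).hom ≫ (ColorIso.signedValue s f ⊗ₘ r.value) ≫
        (consIso ⟨X', s⟩ A').inv) ⊗ₘ q.value = (consIso (⟨X, s⟩ : SignedColor G C) A).hom ▷ _ ≫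
        ((ColorIso.signedValue s f ⊗ₘ r.value) ⊗ₘ q.value) ≫ (consIso ⟨X', s⟩ A').inv ▷ _ := by
      rw [← tensorHom_id, ← tensorHom_id, tensorHom_comp_tensorHom, tensorHom_comp_tensorHom,
        Category.id_comp, Category.comp_id]
    rw [ih, e2] at e1
    rw [e3]
    simp only [Category.assoc, Iso.inv_hom_id_assoc, inv_hom_whiskerRight_assoc]
    rw [← reassoc_of% e1, associator_naturality_assoc]

end Coloring
end GRibbon

namespace GRibbon

open PivotalCategory GGradedCategory GCrossing GBraiding Diagram

/-! ### Invariance under isomorphisms of colorings. -/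

section ColoringEval

variable {G : Type w} [Group G] {C : Type u} [Category.{v} C] [MonoidalCategory C] [Preadditive C]
  [GGradedCategory G C] [GCrossing G C] [PivotalCategory C] [GBraiding G C]

set_option linter.unusedSectionVars false

theorem ColorIso.value_pair {X X' Y Y' : Color G C} (s t : Bool) (f : X.obj ≅ X'.obj)
    (g : Y.obj ≅ Y'.obj) : (ColorIso.cons s f (.cons t g .nil)).value =
      (ColorIso.signed f s ⊗ₘ ColorIso.signed g t :
        signedDual s X.obj ⊗ signedDual t Y.obj ⟶ signedDual s X'.obj ⊗ signedDual t Y'.obj) := by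
  dsimp only [ColorIso.value, listValue, tensorListCons, tensorList, SignedColor.value]
  simp

theorem crossIso_coloring {X X' Y Y' Z Z' : C} {β β' : G} (hY : component β Y)
    (hY' : component β' Y') (hβ : β = β') (f : X ⟶ X') (g : Y ⟶ Y') (h : Z ⟶ Z')
    (ψ : Z ≅ (act β).obj X) (ψ' : Z' ≅ (act β').obj X')
    (w : ψ.hom ≫ (act β).map f = h ≫ ψ'.hom ≫ eqToHom (by rw [hβ])) :
    (f ⊗ₘ g) ≫ (crossIso X' hY' ψ').hom = (crossIso X hY ψ).hom ≫ (g ⊗ₘ h) := by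
  subst hβ
  have w' : (act β).map f ≫ ψ'.inv = ψ.inv ≫ h := by
    rw [Iso.comp_inv_eq, Category.assoc, Iso.eq_inv_comp, w]; simp
  rw [crossIso_hom, crossIso_hom, ← Category.assoc, braid_naturality hY hY', Category.assoc,
    Category.assoc, ← id_tensorHom, ← id_tensorHom, tensorHom_comp_tensorHom,
    tensorHom_comp_tensorHom, w', Category.comp_id, Category.id_comp]

/-- Each elementary piece is natural: caps and cups because `f^*` cancels its inverse, crossings by
naturality of the braiding, coupons by assumption. Arbitrary isomorphisms at the ends are needed,
since stacking creates them at intermediate levels even when the ends are fixed. -/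
theorem Diagram.ColoringIso.eval_value {A A' B B' : List (SignedColor G C)} {p : ColorIso A A'}
    {q : ColorIso B B'} {D : Diagram A B} {D' : Diagram A' B'} (h : ColoringIso p q D D') :
    p.value ≫ D'.eval = D.eval ≫ q.value := by
  induction h with
  | id p => rw [eval_id, eval_id, Category.comp_id, Category.id_comp]
  | comp _ _ ih ih' => rw [eval_comp, eval_comp, reassoc_of% ih, ih', Category.assoc]
  | @tensor A A' B B' K K' L L' p q r s D D' E E' _ _ ih ih' =>
    have h1 := ColorIso.value_append r p
    have h2 := ColorIso.value_append s q
    rw [eval_tensor, eval_tensor, Category.assoc, Category.assoc, h2,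
      ← cancel_epi (appendIso A K).hom, reassoc_of% h1, Iso.hom_inv_id_assoc,
      Iso.hom_inv_id_assoc]
    simp only [tensorHom_comp_tensorHom_assoc, ih, ih']
  | @capRight X X' f =>
    have h : (dualMap f.inv ⊗ₘ f.hom) ≫ ev X'.obj = ev X.obj ≫ 𝟙 (𝟙_ C) := by
      rw [MonoidalCategory.tensorHom_def, Category.assoc, ← dualMap_ev, ← comp_whiskerRight_assoc,
        ← dualMap_comp]
      simp [dualMap_id]
    exact (congrArg (· ≫ _) (ColorIso.value_pair false true f f)).trans h
  | @capLeft X X' f =>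
    have h : (f.hom ⊗ₘ dualMap f.inv) ≫ evt X'.obj = evt X.obj ≫ 𝟙 (𝟙_ C) := by
      rw [MonoidalCategory.tensorHom_def', Category.assoc, ← dualMap_evt,
        ← whiskerLeft_comp_assoc, ← dualMap_comp]
      simp [dualMap_id]
    exact (congrArg (· ≫ _) (ColorIso.value_pair true false f f)).trans h
  | @cupRight X X' f =>
    have h : 𝟙 (𝟙_ C) ≫ coev X'.obj = coev X.obj ≫ (f.hom ⊗ₘ dualMap f.inv) := by
      rw [MonoidalCategory.tensorHom_def, ← Category.assoc, ← coev_dualMap, Category.assoc,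
        ← whiskerLeft_comp, ← dualMap_comp]
      simp [dualMap_id]
    exact h.trans (congrArg (_ ≫ ·) (ColorIso.value_pair true false f f)).symm
  | @cupLeft X X' f =>
    have h : 𝟙 (𝟙_ C) ≫ coevt X'.obj = coevt X.obj ≫ (dualMap f.inv ⊗ₘ f.hom) := by
      rw [MonoidalCategory.tensorHom_def', ← Category.assoc, ← coevt_dualMap, Category.assoc,
        ← comp_whiskerRight, ← dualMap_comp]
      simp [dualMap_id]
    exact h.trans (congrArg (_ ≫ ·) (ColorIso.value_pair false true f f)).symm
  | @crossPos X Y Z X' Y' Z' f g h ψ ψ' hY w =>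
    have e := crossIso_coloring Y.mem Y'.mem hY f.hom g.hom h.hom ψ ψ' w
    exact ((congrArg (· ≫ _) (ColorIso.value_pair true true f g)).trans e).trans
      (congrArg (_ ≫ ·) (ColorIso.value_pair true true g h)).symm
  | @crossNeg X Y Z X' Y' Z' f g h ψ ψ' hX w =>
    -- A negative crossing is the inverse of a positive one with the roles of the strands exchanged,
    -- so the square for the latter is inverted.
    have e := crossIso_coloring X.mem X'.mem hX h.hom f.hom g.hom ψ ψ' w
    have e' : (f.hom ⊗ₘ g.hom) ≫ (crossIso Z'.obj X'.mem ψ').inv =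
        (crossIso Z.obj X.mem ψ).inv ≫ (h.hom ⊗ₘ f.hom) := by
      rw [Iso.comp_inv_eq, Category.assoc, e, Iso.inv_hom_id_assoc]
    exact ((congrArg (· ≫ _) (ColorIso.value_pair true true f g)).trans e').trans
      (congrArg (_ ≫ ·) (ColorIso.value_pair true true h f)).symm
  | coupon p q h h' f f' w => exact w.symm

theorem Diagram.ColorEquivalent.eval_eq {A B : List (SignedColor G C)} {D E : Diagram A B}
    (h : ColorEquivalent D E) : D.eval = E.eval := by
  induction h with
  | isotopy h => exact h.eval_eq
  | coloring h =>
    have := h.eval_value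
    rwa [ColorIso.value_refl, ColorIso.value_refl, Category.id_comp, Category.comp_id, eq_comm]
      at this
  | symm _ ih => exact ih.symm
  | trans _ _ ih ih' => exact ih.trans ih'
  | comp _ _ ih ih' => rw [eval_comp, eval_comp, ih, ih']
  | tensor _ _ ih ih' => rw [eval_tensor, eval_tensor, ih, ih']

end ColoringEval

/-! ### The evaluation functor and its uniqueness. -/

section EvalFunctor

variable (G : Type w) [Group G] (C : Type u) [Category.{v} C] [MonoidalCategory C] [Preadditive C]
  [GGradedCategory G C] [GCrossing G C] [PivotalCategory C] [GBraiding G C]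

/-- The functor which evaluates colored diagrams. -/
def evalFunctor : DiagramCategory G C ⥤ C where
  obj A := listValue A.seq
  map f := Quotient.lift Diagram.eval (fun _ _ h => ColorEquivalent.eval_eq h) f
  map_id _ := rfl
  map_comp := by
    rintro A B K ⟨D⟩ ⟨E⟩
    rfl

variable {G C}

theorem evalFunctor_map_eqToHom {A B : DiagramCategory G C} (h : A = B) :
    (evalFunctor G C).map (eqToHom h) = eqToHom (congrArg (fun A => listValue A.seq) h) := by
  subst h; rfl

variable (G C) in
/-- The evaluation functor is strong monoidal. -/
def evalFunctorCore : (evalFunctor G C).CoreMonoidal where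
  εIso := (nilIso G C).symm
  μIso A B := appendIso A.seq B.seq
  μIso_hom_natural_left {A B} f K := by
    obtain ⟨D, rfl⟩ := exists_ofDiagram f
    have h : D.eval ▷ listValue K.seq ≫ (appendIso B.seq K.seq).hom =
        (appendIso A.seq K.seq).hom ≫ (D.tensor (Diagram.id K.seq)).eval := by
      rw [eval_tensor, eval_id]; simp
    exact h
  μIso_hom_natural_right {A B} K f := by
    obtain ⟨D, rfl⟩ := exists_ofDiagram f
    have h : listValue K.seq ◁ D.eval ≫ (appendIso K.seq B.seq).hom =
        (appendIso K.seq A.seq).hom ≫ ((Diagram.id K.seq).tensor D).eval := by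
      rw [eval_tensor, eval_id]; simp
    exact h
  associativity A B K := by
    have h := appendIso_assoc A.seq B.seq K.seq
    rw [DiagramCategory.associator_hom, evalFunctor_map_eqToHom]
    have h' : (appendIso A.seq B.seq).hom ▷ listValue K.seq ≫
        (appendIso (A.seq ++ B.seq) K.seq).hom ≫
          eqToHom (congrArg listValue (List.append_assoc A.seq B.seq K.seq)) =
        (α_ _ _ _).hom ≫ listValue A.seq ◁ (appendIso B.seq K.seq).hom ≫
        (appendIso A.seq (B.seq ++ K.seq)).hom := by
      rw [reassoc_of% h]; simp
    exact h'
  left_unitality A := by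
    rw [DiagramCategory.leftUnitor_hom, evalFunctor_map_eqToHom]
    have h : (λ_ (listValue A.seq)).hom = (nilIso G C).inv ▷ listValue A.seq ≫
        (appendIso [] A.seq).hom := by
      rw [appendIso_nil_left]; simp
    exact h.trans (congrArg (_ ≫ ·) (Category.comp_id _).symm)
  right_unitality A := by
    rw [DiagramCategory.rightUnitor_hom, evalFunctor_map_eqToHom]
    have h : (ρ_ (listValue A.seq)).hom = listValue A.seq ◁ (nilIso G C).inv ≫
        (appendIso A.seq []).hom ≫ eqToHom (congrArg listValue (List.append_nil A.seq)) := by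
      rw [appendIso_nil_right]; simp
    exact h

instance : (evalFunctor G C).Monoidal := (evalFunctorCore G C).toMonoidal

variable (G C) in
/-- The evaluation functor as a strong monoidal functor. -/
def evalStrongMonoidalFunctor : StrongMonoidalFunctor (DiagramCategory G C) C where
  toFunctor := evalFunctor G C

theorem carries_evalFunctor {A B : List (SignedColor G C)} (D : Diagram A B)
    (f : listValue A ⟶ listValue B) (h : D.eval = f) :
    Carries (F := evalFunctor G C) (fun _ => rfl) D f := by
  subst h
  exact ((Category.id_comp _).trans (Category.comp_id _)).symm

theorem isEvaluationFunctor_eval : IsEvaluationFunctor (evalStrongMonoidalFunctor G C) where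
  obj_eq _ := rfl
  constraint_zero := rfl
  constraint_two A B := by
    have h : (appendIso A B).hom = (𝟙 (listValue A) ⊗ₘ 𝟙 (listValue B)) ≫
        (appendIso A B).hom ≫ 𝟙 _ := by simp
    exact h
  capRight X := carries_evalFunctor _ _ rfl
  capLeft X := carries_evalFunctor _ _ rfl
  cupRight X := carries_evalFunctor _ _ rfl
  cupLeft X := carries_evalFunctor _ _ rfl
  coupon A B h f := carries_evalFunctor _ _ rfl
  crossPos X Y X' ψ := carries_evalFunctor _ _ rfl
  crossNeg X Y Y' ψ := carries_evalFunctor _ _ rfl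

/-- Induction on the diagram: functoriality handles stacking, the prescribed values handle the
generators, and naturality of the prescribed constraint handles juxtaposition. -/
theorem IsEvaluationFunctor.carries_eval {F : StrongMonoidalFunctor (DiagramCategory G C) C}
    (hF : IsEvaluationFunctor F) {A B : List (SignedColor G C)} (D : Diagram A B) :
    Carries hF.obj_eq D D.eval := by
  induction D with
  | id A => dsimp only [Carries]; rw [eval_id, ofDiagram_id, CategoryTheory.Functor.map_id]; simp
  | comp D E ih ih' =>
    dsimp only [Carries] at ih ih' ⊢
    rw [ofDiagram_comp, CategoryTheory.Functor.map_comp, ih, ih', eval_comp]; simp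
  | @tensor A B A' B' D E ih ih' =>
    dsimp only [Carries] at ih ih' ⊢
    have h := Functor.LaxMonoidal.μ_natural F.toFunctor (ofDiagram D) (ofDiagram E)
    rw [hF.constraint_two, hF.constraint_two, ih, ih'] at h
    rw [ofDiagram_tensor, eval_tensor]
    have h2 : (eqToHom (hF.obj_eq A) ≫ D.eval ≫ eqToHom (hF.obj_eq B).symm) ⊗ₘ
        (eqToHom (hF.obj_eq A') ≫ E.eval ≫ eqToHom (hF.obj_eq B').symm) =
        (eqToHom (hF.obj_eq A) ⊗ₘ eqToHom (hF.obj_eq A')) ≫ (D.eval ⊗ₘ E.eval) ≫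
        (eqToHom (hF.obj_eq B).symm ⊗ₘ eqToHom (hF.obj_eq B').symm) := by simp
    have h3 : (eqToHom (hF.obj_eq B).symm ⊗ₘ eqToHom (hF.obj_eq B').symm) ≫
        (eqToHom (hF.obj_eq B) ⊗ₘ eqToHom (hF.obj_eq B')) = 𝟙 _ := by simp
    -- The cancelled factor is the monoidal constraint of `F`, an isomorphism, so its naturality
    -- square determines the image of the juxtaposition.
    rw [← cancel_epi ((eqToHom (hF.obj_eq A) ⊗ₘ eqToHom (hF.obj_eq A')) ≫
      (appendIso A A').hom ≫ eqToHom (hF.obj_eq (A ++ A')).symm)]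
    refine h.symm.trans ?_
    rw [h2]
    simp only [Category.assoc, eqToHom_trans_assoc, eqToHom_refl, Category.id_comp,
      Iso.hom_inv_id_assoc]
    rw [reassoc_of% h3]
    rfl
  | capRight X => exact hF.capRight X
  | cupRight X => exact hF.cupRight X
  | capLeft X => exact hF.capLeft X
  | cupLeft X => exact hF.cupLeft X
  | crossPos X Y X' ψ => exact hF.crossPos X Y X' ψ
  | crossNeg X Y Y' ψ => exact hF.crossNeg X Y Y' ψ
  | coupon A B h f => exact hF.coupon A B h f

/-- The oplax data `η`, `δ` of a strong monoidal functor are inverse to `ε`, `μ`, so they need not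
be compared separately. -/
theorem StrongMonoidalFunctor.ext_of_eq {D : Type*} [Category D] [MonoidalCategory D] {E : Type*}
    [Category E] [MonoidalCategory E] {F F' : StrongMonoidalFunctor D E}
    (h : F.toFunctor = F'.toFunctor)
    (hε : Functor.LaxMonoidal.ε F.toFunctor ≫ eqToHom (by rw [h]) =
      Functor.LaxMonoidal.ε F'.toFunctor)
    (hμ : ∀ X Y, Functor.LaxMonoidal.μ F.toFunctor X Y ≫ eqToHom (by rw [h]) =
      eqToHom (by rw [h]) ≫ Functor.LaxMonoidal.μ F'.toFunctor X Y) : F = F' := by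
  obtain @⟨F, i⟩ := F
  obtain @⟨F', i'⟩ := F'
  dsimp only at h hε hμ
  subst h
  simp only [eqToHom_refl, Category.comp_id, Category.id_comp] at hε hμ
  have h : i = i' := by
    apply Functor.Monoidal.ext
    · exact hε
    · funext X Y; exact hμ X Y
    · have h1 := i.η_ε
      have h2 := i'.ε_η
      calc
        i.η = i.η ≫ i'.ε ≫ i'.η := by rw [h2, Category.comp_id]
        _ = (i.η ≫ i.ε) ≫ i'.η := by rw [Category.assoc]; exact congrArg (fun t => _ ≫ t ≫ _) hε.symm
        _ = i'.η := by rw [h1, Category.id_comp]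
    · funext X Y
      have h1 := i.δ_μ X Y
      have h2 := i'.μ_δ X Y
      calc
        i.δ X Y = i.δ X Y ≫ i'.μ X Y ≫ i'.δ X Y := by rw [h2, Category.comp_id]
        _ = (i.δ X Y ≫ i.μ X Y) ≫ i'.δ X Y := by
          rw [Category.assoc]; exact congrArg (fun t => _ ≫ t ≫ _) (hμ X Y).symm
        _ = i'.δ X Y := by rw [h1, Category.id_comp]
  rw [h]

theorem IsEvaluationFunctor.eq_eval {F : StrongMonoidalFunctor (DiagramCategory G C) C}
    (hF : IsEvaluationFunctor F) : F = evalStrongMonoidalFunctor G C := by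
  have h : F.toFunctor = evalFunctor G C := by
    refine CategoryTheory.Functor.ext (fun A => hF.obj_eq A.seq) ?_
    intro A B f
    obtain ⟨D, rfl⟩ := exists_ofDiagram f
    exact hF.carries_eval D
  refine StrongMonoidalFunctor.ext_of_eq h ?_ ?_
  · exact (congrArg (· ≫ eqToHom (hF.obj_eq [])) hF.constraint_zero).trans
      (eqToHom_trans (hF.obj_eq []).symm (hF.obj_eq []))
  · intro A B
    have h1 := hF.constraint_two A.seq B.seq
    have h2 : ((eqToHom (hF.obj_eq A.seq) ⊗ₘ eqToHom (hF.obj_eq B.seq)) ≫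
        (appendIso A.seq B.seq).hom ≫ eqToHom (hF.obj_eq (A.seq ++ B.seq)).symm) ≫
        eqToHom (hF.obj_eq (A.seq ++ B.seq)) = eqToHom (congrArg₂ (· ⊗ ·) (hF.obj_eq A.seq)
          (hF.obj_eq B.seq)) ≫ (appendIso A.seq B.seq).hom := by
      have h3 : ∀ {P P' Q Q' : C} (h : P = P') (h' : Q = Q'), eqToHom h ⊗ₘ eqToHom h' =
          eqToHom (congrArg₂ (· ⊗ ·) h h') := by
        rintro P _ Q _ rfl rfl; simp
      rw [h3]; simp
    exact (congrArg (· ≫ eqToHom (hF.obj_eq (A.seq ++ B.seq))) h1).trans h2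

end EvalFunctor
end GRibbon

namespace GRibbon

open PivotalCategory GGradedCategory GCrossing GBraiding Diagram

/-! ### Curls as traces and rotated crossings as mates. -/

section Pictures

variable {G : Type w} [Group G] {C : Type u} [Category.{v} C] [MonoidalCategory C] [Preadditive C]
  [GGradedCategory G C] [GCrossing G C] [PivotalCategory C] [GBraiding G C]

theorem eval_curlLeftPos (X X' : Color G C) (ψ : X'.obj ≅ (act X.degree).obj X.obj) :
    (curlLeftPos X X' ψ).eval = traceL (crossIso X.obj X.mem ψ).hom := by
  dsimp only [curlLeftPos, traceL, Diagram.eval, listValue, tensorListAppend, tensorListCons, tensorList,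
    value_down, value_up, Color.down, Color.up, List.cons_append, List.nil_append]
  simp only [Iso.trans_hom, Iso.trans_inv, Iso.refl_hom, Iso.refl_inv, Iso.symm_hom, Iso.symm_inv,
    whiskerRightIso_hom, whiskerRightIso_inv, whiskerLeftIso_hom, whiskerLeftIso_inv]
  monoidal

theorem eval_curlLeftNeg (X X' : Color G C) (ψ : X.obj ≅ (act X'.degree).obj X'.obj) :
    (curlLeftNeg X X' ψ).eval = traceL (crossIso X'.obj X'.mem ψ).inv := by
  dsimp only [curlLeftNeg, traceL, Diagram.eval, listValue, tensorListAppend, tensorListCons, tensorList,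
    value_down, value_up, Color.down, Color.up, List.cons_append, List.nil_append]
  simp only [Iso.trans_hom, Iso.trans_inv, Iso.refl_hom, Iso.refl_inv, Iso.symm_hom, Iso.symm_inv,
    whiskerRightIso_hom, whiskerRightIso_inv, whiskerLeftIso_hom, whiskerLeftIso_inv]
  monoidal

theorem eval_curlRightPos (X X' : Color G C) (ψ : X'.obj ≅ (act X'.degree).obj X.obj) :
    (curlRightPos X X' ψ).eval = traceR (crossIso X.obj X'.mem ψ).hom := by
  dsimp only [curlRightPos, traceR, Diagram.eval, listValue, tensorListAppend, tensorListCons, tensorList,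
    value_down, value_up, Color.down, Color.up, List.cons_append, List.nil_append]
  simp only [Iso.trans_hom, Iso.trans_inv, Iso.refl_hom, Iso.refl_inv, Iso.symm_hom, Iso.symm_inv,
    whiskerRightIso_hom, whiskerRightIso_inv, whiskerLeftIso_hom, whiskerLeftIso_inv]
  monoidal

theorem eval_curlRightNeg (X X' : Color G C) (ψ : X.obj ≅ (act X.degree).obj X'.obj) :
    (curlRightNeg X X' ψ).eval = traceR (crossIso X'.obj X.mem ψ).inv := by
  dsimp only [curlRightNeg, traceR, Diagram.eval, listValue, tensorListAppend, tensorListCons, tensorList,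
    value_down, value_up, Color.down, Color.up, List.cons_append, List.nil_append]
  simp only [Iso.trans_hom, Iso.trans_inv, Iso.refl_hom, Iso.refl_inv, Iso.symm_hom, Iso.symm_inv,
    whiskerRightIso_hom, whiskerRightIso_inv, whiskerLeftIso_hom, whiskerLeftIso_inv]
  monoidal

theorem eval_crossPosUD (X Y Y' : Color G C) (ψ : Y'.obj ≅ (act X.degree).obj Y.obj) :
    (crossPosUD X Y Y' ψ).eval = rotL (crossIso Y.obj X.mem ψ).hom := by
  dsimp only [crossPosUD, rotL, Diagram.eval, listValue, tensorListAppend, tensorListCons, tensorList,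
    value_down, value_up, Color.down, Color.up, List.cons_append, List.nil_append]
  simp only [Iso.trans_hom, Iso.trans_inv, Iso.refl_hom, Iso.refl_inv, Iso.symm_hom, Iso.symm_inv,
    whiskerRightIso_hom, whiskerRightIso_inv, whiskerLeftIso_hom, whiskerLeftIso_inv]
  monoidal

theorem eval_crossNegDU (X Y X' : Color G C) (ψ : X.obj ≅ (act Y.degree).obj X'.obj) :
    (crossNegDU X Y X' ψ).eval = rotR (crossIso X'.obj Y.mem ψ).inv := by
  dsimp only [crossNegDU, rotR, Diagram.eval, listValue, tensorListAppend, tensorListCons, tensorList,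
    value_down, value_up, Color.down, Color.up, List.cons_append, List.nil_append]
  simp only [Iso.trans_hom, Iso.trans_inv, Iso.refl_hom, Iso.refl_inv, Iso.symm_hom, Iso.symm_inv,
    whiskerRightIso_hom, whiskerRightIso_inv, whiskerLeftIso_hom, whiskerLeftIso_inv]
  monoidal

theorem eval_crossPosDU (X Y Y' : Color G C) (ψ : Y.obj ≅ (act X.degree).obj Y'.obj) :
    (crossPosDU X Y Y' ψ).eval = rotR (crossIso Y'.obj X.mem ψ).hom := by
  dsimp only [crossPosDU, rotR, Diagram.eval, listValue, tensorListAppend, tensorListCons, tensorList,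
    value_down, value_up, Color.down, Color.up, List.cons_append, List.nil_append]
  simp only [Iso.trans_hom, Iso.trans_inv, Iso.refl_hom, Iso.refl_inv, Iso.symm_hom, Iso.symm_inv,
    whiskerRightIso_hom, whiskerRightIso_inv, whiskerLeftIso_hom, whiskerLeftIso_inv]
  monoidal

theorem eval_crossNegUD (X Y X' : Color G C) (ψ : X'.obj ≅ (act Y.degree).obj X.obj) :
    (crossNegUD X Y X' ψ).eval = rotL (crossIso X.obj Y.mem ψ).inv := by
  dsimp only [crossNegUD, rotL, Diagram.eval, listValue, tensorListAppend, tensorListCons, tensorList,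
    value_down, value_up, Color.down, Color.up, List.cons_append, List.nil_append]
  simp only [Iso.trans_hom, Iso.trans_inv, Iso.refl_hom, Iso.refl_inv, Iso.symm_hom, Iso.symm_inv,
    whiskerRightIso_hom, whiskerRightIso_inv, whiskerLeftIso_hom, whiskerLeftIso_inv]
  monoidal

/-- For explicit lists all list equalities in `rotate` are reflexive, so its transports disappear
and the evaluation can be unfolded. -/
theorem rotate_pair {X Y Z W : Color G C} (D : Diagram [X.down, Y.down] [Z.down, W.down]) :
    rotate D = ((Diagram.id [W.up, Z.up]).tensor ((cupRight X).comp
      (insert [X.down] [X.up] ((cupRight Y).comp (insert [Y.down] [Y.up] (Diagram.id [])))))).comp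
      (((Diagram.id [W.up, Z.up]).tensor (D.tensor
        (Diagram.id [Y.up, X.up]))).comp (Diagram.tensor (A := [W.up, Z.up, Z.down, W.down])
        ((insert [W.up] [W.down] (capRight Z)).comp ((insert [] [] (capRight W)).comp
        (Diagram.id []))) (Diagram.id [Y.up, X.up]))) := rfl

theorem rotate'_pair {X Y Z W : Color G C} (D : Diagram [X.down, Y.down] [Z.down, W.down]) :
    rotate' D = (Diagram.tensor (B := [Y.up, X.up, X.down, Y.down])
      (((Diagram.id []).comp (insert [] [] (cupLeft Y))).comp
      (insert [Y.up] [Y.down] (cupLeft X))) (Diagram.id [W.up, Z.up])).comp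
      (((Diagram.id [Y.up, X.up]).tensor (D.tensor
        (Diagram.id [W.up, Z.up]))).comp ((Diagram.id [Y.up, X.up]).tensor
        ((insert [Z.down] [Z.up] ((insert [W.down] [W.up] (Diagram.id [])).comp
          (capLeft W))).comp (capLeft Z)))) := rfl

/-- Bending two strands at once is bending them one after the other. This brings crossings of two
upward strands within reach of the rotation formulas. -/
theorem eval_rotate_pair {X Y Z W : Color G C} (D : Diagram [X.down, Y.down] [Z.down, W.down])
    (c : X.obj ⊗ Y.obj ⟶ Z.obj ⊗ W.obj) (h : D.eval = c) :
    (rotate D).eval = rotL (rotL c) := by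
  subst h
  rw [rotate_pair]
  dsimp only [Diagram.insert, rotL, Diagram.eval, listValue, tensorListAppend, tensorListCons, tensorList,
    value_down, value_up, Color.down, Color.up, List.cons_append, List.nil_append]
  simp only [Iso.trans_hom, Iso.trans_inv, Iso.refl_hom, Iso.refl_inv, Iso.symm_hom, Iso.symm_inv,
    whiskerRightIso_hom, whiskerRightIso_inv, whiskerLeftIso_hom, whiskerLeftIso_inv]
  monoidal

theorem eval_rotate'_pair {X Y Z W : Color G C} (D : Diagram [X.down, Y.down] [Z.down, W.down])
    (c : X.obj ⊗ Y.obj ⟶ Z.obj ⊗ W.obj) (h : D.eval = c) :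
    (rotate' D).eval = rotR (rotR c) := by
  subst h
  rw [rotate'_pair]
  dsimp only [Diagram.insert, rotR, Diagram.eval, listValue, tensorListAppend, tensorListCons, tensorList,
    value_down, value_up, Color.down, Color.up, List.cons_append, List.nil_append]
  simp only [Iso.trans_hom, Iso.trans_inv, Iso.refl_hom, Iso.refl_inv, Iso.symm_hom, Iso.symm_inv,
    whiskerRightIso_hom, whiskerRightIso_inv, whiskerLeftIso_hom, whiskerLeftIso_inv]
  monoidal

end Pictures
end GRibbon

namespace GRibbon

open PivotalCategory GGradedCategory GCrossing GBraiding Diagram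

/-! ### Coherence for a strand passing a list of strands. -/

section Passing

variable {C : Type u} [Category.{v} C] [MonoidalCategory C]

/-- Crossing the first strand of a list and then the remaining ones, with arbitrary objects and
splitting isomorphisms in place of list values, so that only naturality and cancellation are
involved. -/
theorem comp_tensor_id_tensor {P Q S S' T LA L₁ L₁' L₂ X A B X' B₁ : C}
    (E : P ⊗ LA ≅ S) (e : P ≅ X ⊗ A) (k₁ : S ≅ X ⊗ L₁) (k₂ : L₁ ≅ A ⊗ LA)
    (hE : E.hom = e.hom ▷ LA ≫ (α_ _ _ _).hom ≫ X ◁ k₂.inv ≫ k₁.inv)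
    (E' : Q ⊗ LA ≅ S') (e' : Q ≅ B ⊗ X') (k₁' : S' ≅ B ⊗ L₁') (k₂' : L₁' ≅ X' ⊗ LA)
    (hE' : E'.hom = e'.hom ▷ LA ≫ (α_ _ _ _).hom ≫ B ◁ k₂'.inv ≫ k₁'.inv)
    (F : B₁ ⊗ L₁' ≅ S') (s : B₁ ≅ B) (hF : F.hom = s.hom ▷ L₁' ≫ k₁'.inv)
    (F' : B₁ ⊗ L₂ ≅ T) (k : T ≅ B ⊗ L₂) (hF' : F'.hom = s.hom ▷ L₂ ≫ k.inv)
    (c : P ⟶ Q) (r : L₁' ⟶ L₂) :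
    (E.inv ≫ (c ⊗ₘ 𝟙 LA) ≫ E'.hom) ≫ (F.inv ≫ (𝟙 B₁ ⊗ₘ r) ≫ F'.hom) =
      k₁.hom ≫ X ◁ k₂.hom ≫ (α_ _ _ _).inv ≫ (e.inv ≫ c ≫ e'.hom) ▷ LA ≫ (α_ _ _ _).hom ≫
        B ◁ (k₂'.inv ≫ r) ≫ k.inv := by
  have hEi : E.inv = k₁.hom ≫ X ◁ k₂.hom ≫ (α_ _ _ _).inv ≫ e.inv ▷ LA := by
    apply Iso.inv_ext; rw [hE]; simp
  have hFi : F.inv = k₁'.hom ≫ s.inv ▷ L₁' := by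
    apply Iso.inv_ext; rw [hF]; simp
  rw [hEi, hFi, hE', hF']
  simp [← whisker_exchange_assoc]

theorem comp_tensor_slide {X Y X₁ Y₁ LA LA' LB LB' S S' T T' : C}
    (E : X₁ ⊗ LA ≅ S) (s : X₁ ≅ X) (k : S ≅ X ⊗ LA) (hE : E.hom = s.hom ▷ LA ≫ k.inv)
    (E' : X₁ ⊗ LA' ≅ S') (k' : S' ≅ X ⊗ LA') (hE' : E'.hom = s.hom ▷ LA' ≫ k'.inv)
    (F : LB ⊗ Y₁ ≅ T) (F' : LB' ⊗ Y₁ ≅ T') (t : Y₁ ≅ Y)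
    (f : LA ⟶ LA') (g : LB ⟶ LB') (p : S ⟶ T) (q : S' ⟶ T')
    (w : X ◁ f ≫ k'.inv ≫ q ≫ F'.inv ≫ LB' ◁ t.hom =
      (k.inv ≫ p ≫ F.inv ≫ LB ◁ t.hom) ≫ g ▷ Y) :
    (E.inv ≫ (𝟙 X₁ ⊗ₘ f) ≫ E'.hom) ≫ q = p ≫ (F.inv ≫ (g ⊗ₘ 𝟙 Y₁) ≫ F'.hom) := by
  have hEi : E.inv = k.hom ≫ s.inv ▷ LA := by
    apply Iso.inv_ext; rw [hE]; simp
  rw [hEi, hE', ← cancel_epi k.inv, ← cancel_mono (F'.inv ≫ LB' ◁ t.hom)]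
  calc
    _ = X ◁ f ≫ k'.inv ≫ q ≫ F'.inv ≫ LB' ◁ t.hom := by
      simp [← whisker_exchange_assoc]
    _ = _ := by
      rw [w]; simp [whisker_exchange]

end Passing

/-! ### Passing a list of strands, one strand at a time. -/

section Pass

variable {G : Type w} [Group G] {C : Type u} [Category.{v} C] [MonoidalCategory C] [Preadditive C]
  [GGradedCategory G C] [PivotalCategory C]

/-- The value of a list with two entries. -/
def pairIso (a b : SignedColor G C) : listValue [a, b] ≅ a.value ⊗ b.value := Iso.refl _

theorem consIso_pair (a b : SignedColor G C) :
    consIso a [b] = pairIso a b ≪≫ whiskerLeftIso a.value (singleIso b).symm := by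
  ext
  change 𝟙 _ = 𝟙 _ ≫ _ ◁ 𝟙 _
  rw [Category.id_comp, whiskerLeft_id]

theorem appendIso_pair (a b : SignedColor G C) (A : List (SignedColor G C)) :
    (appendIso [a, b] A).hom = (pairIso a b).hom ▷ listValue A ≫ (α_ _ _ _).hom ≫
      a.value ◁ (consIso b A).inv ≫ (consIso a (b :: A)).inv := by
  have h : (appendIso [a, b] A).hom = (consIso a [b]).hom ▷ listValue A ≫
    (α_ _ _ _).hom ≫ a.value ◁ (appendIso [b] A).hom ≫ (consIso a (b :: A)).inv := rfl
  rw [h, appendIso_single, consIso_pair]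
  simp only [Iso.trans_hom, whiskerLeftIso_hom, Iso.symm_hom, comp_whiskerRight, whiskerLeft_comp,
    Category.assoc]
  congr 1
  calc
    _ = (α_ _ _ _).hom ≫ a.value ◁ ((singleIso b).inv ≫ (singleIso b).hom) ▷ listValue A ≫
        a.value ◁ (consIso b A).inv ≫ (consIso a (b :: A)).inv := by simp
    _ = _ := by rw [Iso.inv_hom_id]; simp

/-- A morphism which carries a strand from the left to the right, in terms of the values. -/
def pass {x x' : SignedColor G C} {A B : List (SignedColor G C)}
    (f : listValue (x :: A) ⟶ listValue (B ++ [x'])) :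
    x.value ⊗ listValue A ⟶ listValue B ⊗ x'.value :=
  (consIso x A).inv ≫ f ≫ (appendIso B [x']).inv ≫ listValue B ◁ (singleIso x').hom

theorem pass_id (x : SignedColor G C) :
    pass (x := x) (x' := x) (A := []) (B := []) (𝟙 (listValue [x])) =
      x.value ◁ (nilIso G C).hom ≫ (ρ_ x.value).hom ≫ (λ_ x.value).inv ≫
        (nilIso G C).inv ▷ x.value := by
  have h : pass (x := x) (x' := x) (A := []) (B := []) (𝟙 (listValue [x])) =
    (consIso x []).inv ≫ 𝟙 (listValue [x]) ≫ (appendIso [] [x]).inv ≫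
      listValue [] ◁ (singleIso x).hom := rfl
  have h' := appendIso_nil_left_inv [x]
  rw [h, consIso_nil_inv]
  refine Eq.trans (congrArg (fun t => _ ≫ _ ≫ t ≫ _) h') ?_
  simp only [Category.assoc, Category.id_comp, ← whisker_exchange]
  simp

variable [GCrossing G C] [GBraiding G C]

theorem pass_cons {x x' x'' a b : SignedColor G C} {A B : List (SignedColor G C)}
    (c : Diagram [x, a] [b, x']) (r : Diagram (x' :: A) (B ++ [x''])) :
    pass (x := x) (x' := x'') (A := a :: A) (B := b :: B)
        (Diagram.comp (B := b :: x' :: A) (c.tensor (Diagram.id A))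
          ((Diagram.id [b]).tensor r)).eval =
      x.value ◁ (consIso a A).hom ⊗≫
        ((pairIso x a).inv ≫ c.eval ≫ (pairIso b x').hom) ▷ listValue A ⊗≫
        b.value ◁ pass r.eval ⊗≫ (consIso b B).inv ▷ x''.value := by
  have h := comp_tensor_id_tensor (appendIso [x, a] A) (pairIso x a) (consIso x (a :: A))
    (consIso a A) (appendIso_pair x a A) (appendIso [b, x'] A) (pairIso b x')
    (consIso b (x' :: A)) (consIso x' A) (appendIso_pair b x' A) (appendIso [b] (x' :: A))
    (singleIso b) (appendIso_single b _) (appendIso [b] (B ++ [x''])) (consIso b (B ++ [x'']))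
    (appendIso_single b _) c.eval r.eval
  have h' : (appendIso (b :: B) [x'']).inv = (consIso b (B ++ [x''])).hom ≫
      b.value ◁ (appendIso B [x'']).inv ≫ (α_ _ _ _).inv ≫
      (consIso b B).inv ▷ listValue [x''] := by
    apply Iso.inv_ext
    rw [appendIso_cons]
    simp
  refine Eq.trans (congrArg₂ (fun s t => (consIso x (a :: A)).inv ≫ s ≫ t ≫
    listValue (b :: B) ◁ (singleIso x'').hom) h h') ?_
  simp only [Category.assoc, Iso.inv_hom_id_assoc, pass, ← whisker_exchange]
  monoidal

/-- Every type 4 move has this shape; it reduces the move to one commutative square in `C` between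
`pass` and the coupons. -/
theorem eval_slide {x x' : SignedColor G C} {A A' B B' : List (SignedColor G C)}
    (D : Diagram A A') (E : Diagram B B') (p : Diagram (x :: A) (B ++ [x']))
    (q : Diagram (x :: A') (B' ++ [x']))
    (w : x.value ◁ D.eval ≫ pass q.eval = pass p.eval ≫ E.eval ▷ x'.value) :
    (Diagram.comp (B := x :: A') ((Diagram.id [x]).tensor D) q).eval =
      (p.comp (E.tensor (Diagram.id [x']))).eval :=
  comp_tensor_slide (appendIso [x] A) (singleIso x) (consIso x A) (appendIso_single x A)
    (appendIso [x] A') (consIso x A') (appendIso_single x A') (appendIso B [x'])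
    (appendIso B' [x']) (singleIso x') D.eval E.eval p.eval q.eval w

end Pass
end GRibbon

namespace GRibbon

open PivotalCategory GGradedCategory GCrossing GBraiding Diagram

set_option linter.unusedSectionVars false

/-! ### A strand passing below a list of strands. -/

section Under

variable {G : Type w} [Group G] {C : Type u} [Category.{v} C] [MonoidalCategory C] [Preadditive C]
  [GGradedCategory G C] [PivotalCategory C] [GCrossing G C] [GBraiding G C]

variable (G C) in
/-- The isomorphism between the empty product and its image under `φ_γ`. -/
def underNil (γ : G) :
    listValue ([] : List (SignedColor G C)) ≅ (act γ).obj (listValue ([] : List (SignedColor G C))) :=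
  nilIso G C ≪≫ Functor.Monoidal.εIso (act γ) ≪≫ (act γ).mapIso (nilIso G C).symm

/-- Joining an isomorphism for the first factor to an isomorphism for the others. -/
def underCons {γ : G} {a b : SignedColor G C} {A B : List (SignedColor G C)}
    (ψ : a.value ≅ (act γ).obj b.value) (ψ' : listValue A ≅ (act γ).obj (listValue B)) :
    listValue (a :: A) ≅ (act γ).obj (listValue (b :: B)) :=
  consIso a A ≪≫ ((ψ ⊗ᵢ ψ') ≪≫ Functor.Monoidal.μIso (act γ) b.value (listValue B)) ≪≫
    (act γ).mapIso (consIso b B).symm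

theorem crossIso_inv_transport {X X' Y Y' Z : C} {γ : G} (hZ : component γ Z) (e : X' ≅ X)
    (ψ : X ≅ (act γ).obj Y) (d : Y' ≅ Y) :
    (crossIso Y' hZ (e ≪≫ ψ ≪≫ (act γ).mapIso d.symm)).inv =
      Z ◁ e.hom ≫ (crossIso Y hZ ψ).inv ≫ d.inv ▷ Z := by
  rw [← crossIso_slide hZ ψ (ψ ≪≫ (act γ).mapIso d.symm) (𝟙 X) d.inv (by simp)]
  simp [crossIso_inv]

theorem pass_under_nil {x : SignedColor G C} {γ : G} (hx : component γ x.value) :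
    pass (x := x) (x' := x) (A := []) (B := []) (𝟙 (listValue [x])) =
      (crossIso (listValue []) hx (underNil G C γ)).inv := by
  have h : (braid (𝟙_ C) hx).inv = x.value ◁ Functor.OplaxMonoidal.η (act γ) ≫
      (ρ_ x.value).hom ≫ (λ_ x.value).inv := by
    apply Iso.inv_ext
    rw [braid_unit_left]
    simp
  rw [pass_id, underNil, crossIso_inv_transport, crossIso_inv, h]
  simp

/-- Inductive step: the tensor axiom in the first variable, in the form `cross_cross_under_inv`,
merges the first crossing with the crossing for the rest of the list. -/
theorem pass_under_cons {x a b : SignedColor G C} {A B : List (SignedColor G C)} {γ : G}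
    (hx : component γ x.value) (ψ : a.value ≅ (act γ).obj b.value)
    (ψ' : listValue A ≅ (act γ).obj (listValue B))
    (c : Diagram [x, a] [b, x]) (r : Diagram (x :: A) (B ++ [x]))
    (hc : (pairIso x a).inv ≫ c.eval ≫ (pairIso b x).hom = (crossIso b.value hx ψ).inv)
    (hr : pass r.eval = (crossIso (listValue B) hx ψ').inv) :
    pass (x := x) (x' := x) (A := a :: A) (B := b :: B)
        (Diagram.comp (B := b :: x :: A) (c.tensor (Diagram.id A))
          ((Diagram.id [b]).tensor r)).eval =
      (crossIso (listValue (b :: B)) hx (underCons ψ ψ')).inv := by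
  rw [pass_cons, hc, hr, underCons, crossIso_inv_transport, cross_cross_under_inv]
  monoidal

namespace UnderCrossings

variable {Z : Color G C}

/-- The isomorphism `ψ^ε`. -/
noncomputable def signedIso {γ : G} {X Y : C} (ψ : X ≅ (act γ).obj Y) :
    ∀ s : Bool, signedDual s X ≅ (act γ).obj (signedDual s Y)
  | true => ψ
  | false => negIso ψ

theorem signedIso_hom {γ : G} {X Y : C} (ψ : X ≅ (act γ).obj Y) (s : Bool) :
    (signedIso ψ s).hom = signedHom ψ s := by
  cases s <;> rfl

/-- The isomorphism between the products of the colors induced by the colors of the crossings. -/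
noncomputable def valueIso : ∀ {A B : List (SignedColor G C)}, UnderCrossings Z A B →
    (listValue A ≅ (act Z.degree).obj (listValue B))
  | _, _, nil => underNil G C Z.degree
  | _, _, cons (X := X) (Y := Y) s ψ r =>
      underCons (a := ⟨X, s⟩) (b := ⟨Y, s⟩) (signedIso ψ s) (valueIso r)

/-- The isomorphism between the products of the colors induced by the inverse colors of the
crossings. -/
noncomputable def barValueIso : ∀ {A B : List (SignedColor G C)}, UnderCrossings Z A B →
    (listValue B ≅ (act Z.degree⁻¹).obj (listValue A))
  | _, _, nil => underNil G C Z.degree⁻¹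
  | _, _, cons (X := X) (Y := Y) s ψ r =>
      underCons (a := ⟨Y, s⟩) (b := ⟨X, s⟩) (signedIso (barIso ψ) s) (barValueIso r)

theorem underNil_hom (γ : G) : (underNil G C γ).hom =
    𝟙 (𝟙_ C) ≫ tensorListConstraint (act γ) SignedColor.value ([] : List (SignedColor G C)) := by
  have h : (nilIso G C).hom ≫ Functor.LaxMonoidal.ε (act γ) ≫ (act γ).map (𝟙 (𝟙_ C)) =
      𝟙 (𝟙_ C) ≫ Functor.LaxMonoidal.ε (act γ) := by
    rw [CategoryTheory.Functor.map_id, Category.comp_id]; rfl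
  exact h

theorem tensorHom_comp_cons {K X A T S X' B M N : C} (k : K ⟶ X ⊗ A) (f : X ⟶ X') (g : A ⟶ T)
    (t : T ⟶ B) (e : S ≅ X' ⊗ T) (m : X' ⊗ B ⟶ M) (n : M ⟶ N) :
    k ≫ ((f ⊗ₘ (g ≫ t)) ≫ m) ≫ n = (k ≫ (f ⊗ₘ g) ≫ e.inv) ≫ e.hom ≫ X' ◁ t ≫ m ≫ n := by
  simp [MonoidalCategory.tensorHom_def]

theorem underCons_hom {γ : G} {a b : SignedColor G C} {A B : List (SignedColor G C)}
    (ψ : a.value ≅ (act γ).obj b.value) (ψ' : listValue A ≅ (act γ).obj (listValue B))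
    (f : a.value ⟶ (act γ).obj b.value) (hf : ψ.hom = f)
    (g : listValue A ⟶ tensorList (fun b => (act γ).obj (SignedColor.value b)) B)
    (hg : ψ'.hom = g ≫ tensorListConstraint (act γ) SignedColor.value B) :
    (underCons ψ ψ').hom =
      ((consIso a A).hom ≫ (f ⊗ₘ g) ≫
        (tensorListCons (fun b => (act γ).obj (SignedColor.value b)) b B).inv) ≫
      tensorListConstraint (act γ) SignedColor.value (b :: B) := by
  subst hf
  exact (congrArg (fun t => (consIso a A).hom ≫ ((ψ.hom ⊗ₘ t) ≫ Functor.LaxMonoidal.μ (act γ) b.value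
    (listValue B)) ≫ (act γ).map (consIso b B).inv) hg).trans
    (tensorHom_comp_cons _ _ _ _ (tensorListCons (fun b => (act γ).obj (SignedColor.value b)) b B)
      _ _)

/-- Matches the color produced by merging crossings, which interleaves the constraints of `φ_{|Z|}`
with the `ψᵢ`, with the condition of the move, which applies the `n`-fold constraint at the end. -/
theorem valueIso_hom {A B : List (SignedColor G C)} (p : UnderCrossings Z A B) :
    p.valueIso.hom = p.value ≫ tensorListConstraint (act Z.degree) SignedColor.value B := by
  induction p with
  | nil => exact underNil_hom _
  | cons s ψ r ih => exact underCons_hom _ _ _ (signedIso_hom ψ s) _ ih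

theorem barValueIso_hom {A B : List (SignedColor G C)} (p : UnderCrossings Z A B) :
    p.barValueIso.hom =
      p.barValue ≫ tensorListConstraint (act Z.degree⁻¹) SignedColor.value A := by
  induction p with
  | nil => exact underNil_hom _
  | cons s ψ r ih => exact underCons_hom _ _ _ (signedIso_hom (barIso ψ) s) _ ih

theorem eval_crossDown [PivotalCrossing G C] {X Y : Color G C}
    (ψ : X.obj ≅ (act Z.degree).obj Y.obj) :
    ∀ s : Bool, (pairIso Z.down ⟨X, s⟩).inv ≫ (crossDown ψ s).eval ≫ (pairIso ⟨Y, s⟩ Z.down).hom =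
      (crossIso (SignedColor.value ⟨Y, s⟩) (Z := Z.down.value) Z.mem (signedIso ψ s)).inv
  | true => (Category.id_comp _).trans (Category.comp_id _)
  | false => ((Category.id_comp _).trans (Category.comp_id _)).trans
      ((eval_crossPosDU Z X Y ψ).trans (rotR_crossIso_hom Y.obj Z.mem ψ))

theorem pass_diagramDown [PivotalCrossing G C] {A B : List (SignedColor G C)}
    (p : UnderCrossings Z A B) : pass p.diagramDown.eval =
      (crossIso (listValue B) (Z := Z.down.value) Z.mem p.valueIso).inv := by
  induction p with
  | nil => exact pass_under_nil (x := Z.down) Z.mem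
  | cons s ψ r ih => exact pass_under_cons (x := Z.down) Z.mem _ _ _ _ (eval_crossDown ψ s) ih

variable [PivotalGGradedCategory G C] [PivotalCrossing G C]

theorem eval_crossUp {X Y : Color G C} (ψ : X.obj ≅ (act Z.degree).obj Y.obj) :
    ∀ s : Bool, (pairIso Z.up ⟨Y, s⟩).inv ≫ (crossUp ψ s).eval ≫ (pairIso ⟨X, s⟩ Z.up).hom =
      (crossIso (SignedColor.value ⟨X, s⟩) (Z := Z.up.value)
        (PivotalGGradedCategory.dual_mem Z.mem) (signedIso (barIso ψ) s)).inv
  | true => ((Category.id_comp _).trans (Category.comp_id _)).trans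
      ((eval_crossPosUD Z Y X ψ).trans (rotL_crossIso_hom Y.obj Z.mem _ ψ))
  | false => ((Category.id_comp _).trans (Category.comp_id _)).trans
      -- The picture is defined with `rotate`, but rotating the other way dualizes the strand `Z`
      -- first and then the other one, producing `(ψ̄)^-`, the color required by `barValue`.
      ((eval_rotate_eq (crossNeg Z X Y ψ)).trans
        ((eval_rotate'_pair (crossNeg Z X Y ψ) _ rfl).trans
          ((congrArg rotR (rotR_crossIso_inv Y.obj Z.mem
            (PivotalGGradedCategory.dual_mem Z.mem) ψ)).trans
            (rotR_crossIso_hom X.obj (PivotalGGradedCategory.dual_mem Z.mem) (barIso ψ)))))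

theorem pass_diagramUp {A B : List (SignedColor G C)} (p : UnderCrossings Z A B) :
    pass p.diagramUp.eval = (crossIso (listValue A) (Z := Z.up.value)
      (PivotalGGradedCategory.dual_mem Z.mem) p.barValueIso).inv := by
  induction p with
  | nil => exact pass_under_nil (x := Z.up) (PivotalGGradedCategory.dual_mem Z.mem)
  | cons s ψ r ih =>
    exact pass_under_cons (x := Z.up) (PivotalGGradedCategory.dual_mem Z.mem) _ _ _ _
      (eval_crossUp ψ s) ih

end UnderCrossings

end Under
end GRibbon

namespace GRibbon

open PivotalCategory GGradedCategory GCrossing GBraiding Diagram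

/-! ### Compatibility of the passage from ψ to ψ⁻ with the constraints of the crossing. -/

section NegIso

variable {G : Type w} [Group G] {C : Type u} [Category.{v} C] [MonoidalCategory C] [Preadditive C]
  [GGradedCategory G C] [GCrossing G C]

theorem actMulIso_tensor {α β γ : G} (h : β * α = γ) (X Y : C) :
    ((actMulIso α β γ h X).hom ⊗ₘ (actMulIso α β γ h Y).hom) ≫
        Functor.LaxMonoidal.μ (act γ) X Y =
      Functor.LaxMonoidal.μ (act α) _ _ ≫ (act α).map (Functor.LaxMonoidal.μ (act β) X Y) ≫
        (actMulIso α β γ h (X ⊗ Y)).hom := by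
  subst h
  have := actMul_isMonoidal (C := C) α β
  have h := NatTrans.IsMonoidal.tensor (τ := (actMul α β).hom) X Y
  simp only [actMulIso, Iso.trans_hom, eqToIso_refl, Iso.refl_hom, Category.comp_id, Iso.app_hom]
  rw [← h]
  simp [Functor.LaxMonoidal.comp_μ]

theorem actMulIso_unit {α β γ : G} (h : β * α = γ) :
    Functor.LaxMonoidal.ε (act (C := C) α) ≫
        (act α).map (Functor.LaxMonoidal.ε (act (C := C) β)) ≫ (actMulIso α β γ h (𝟙_ C)).hom =
      Functor.LaxMonoidal.ε (act γ) := by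
  subst h
  have := actMul_isMonoidal (C := C) α β
  have h := NatTrans.IsMonoidal.unit (τ := (actMul (C := C) α β).hom)
  simp only [actMulIso, Iso.trans_hom, eqToIso_refl, Iso.refl_hom, Category.comp_id, Iso.app_hom]
  rw [← h]
  simp [Functor.LaxMonoidal.comp_ε]

theorem actMulIso_natural {α β γ : G} (h : β * α = γ) {X Y : C} (f : X ⟶ Y) :
    (act α).map ((act β).map f) ≫ (actMulIso α β γ h Y).hom =
      (actMulIso α β γ h X).hom ≫ (act γ).map f := by
  subst h
  simpa [actMulIso] using (actMul α β).hom.naturality f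

variable [PivotalCategory C]

theorem negIso_ev {γ : G} {X Y : C} (ψ : X ≅ (act γ).obj Y) :
    ((negIso ψ).hom ⊗ₘ ψ.hom) ≫ Functor.LaxMonoidal.μ (act γ) (dual Y) Y ≫
      (act γ).map (ev Y) = ev X ≫ Functor.LaxMonoidal.ε (act γ) := by
  have h := leftComparison_ev (act γ) Y
  have h2 : (negIso ψ).hom ≫ leftComparison (act γ) Y = dualMap ψ.inv := by
    have h3 : (negIso ψ).hom ≫ (comparisonIso (act γ) Y).hom = dualMap ψ.inv := by
      rw [negIso, Iso.trans_hom, Category.assoc, Iso.symm_hom, Iso.inv_hom_id, Category.comp_id]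
      rfl
    exact h3
  rw [← cancel_mono (Functor.OplaxMonoidal.η (act γ)), Category.assoc, Category.assoc,
    Category.assoc, Functor.Monoidal.ε_η, Category.comp_id, ← h, tensorHom_def',
    Category.assoc, ← comp_whiskerRight_assoc, h2, dualMap_ev, ← whiskerLeft_comp_assoc,
    ψ.hom_inv_id]
  simp

/-- A morphism into `φ_γ(Y^*)` is determined by its pairing with `ψ` through the image of the cap,
because `φ_γ(Y^*) ≅ φ_γ(Y)^*`. This uniqueness gives the two compatibilities below. -/
theorem eq_negIso_hom {γ : G} {X Y : C} (ψ : X ≅ (act γ).obj Y)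
    (n : dual X ⟶ (act γ).obj (dual Y))
    (h : (n ⊗ₘ ψ.hom) ≫ Functor.LaxMonoidal.μ (act γ) (dual Y) Y ≫
      (act γ).map (ev Y) = ev X ≫ Functor.LaxMonoidal.ε (act γ)) : n = (negIso ψ).hom := by
  rw [← negIso_ev ψ, tensorHom_def', tensorHom_def', Category.assoc, Category.assoc,
    ← whiskerLeftIso_hom, Iso.cancel_iso_hom_left] at h
  replace h := congrArg (· ≫ Functor.OplaxMonoidal.η (act γ)) h
  simp only [Category.assoc] at h
  rw [← leftComparison_ev, ← comp_whiskerRight_assoc, ← comp_whiskerRight_assoc] at h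
  have h' := hom_ext_dual h
  have : IsIso (leftComparison (act γ) Y) := isIso_leftComparison _ _
  rwa [cancel_mono] at h'

theorem negIso_actOneIso (X : C) : negIso (actOneIso G X) = actOneIso G (dual X) := by
  symm
  ext
  apply eq_negIso_hom
  have := actOne_isMonoidal (G := G) (C := C)
  have h := NatTrans.IsMonoidal.tensor (τ := (actOne (G := G) (C := C)).hom) (dual X) X
  have h2 := NatTrans.IsMonoidal.unit (τ := (actOne (G := G) (C := C)).hom)
  have h3 := (actOne (G := G) (C := C)).hom.naturality (ev X)
  simp [Functor.LaxMonoidal.id_μ, Functor.LaxMonoidal.id_ε] at h h2 h3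
  simp only [actOneIso, Iso.app_hom]
  rw [← reassoc_of% h, ← h3, h2]

/-- The right side satisfies the characterizing property: `φ_2` is monoidal and natural, so the
pairing for the composite is computed by applying `negIso_ev` to `ψ` and then to `ψ'`. -/
theorem negIso_trans {α β γ : G} (h : β * α = γ) {X X' X'' : C} (ψ : X' ≅ (act β).obj X)
    (ψ' : X'' ≅ (act α).obj X') :
    negIso (ψ' ≪≫ (act α).mapIso ψ ≪≫ actMulIso α β γ h X) =
      negIso ψ' ≪≫ (act α).mapIso (negIso ψ) ≪≫ actMulIso α β γ h (dual X) := by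
  symm
  ext
  apply eq_negIso_hom
  simp only [Iso.trans_hom, Functor.mapIso_hom]
  calc
    _ = ((negIso ψ').hom ⊗ₘ ψ'.hom) ≫ ((act α).map (negIso ψ).hom ⊗ₘ (act α).map ψ.hom) ≫
        (((actMulIso α β γ h (dual X)).hom ⊗ₘ (actMulIso α β γ h X).hom) ≫
        Functor.LaxMonoidal.μ (act γ) (dual X) X) ≫ (act γ).map (ev X) := by simp
    _ = ((negIso ψ').hom ⊗ₘ ψ'.hom) ≫ Functor.LaxMonoidal.μ (act α) _ _ ≫
        (act α).map (((negIso ψ).hom ⊗ₘ ψ.hom) ≫ Functor.LaxMonoidal.μ (act β) (dual X) X ≫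
        (act β).map (ev X)) ≫ (actMulIso α β γ h (𝟙_ C)).hom := by
      rw [actMulIso_tensor]
      simp only [Category.assoc, ← actMulIso_natural, Functor.LaxMonoidal.μ_natural_assoc,
        CategoryTheory.Functor.map_comp]
    _ = (((negIso ψ').hom ⊗ₘ ψ'.hom) ≫ Functor.LaxMonoidal.μ (act α) _ _ ≫
        (act α).map (ev X')) ≫
        (act α).map (Functor.LaxMonoidal.ε (act β)) ≫ (actMulIso α β γ h (𝟙_ C)).hom := by
      rw [negIso_ev]; simp
    _ = _ := by rw [negIso_ev, Category.assoc, actMulIso_unit]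

end NegIso

set_option linter.unusedSectionVars false

/-! ### A strand passing above a list of strands. -/

section Over

variable {G : Type w} [Group G] {C : Type u} [Category.{v} C] [MonoidalCategory C] [Preadditive C]
  [GGradedCategory G C] [PivotalCategory C] [GCrossing G C] [GBraiding G C]

theorem pass_over_nil {x : SignedColor G C} (h : component (1 : G) (listValue (G := G) (C := C) [])) :
    pass (x := x) (x' := x) (A := []) (B := []) (𝟙 (listValue [x])) =
      (crossIso x.value h (actOneIso G x.value)).hom := by
  have hn : component (1 : G) (𝟙_ C) := unit_mem
  rw [pass_id, ← cancel_mono ((nilIso G C).hom ▷ x.value),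
    ← crossIso_natural x.value h hn (actOneIso G x.value) (nilIso G C).hom, crossIso_hom,
    braid_unit_right]
  simp only [Category.assoc, ← whiskerLeft_comp, Iso.hom_inv_id, ← comp_whiskerRight,
    Iso.inv_hom_id]
  simp

/-- Inductive step: `cross_cross`, the tensor axiom in the second variable, merges the crossings.
The color of the merged crossing is the recursion step of `OverCrossings.value`. -/
theorem pass_over_cons {x x' x'' a : SignedColor G C} {A : List (SignedColor G C)} {α β δ : G}
    (ha : component α a.value) (hA : component β (listValue A)) (h : α * β = δ)
    (hd : component δ (listValue (a :: A))) (ψ : x'.value ≅ (act α).obj x.value)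
    (ψ' : x''.value ≅ (act β).obj x'.value)
    (c : Diagram [x, a] [a, x']) (r : Diagram (x' :: A) (A ++ [x'']))
    (hc : (pairIso x a).inv ≫ c.eval ≫ (pairIso a x').hom = (crossIso x.value ha ψ).hom)
    (hr : pass r.eval = (crossIso x'.value hA ψ').hom) :
    pass (x := x) (x' := x'') (A := a :: A) (B := a :: A)
        (Diagram.comp (B := a :: x' :: A) (c.tensor (Diagram.id A))
          ((Diagram.id [a]).tensor r)).eval =
      (crossIso x.value hd (ψ' ≪≫ (act β).mapIso ψ ≪≫ actMulIso β α δ h x.value)).hom := by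
  have hp : component δ (a.value ⊗ listValue A) := h ▸ tensor_mem ha hA
  rw [pass_cons, hc, hr]
  calc
    _ = x.value ◁ (consIso a A).hom ≫ (𝟙 _ ⊗≫ (crossIso x.value ha ψ).hom ▷ listValue A ⊗≫
        a.value ◁ (crossIso x'.value hA ψ').hom ⊗≫ 𝟙 _) ≫ (consIso a A).inv ▷ x''.value := by
      monoidal
    _ = _ := by
      rw [cross_cross ha hA h hp, crossIso_natural_assoc x.value hd hp, ← comp_whiskerRight,
        Iso.hom_inv_id]
      simp

theorem signedValue_mem [PivotalGGradedCategory G C] :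
    ∀ a : SignedColor G C, component a.degree a.value
  | ⟨X, true⟩ => X.mem
  | ⟨X, false⟩ => PivotalGGradedCategory.dual_mem X.mem

theorem listValue_mem [PivotalGGradedCategory G C] :
    ∀ A : List (SignedColor G C), component (listDegree A) (listValue A)
  | [] => unit_mem
  | [a] => by
    have h : listDegree [a] = a.degree := by simp [listDegree]
    rw [h]
    exact signedValue_mem a
  | a :: b :: A => tensor_mem (signedValue_mem a) (listValue_mem (b :: A))

namespace OverCrossings

/-- The isomorphism between the colors induced by the colors of the crossings. -/
def valueIso : ∀ {X X' : Color G C} {A : List (SignedColor G C)}, OverCrossings X A X' →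
    (X'.obj ≅ (act (listDegree A)).obj X.obj)
  | _, _, _, nil X => actOneIso G X.obj
  | _, _, _, consPos (X := X) (Y := Y) ψ (A := A) r =>
      valueIso r ≪≫ (act (listDegree A)).mapIso ψ ≪≫
        actMulIso (listDegree A) Y.degree (listDegree (Y.down :: A)) rfl X.obj
  | _, _, _, consNeg (X := X) (Y := Y) ψ (A := A) r =>
      valueIso r ≪≫ (act (listDegree A)).mapIso (barIso ψ) ≪≫
        actMulIso (listDegree A) Y.degree⁻¹ (listDegree (Y.up :: A)) rfl X.obj

theorem valueIso_hom {X X' : Color G C} {A : List (SignedColor G C)} (p : OverCrossings X A X') :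
    p.valueIso.hom = p.value := by
  induction p with
  | nil => rfl
  | consPos ψ r ih => exact congrArg (· ≫ _) ih
  | consNeg ψ r ih => exact congrArg (· ≫ _) ih

variable [PivotalGGradedCategory G C]

theorem pass_diagramDown {X X' : Color G C} {A : List (SignedColor G C)}
    (p : OverCrossings X A X') : pass p.diagramDown.eval =
      (crossIso X.down.value (X := X'.down.value) (listValue_mem A) p.valueIso).hom := by
  induction p with
  | nil X => exact pass_over_nil (x := X.down) unit_mem
  | @consPos X X' X'' Y ψ A r ih =>
    exact pass_over_cons (x := X.down) (x' := X'.down) (x'' := X''.down) (a := Y.down)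
      (signedValue_mem _) (listValue_mem _) rfl (listValue_mem (Y.down :: A)) ψ r.valueIso
      (crossPos _ _ _ ψ) r.diagramDown ((Category.id_comp _).trans (Category.comp_id _)) ih
  | @consNeg X X' X'' Y ψ A r ih =>
    exact pass_over_cons (x := X.down) (x' := X'.down) (x'' := X''.down) (a := Y.up)
      (signedValue_mem _) (listValue_mem _) rfl (listValue_mem (Y.up :: A)) (barIso ψ) r.valueIso
      (crossNegDU _ _ _ ψ) r.diagramDown (((Category.id_comp _).trans (Category.comp_id _)).trans
        ((eval_crossNegDU _ _ _ ψ).trans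
          (rotR_crossIso_inv _ _ (PivotalGGradedCategory.dual_mem Y.mem) ψ))) ih

/-- For the upward strand every step color is some `(·)^-`. By `negIso_trans` these compose to
`(·)^-` of the downward color, so both directions of the strand have the same compatibility
condition. -/
theorem pass_diagramUp {X X' : Color G C} {A : List (SignedColor G C)}
    (p : OverCrossings X A X') : pass p.diagramUp.eval =
      (crossIso X.up.value (X := X'.up.value) (listValue_mem A) (negIso p.valueIso)).hom := by
  induction p with
  | nil X =>
    exact (pass_over_nil (x := X.up) unit_mem).trans (congrArg (fun t =>
      (crossIso (dual X.obj) (listValue_mem []) t).hom) (negIso_actOneIso X.obj).symm)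
  | @consPos X X' X'' Y ψ A r ih =>
    exact (pass_over_cons (x := X.up) (x' := X'.up) (x'' := X''.up) (a := Y.down)
      (signedValue_mem _) (listValue_mem _) rfl (listValue_mem (Y.down :: A)) (negIso ψ) (negIso r.valueIso)
      (crossNegUD _ _ _ ψ) r.diagramUp (((Category.id_comp _).trans (Category.comp_id _)).trans
        ((eval_crossNegUD _ _ _ ψ).trans (rotL_crossIso_inv _ _ ψ))) ih).trans
      (congrArg (fun t => (crossIso (dual X.obj) (listValue_mem (Y.down :: A)) t).hom)
        (negIso_trans _ _ _).symm)
  | @consNeg X X' X'' Y ψ A r ih =>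
    exact (pass_over_cons (x := X.up) (x' := X'.up) (x'' := X''.up) (a := Y.up)
      (signedValue_mem _) (listValue_mem _) rfl (listValue_mem (Y.up :: A)) (negIso (barIso ψ))
      (negIso r.valueIso) (crossPosUU _ _ _ ψ) r.diagramUp
      (((Category.id_comp _).trans (Category.comp_id _)).trans
        ((eval_rotate_pair _ _ rfl).trans
          ((congrArg rotL (rotL_crossIso_hom _ _ (PivotalGGradedCategory.dual_mem Y.mem) ψ)).trans
            (rotL_crossIso_inv _ _ _)))) ih).trans
      (congrArg (fun t => (crossIso (dual X.obj) (listValue_mem (Y.up :: A)) t).hom)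
        (negIso_trans _ _ _).symm)

end OverCrossings

end Over
end GRibbon

namespace GRibbon

open PivotalCategory GGradedCategory GCrossing GBraiding Diagram

set_option linter.unusedSectionVars false

/-! ### Invariance under the local moves. -/

section Moves

variable {G : Type w} [Group G] {C : Type u} [Category.{v} C] [MonoidalCategory C] [Preadditive C]
  [GGradedCategory G C] [PivotalCategory C] [GCrossing G C]

/-- The object `φ_{|X|}(X')` has degree `|X|⁻¹|X'||X|`, and an isomorphism between objects of
different degrees is zero, which is impossible for a non-zero `X`. So conjugation by `|X|` carries
`|X'|` to `|X|`, and the degrees agree. -/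
theorem Color.degree_eq (X X' : Color G C) (ψ : X.obj ≅ (act X.degree).obj X'.obj) :
    X'.degree = X.degree := by
  by_contra h
  refine X.not_isZero ((Limits.IsZero.iff_id_eq_zero _).2 ?_)
  rw [← ψ.hom_inv_id, hom_eq_zero X.mem (act_mem X.degree X'.mem) ?_ ψ.hom, Limits.zero_comp]
  intro h'
  apply h
  rw [mul_assoc, eq_inv_mul_iff_mul_eq, mul_left_inj] at h'
  exact h'.symm

variable [GBraiding G C]

/-- Naturality in the lower strand, when the degrees of source and target of the coupon are equal
only propositionally. -/
theorem crossIso_slide_over {X X' Y Y' : C} {β β' : G} (hβ : β = β') (hY : component β Y)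
    (hY' : component β' Y') (ψ : X' ≅ (act β).obj X) (ψ' : X' ≅ (act β').obj X)
    (w : ψ.hom ≫ eqToHom (by rw [hβ]) = ψ'.hom) (f : Y ⟶ Y') :
    X ◁ f ≫ (crossIso X hY' ψ').hom = (crossIso X hY ψ).hom ≫ f ▷ X' := by
  subst hβ
  have h : ψ = ψ' := by ext; simpa using w
  rw [h, crossIso_natural]

theorem crossIso_slide_over_neg {X X' Y Y' : C} {β β' : G} (hβ : β = β') (hY : component β Y)
    (hY' : component β' Y') (ψ : X' ≅ (act β).obj X) (ψ' : X' ≅ (act β').obj X)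
    (w : ψ.hom ≫ eqToHom (by rw [hβ]) = ψ'.hom) (f : Y ⟶ Y') :
    dual X ◁ f ≫ (crossIso (dual X) hY' (negIso ψ')).hom =
      (crossIso (dual X) hY (negIso ψ)).hom ≫ f ▷ dual X' := by
  subst hβ
  have h : ψ = ψ' := by ext; simpa using w
  rw [h, crossIso_natural]

theorem eval_crossPos_triple_left (X Y Z X' X'' Y' : Color G C)
    (a : X'.obj ≅ (act Y.degree).obj X.obj) (b : X''.obj ≅ (act Z.degree).obj X'.obj)
    (c : Y'.obj ≅ (act Z.degree).obj Y.obj) :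
    (((crossPos X Y X' a).tensor (Diagram.id [Z.down])).comp
          (((Diagram.id [Y.down]).tensor (crossPos X' Z X'' b)).comp
            ((crossPos Y Z Y' c).tensor (Diagram.id [X''.down])))).eval =
      𝟙 (X.obj ⊗ (Y.obj ⊗ Z.obj)) ⊗≫ (crossIso X.obj Y.mem a).hom ▷ Z.obj ⊗≫
        Y.obj ◁ (crossIso X'.obj Z.mem b).hom ⊗≫
        (crossIso Y.obj Z.mem c).hom ▷ X''.obj ⊗≫ 𝟙 (Z.obj ⊗ (Y'.obj ⊗ X''.obj)) := by
  dsimp only [Diagram.eval, listValue, tensorListAppend, tensorListCons, tensorList,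
    value_down, value_up, Color.down, Color.up, List.cons_append, List.nil_append]
  simp only [Iso.trans_hom, Iso.trans_inv, Iso.refl_hom, Iso.refl_inv, Iso.symm_hom, Iso.symm_inv,
    whiskerRightIso_hom, whiskerRightIso_inv, whiskerLeftIso_hom, whiskerLeftIso_inv]
  monoidal

theorem eval_crossPos_triple_right (X Y Z X'' Xt Y' : Color G C)
    (c : Y'.obj ≅ (act Z.degree).obj Y.obj) (a' : Xt.obj ≅ (act Z.degree).obj X.obj)
    (b' : X''.obj ≅ (act Y'.degree).obj Xt.obj) :
    (((Diagram.id [X.down]).tensor (crossPos Y Z Y' c)).comp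
          (((crossPos X Z Xt a').tensor (Diagram.id [Y'.down])).comp
            ((Diagram.id [Z.down]).tensor (crossPos Xt Y' X'' b')))).eval =
      X.obj ◁ (crossIso Y.obj Z.mem c).hom ⊗≫ (crossIso X.obj Z.mem a').hom ▷ Y'.obj ⊗≫
        Z.obj ◁ (crossIso Xt.obj Y'.mem b').hom ⊗≫ 𝟙 (Z.obj ⊗ (Y'.obj ⊗ X''.obj)) := by
  dsimp only [Diagram.eval, listValue, tensorListAppend, tensorListCons, tensorList,
    value_down, value_up, Color.down, Color.up, List.cons_append, List.nil_append]
  simp only [Iso.trans_hom, Iso.trans_inv, Iso.refl_hom, Iso.refl_inv, Iso.symm_hom, Iso.symm_inv,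
    whiskerRightIso_hom, whiskerRightIso_inv, whiskerLeftIso_hom, whiskerLeftIso_inv]
  monoidal

variable [PivotalGGradedCategory G C] [GRibbonCategory G C]

theorem LocalReidemeister.eval_eq {A B : List (SignedColor G C)} {T T' : Diagram A B}
    (h : LocalReidemeister T T') : T.eval = T'.eval := by
  cases h with
  | type1a X X' ψ =>
    exact ((congrArg₂ (· ≫ ·) (eval_curlLeftPos X X' ψ) (eval_curlLeftNeg X' X ψ)).trans
      (traceL_traceL_inv X.mem ψ)).symm
  | type1b X X' ψ =>
    exact ((congrArg₂ (· ≫ ·) (eval_curlLeftNeg X X' ψ) (eval_curlLeftPos X' X ψ)).trans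
      (traceL_inv_traceL X'.mem ψ)).symm
  | type1c X X' ψ =>
    -- The crossings of the right curls have `X` as lower strand. The trace identities are stated
    -- for left curls, where the lower strand is `X'`, so both colors must lie in the same
    -- component.
    have hX' : component X.degree X'.obj := Color.degree_eq X X' ψ ▸ X'.mem
    refine ((congrArg₂ (· ≫ ·) (eval_curlRightNeg X X' ψ) (eval_curlRightPos X' X ψ)).trans
      ?_).symm
    refine Eq.trans (congrArg₂ (· ≫ ·) (traceR_inv_eq_traceL_inv hX' X.mem ψ)
      (traceR_eq_traceL hX' X.mem ψ)) (traceL_inv_traceL hX' ψ)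
  | type1d X X' ψ =>
    have hX : component X'.degree X.obj := Color.degree_eq X' X ψ ▸ X.mem
    refine ((congrArg₂ (· ≫ ·) (eval_curlRightPos X X' ψ) (eval_curlRightNeg X' X ψ)).trans
      ?_).symm
    refine Eq.trans (congrArg₂ (· ≫ ·) (traceR_eq_traceL hX X'.mem ψ)
      (traceR_inv_eq_traceL_inv hX X'.mem ψ)) (traceL_traceL_inv hX ψ)
  | type2a X Y Y' ψ => exact (crossIso Y'.obj X.mem ψ).inv_hom_id.symm
  | type2b X Y X' ψ => exact (crossIso X.obj Y.mem ψ).hom_inv_id.symm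
  | type2c X Y Y' ψ =>
    exact ((congrArg₂ (· ≫ ·) (eval_crossPosUD X Y Y' ψ) (eval_crossNegDU Y' X Y ψ)).trans
      (rotL_crossIso_hom_rotR Y.obj X.mem (PivotalGGradedCategory.dual_mem X.mem) ψ)).symm
  | type2d X Y Y' ψ =>
    exact ((congrArg₂ (· ≫ ·) ((eval_crossPosDU X Y Y' ψ).trans (rotR_crossIso_hom _ _ _))
      ((eval_crossNegUD Y' X Y ψ).trans (rotL_crossIso_inv _ _ _))).trans
      (Iso.inv_hom_id _)).symm
  | type3 X Y Z X' X'' Xt Y' a b c a' b' h w =>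
    exact (eval_crossPos_triple_left X Y Z X' X'' Y' a b c).trans
      ((yang_baxter Y.mem Z.mem Y'.mem a b c a' b' h w).trans
        (eval_crossPos_triple_right X Y Z X'' Xt Y' c a' b').symm)
  | type4a Z p q h₀ h₁ f₀ f₁ w =>
    refine eval_slide (x := Z.down) (x' := Z.down) _ _ _ _ ?_
    rw [p.pass_diagramDown, q.pass_diagramDown]
    -- The strand is behind the coupon, so naturality of the braiding in the first variable applies.
    -- The coupon color changes through `φ_{|Z|}`, which is what the condition of the move
    -- expresses.
    refine crossIso_slide (Z := Z.down.value) Z.mem _ _ f₀ f₁ ?_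
    rw [p.valueIso_hom, q.valueIso_hom]
    exact w.trans (Category.assoc _ _ _).symm
  | type4b Z p q h₀ h₁ f₀ f₁ w =>
    refine eval_slide (x := Z.up) (x' := Z.up) _ _ _ _ ?_
    rw [p.pass_diagramUp, q.pass_diagramUp]
    refine crossIso_slide (Z := Z.up.value) (PivotalGGradedCategory.dual_mem Z.mem) _ _ f₀ f₁ ?_
    rw [p.barValueIso_hom, q.barValueIso_hom]
    exact w.trans (Category.assoc _ _ _).symm
  | type4c X X' p q h f w =>
    refine eval_slide (x := X.down) (x' := X'.down) _ _ _ _ ?_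
    rw [p.pass_diagramDown, q.pass_diagramDown]
    rw [← p.valueIso_hom, ← q.valueIso_hom] at w
    exact crossIso_slide_over (X := X.obj) (X' := X'.obj) h (listValue_mem _) (listValue_mem _)
      _ _ w f
  | type4d X X' p q h f w =>
    refine eval_slide (x := X.up) (x' := X'.up) _ _ _ _ ?_
    rw [p.pass_diagramUp, q.pass_diagramUp]
    rw [← p.valueIso_hom, ← q.valueIso_hom] at w
    exact crossIso_slide_over_neg (X := X.obj) (X' := X'.obj) h (listValue_mem _)
      (listValue_mem _) _ _ w f

theorem LocalStabilization.eval_eq {A B : List (SignedColor G C)} {T T' : Diagram A B}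
    (h : LocalStabilization T T') : T.eval = T'.eval := by
  cases h with
  | stabilization X => rfl

/-- Outside the disk nothing changes, and the value of an inserted local picture depends only on the
value of that picture. -/
theorem Transforms.eval_eq
    {R : ∀ {A B : List (SignedColor G C)}, Diagram A B → Diagram A B → Prop}
    (hR : ∀ {A B : List (SignedColor G C)} {T T' : Diagram A B}, R T T' → T.eval = T'.eval)
    {A B : List (SignedColor G C)} {D E : Diagram A B} (h : Transforms R D E) :
    D.eval = E.eval := by
  obtain ⟨L, N, T, T', hT, K, M, hD, hE⟩ := h
  rw [hD.eval_eq, hE.eval_eq, eval_comp, eval_comp, eval_comp, eval_comp, eval_insert,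
    eval_insert, hR hT]

theorem ReidemeisterMove.eval_eq {A B : List (SignedColor G C)} {D E : Diagram A B}
    (h : ReidemeisterMove D E) : D.eval = E.eval :=
  h.elim (fun h => h.eval_eq LocalReidemeister.eval_eq)
    (fun h => (h.eval_eq LocalReidemeister.eval_eq).symm)

theorem Stabilization.eval_eq {A B : List (SignedColor G C)} {D E : Diagram A B}
    (h : Stabilization D E) : D.eval = E.eval :=
  Transforms.eval_eq LocalStabilization.eval_eq h

end Moves
end GRibbon

theorem mainTheorem2 {G : Type w} [Group G] {k : Type*} [CommRing k]
    {C : Type u} [Category.{v} C] [MonoidalCategory C] [Preadditive C] [Linear k C]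
    [MonoidalPreadditive C] [MonoidalLinear k C] [PivotalCategory C] [GGradedCategory G C]
    [PivotalGGradedCategory G C] [GCrossing G C] [LinearCrossing G C k] [GBraiding G C]
    [GRibbonCategory G C] :
    ∃ F : StrongMonoidalFunctor (DiagramCategory G C) C,
      IsEvaluationFunctor F ∧
      (∀ F' : StrongMonoidalFunctor (DiagramCategory G C) C, IsEvaluationFunctor F' → F' = F) ∧
      (∀ (A B : List (SignedColor G C)) (D E : Diagram A B), ReidemeisterMove D E →
        F.toFunctor.map (ofDiagram D) = F.toFunctor.map (ofDiagram E)) ∧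
      (∀ (A B : List (SignedColor G C)) (D E : Diagram A B), Stabilization D E →
        F.toFunctor.map (ofDiagram D) = F.toFunctor.map (ofDiagram E)) :=
  ⟨evalStrongMonoidalFunctor G C, isEvaluationFunctor_eval, fun _ h => h.eq_eval,
    fun _ _ _ _ h => h.eval_eq, fun _ _ _ _ h => h.eval_eq⟩
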